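/- Let $\kappa,\tau\in\mathbb{R}$. Let $\mathbb{M}^2(\kappa)$ be the complete simply connected surface of constant curvature $\kappa$, and let $\pi\colon\mathbb{E}(\kappa,\tau)\to\mathbb{M}^2(\kappa)$ be the simply connected homogeneous Riemannian 3-manifold that fibers over $\mathbb{M}^2(\kappa)$ with bundle curvature $\tau$. Explicitly, $\mathbb{E}(\kappa,\tau)$ is - for $\kappa\le 0$, the domain $\{1+\frac{\kappa}{4}(x^2+y^2)>0\}\subset\mathbb{R}^3$ with the metric $\lambda^2(dx^2+dy^2)+(dz+\tau\lambda(y\,dx-x\,dy))^2$, $\lambda=(1+\frac{\kappa}{4}(x^2+y^2))^{-1}$, and $\pi(x,y,z)=(x,y)$; - for $\kappa>0$, $\tau=0$, the product $\mathbb{S}^2(\kappa)\times\mathbb{R}$ with its projection onto the first factor; - for $\kappa>0$, $\tau\ne0$, the Berger sphere $\mathbb{S}^3\subset\mathbb{C}^2$ with the metric $\frac{4}{\kappa}\left(\langle X,Y\rangle+\left(\frac{4\tau^2}{\kappa}-1\right)\langle X,V\rangle\langle Y,V\rangle\right)$, $V_{(z,w)}=(iz,iw)$, and $\pi$ the Hopf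 map onto $\mathbb{S}^2(\kappa)$. Let $\gamma\subset\mathbb{M}^2(\kappa)$ be a complete curve (a smooth curve parametrized by arc length on all of $\mathbb{R}$, possibly closed) with constant geodesic curvature $k_\gamma\in\mathbb{R}$, and let $C_\gamma=\pi^{-1}(\gamma)\subset\mathbb{E}(\kappa,\tau)$ be the vertical cylinder over $\gamma$, with the induced metric and a unit normal field $\eta$. Let $L=\Delta+|A|^2+\mathrm{Ric}(\eta)$ be the stability operator of $C_\gamma$, where $\Delta$ is the Laplacian of the induced metric and $A$ is the shape operator. The surface $C_\gamma$ is called stable if $-L$ is nonnegative, that is, if $$\int_{C_\gamma}\left(|\nabla f|^2-(|A|^2+\mathrm{Ric}(\eta))f^2\right)dA\ \ge\ 0\qquad\text{for all } f\in C_0^\infty(C_\gamma).$$ Then: 1. $C_\gamma$ is stable if and only if $\kappa\le -k_\gamma^2$. 2. $L=\Delta+k_\gamma^2+\kappa$ on smooth functions. 3. The induced metric on $C_\gamma$ is flat. -/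

import Mathlib

open Manifold MeasureTheory
open scoped ContDiff

noncomputable section

/-- The Euclidean space `ℝⁿ`, the model space of all manifolds below. -/
abbrev Eu (n : ℕ) : Type := EuclideanSpace ℝ (Fin n)

/-! ### Riemannian geometry in local coordinates

In Mathlib a tangent vector `v : TangentSpace (𝓡 n) p` is the vector of its components in the
preferred chart `chartAt (Eu n) p`. All tensors at `p` are computed in that chart. -/

/-- A field of bilinear forms on the tangent spaces of an `n`-manifold. -/
abbrev MetricTensor (n : ℕ) (M : Type*) [TopologicalSpace M] [ChartedSpace (Eu n) M] :=
  (p : M) → TangentSpace (𝓡 n) p → TangentSpace (𝓡 n) p → ℝ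

/-- The pullback `f^*g`; for an immersion `f` this is the metric induced by `g`. -/
def MetricTensor.pullback {m n : ℕ} {M N : Type*} [TopologicalSpace M] [ChartedSpace (Eu m) M]
    [TopologicalSpace N] [ChartedSpace (Eu n) N] (g : MetricTensor n N) (f : M → N) :
    MetricTensor m M :=
  fun p v w => g (f p) (mfderiv (𝓡 m) (𝓡 n) f p v) (mfderiv (𝓡 m) (𝓡 n) f p w)

/-- The coordinate vector `e_i`. -/
def coordVec {n : ℕ} (i : Fin n) : Eu n := EuclideanSpace.single i 1

/-- The partial derivative `∂_i f`. -/
def pd {n : ℕ} (i : Fin n) (f : Eu n → ℝ) (y : Eu n) : ℝ := fderiv ℝ f y (coordVec i)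

/-- The matrix `g_ij` of a metric at the coordinate point `y`, in the preferred chart of `p`. -/
def metricCoeff {n : ℕ} {M : Type*} [TopologicalSpace M] [ChartedSpace (Eu n) M]
    (g : MetricTensor n M) (p : M) (y : Eu n) : Matrix (Fin n) (Fin n) ℝ :=
  Matrix.of fun i j =>
    g ((chartAt (Eu n) p).symm y)
      (mfderiv (𝓡 n) (𝓡 n) (chartAt (Eu n) p).symm y (coordVec i))
      (mfderiv (𝓡 n) (𝓡 n) (chartAt (Eu n) p).symm y (coordVec j))

/-- The Christoffel symbol `Γ^k_ij` of a metric `G` given in coordinates. -/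
def christoffel {n : ℕ} (G : Eu n → Matrix (Fin n) (Fin n) ℝ) (k i j : Fin n) (y : Eu n) : ℝ :=
  (1 / 2 : ℝ) * ∑ l, (G y)⁻¹ k l *
    (pd i (fun z => G z j l) y + pd j (fun z => G z i l) y - pd l (fun z => G z i j) y)

/-- The Ricci tensor `Ric_ij` of a metric `G` given in coordinates. -/
def ricciCoeff {n : ℕ} (G : Eu n → Matrix (Fin n) (Fin n) ℝ) (i j : Fin n) (y : Eu n) : ℝ :=
  ∑ k, (pd k (christoffel G k i j) y - pd j (christoffel G k i k) y) +
    ∑ k, ∑ l, (christoffel G k k l y * christoffel G l i j y -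
      christoffel G k j l y * christoffel G l i k y)

/-- `Ric(v) = Ric(v, v)` for a tangent vector `v` at `p`. -/
def ricci {n : ℕ} {M : Type*} [TopologicalSpace M] [ChartedSpace (Eu n) M]
    (g : MetricTensor n M) (p : M) (v : TangentSpace (𝓡 n) p) : ℝ :=
  let c : Eu n := v
  ∑ i, ∑ j, ricciCoeff (metricCoeff g p) i j (chartAt (Eu n) p p) * c i * c j

/-- The Laplacian `Δ f = g^ij (∂_i ∂_j f - Γ^k_ij ∂_k f)` of the metric `g` at `p`. -/
def laplacian {n : ℕ} {M : Type*} [TopologicalSpace M] [ChartedSpace (Eu n) M]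
    (g : MetricTensor n M) (f : M → ℝ) (p : M) : ℝ :=
  let G := metricCoeff g p
  let u := chartAt (Eu n) p p
  let F : Eu n → ℝ := f ∘ (chartAt (Eu n) p).symm
  ∑ i, ∑ j, (G u)⁻¹ i j * (pd i (pd j F) u - ∑ k, christoffel G k i j u * pd k F u)

/-- `|∇ f|² = g^ij ∂_i f ∂_j f` at `p`. -/
def gradSq {n : ℕ} {M : Type*} [TopologicalSpace M] [ChartedSpace (Eu n) M]
    (g : MetricTensor n M) (f : M → ℝ) (p : M) : ℝ :=
  let u := chartAt (Eu n) p p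
  let F : Eu n → ℝ := f ∘ (chartAt (Eu n) p).symm
  ∑ i, ∑ j, (metricCoeff g p u)⁻¹ i j * pd i F u * pd j F u

/-- The Riemannian measure (length, area, volume): the smallest measure which is at least
`√(det g_ij) dy` on each coordinate domain. On a manifold with countable basis it agrees
with `√(det g_ij) dy` on each of them. -/
def riemannianMeasure {n : ℕ} {M : Type*} [TopologicalSpace M] [ChartedSpace (Eu n) M]
    [MeasurableSpace M] (g : MetricTensor n M) : Measure M :=
  ⨆ p : M, Measure.map (chartAt (Eu n) p).symm
    ((volume.restrict (chartAt (Eu n) p).target).withDensity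
      fun y => ENNReal.ofReal (Real.sqrt (metricCoeff g p y).det))

/-- The Euclidean metric of `ℝⁿ`. -/
def euclideanMetric (n : ℕ) : MetricTensor n (Eu n) := fun _ (v w : Eu n) => inner ℝ v w

/-- A metric is flat if it is locally isometric to Euclidean space. -/
def IsFlatMetric {n : ℕ} {M : Type*} [TopologicalSpace M] [ChartedSpace (Eu n) M]
    (g : MetricTensor n M) : Prop :=
  ∀ p : M, ∃ U : Set M, IsOpen U ∧ p ∈ U ∧ ∃ Y : M → Eu n, ContMDiffOn (𝓡 n) (𝓡 n) ∞ Y U ∧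
    ∀ q ∈ U, g q = (euclideanMetric n).pullback Y q

/-! ### Surfaces in a 3-manifold: second fundamental form and stability operator -/

section Surfaces

variable {S N : Type*} [TopologicalSpace S] [ChartedSpace (Eu 2) S]
  [TopologicalSpace N] [ChartedSpace (Eu 3) N]

/-- `η` is a unit normal field along the immersion `x` into `(N, g)`. -/
def IsUnitNormal (g : MetricTensor 3 N) (x : S → N)
    (η : (p : S) → TangentSpace (𝓡 3) (x p)) : Prop :=
  ∀ p, g (x p) (η p) (η p) = 1 ∧
    ∀ v : TangentSpace (𝓡 2) p, g (x p) (η p) (mfderiv (𝓡 2) (𝓡 3) x p v) = 0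

/-- The matrix of the second fundamental form at `p`,
`II_ij = ⟨∇_{∂_i} ∂_j x, η⟩ = g_ab (∂_i ∂_j x^a + Γ^a_cd ∂_i x^c ∂_j x^d) η^b`. -/
def secondFF (g : MetricTensor 3 N) (x : S → N) (η : (p : S) → TangentSpace (𝓡 3) (x p))
    (p : S) : Matrix (Fin 2) (Fin 2) ℝ :=
  let u := chartAt (Eu 2) p p
  let X : Fin 3 → Eu 2 → ℝ := fun a y => chartAt (Eu 3) (x p) (x ((chartAt (Eu 2) p).symm y)) a
  let G := metricCoeff g (x p)
  let z := chartAt (Eu 3) (x p) (x p)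
  let ν : Eu 3 := η p
  Matrix.of fun i j => ∑ a, ∑ b, G z a b *
    (pd i (pd j (X a)) u + ∑ c, ∑ d, christoffel G a c d z * pd i (X c) u * pd j (X d) u) * ν b

/-- The matrix of the shape operator `A` at `p`, that is `(g_ij)⁻¹ (II_ij)`. -/
def shapeOp (g : MetricTensor 3 N) (x : S → N) (η : (p : S) → TangentSpace (𝓡 3) (x p))
    (p : S) : Matrix (Fin 2) (Fin 2) ℝ :=
  (metricCoeff (g.pullback x : MetricTensor 2 S) p (chartAt (Eu 2) p p))⁻¹ * secondFF g x η p

/-- `q = |A|² + Ric(η)`, where `|A|² = tr(A²)`. -/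
def stabilityPotential (g : MetricTensor 3 N) (x : S → N)
    (η : (p : S) → TangentSpace (𝓡 3) (x p)) (p : S) : ℝ :=
  (shapeOp g x η p * shapeOp g x η p).trace + ricci g (x p) (η p)

/-- The stability operator `L f = Δ f + (|A|² + Ric(η)) f`, with `Δ` the Laplacian of the
induced metric. -/
def stabilityOperator (g : MetricTensor 3 N) (x : S → N)
    (η : (p : S) → TangentSpace (𝓡 3) (x p)) (f : S → ℝ) (p : S) : ℝ :=
  laplacian (g.pullback x : MetricTensor 2 S) f p + stabilityPotential g x η p * f p

/-- Stability: `-L` is nonnegative, that is `∫ (|∇ f|² - q f²) dA ≥ 0` for every smooth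
compactly supported `f`. -/
def IsStableSurface [MeasurableSpace S] (g : MetricTensor 3 N) (x : S → N)
    (η : (p : S) → TangentSpace (𝓡 3) (x p)) : Prop :=
  ∀ f : S → ℝ, ContMDiff (𝓡 2) 𝓘(ℝ, ℝ) ∞ f → HasCompactSupport f →
    0 ≤ ∫ p, (gradSq (g.pullback x : MetricTensor 2 S) f p - stabilityPotential g x η p * f p ^ 2)
      ∂(riemannianMeasure (g.pullback x : MetricTensor 2 S))

end Surfaces

/-! ### The surface `𝕄²(κ)` and its curves

`𝕄²(κ)` is the quadric `κ (x² + y²) + w² = 1` of `ℝ³` (with `w > 0` when `κ ≤ 0`) with the metric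
`dx² + dy² + κ⁻¹ dw²`: the round sphere of radius `1/√κ` if `κ > 0`, the plane `w = 1` if `κ = 0`
(where `κ⁻¹ = 0` in Lean, and `dw = 0` on the plane anyway), and the hyperboloid model of the
hyperbolic plane of curvature `κ` if `κ < 0`. -/

/-- The points of `𝕄²(κ)`. -/
def spaceForm (κ : ℝ) : Set (Eu 3) :=
  {P | κ * (P 0 ^ 2 + P 1 ^ 2) + P 2 ^ 2 = 1 ∧ (κ ≤ 0 → 0 < P 2)}

/-- The metric of `𝕄²(κ)`. -/
def spaceFormInner (κ : ℝ) (v w : Eu 3) : ℝ := v 0 * w 0 + v 1 * w 1 + κ⁻¹ * (v 2 * w 2)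

/-- `v` is tangent to `𝕄²(κ)` at `P`. -/
def IsTangentTo (κ : ℝ) (P v : Eu 3) : Prop := κ * (P 0 * v 0 + P 1 * v 1) + P 2 * v 2 = 0

/-- A complete curve in `𝕄²(κ)`: smooth, defined on all of `ℝ`, parametrized by arc length
(injectivity is not required, so that closed curves are covered). -/
def IsCompleteCurve (κ : ℝ) (γ : ℝ → Eu 3) : Prop :=
  ContDiff ℝ ∞ γ ∧ ∀ s, γ s ∈ spaceForm κ ∧ spaceFormInner κ (deriv γ s) (deriv γ s) = 1

/-- The covariant derivative `∇_{γ'} γ'` in `𝕄²(κ)`: the component of `γ''` tangent to the quadric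
(the normal line at `P` is spanned by `P` if `κ ≠ 0`; for `κ = 0` this is `γ''`). -/
def covariantAcceleration (κ : ℝ) (γ : ℝ → Eu 3) (s : ℝ) : Eu 3 :=
  deriv (deriv γ) s + (κ * spaceFormInner κ (deriv γ s) (deriv γ s)) • γ s

/-- The curve `γ`, parametrized by arc length, has constant geodesic curvature `k`:
`∇_{γ'} γ' = k n`, with `n` a unit normal of `γ` in `𝕄²(κ)`. -/
def HasGeodesicCurvature (κ : ℝ) (γ : ℝ → Eu 3) (k : ℝ) : Prop :=
  ∀ s, ∃ n : Eu 3, IsTangentTo κ (γ s) n ∧ spaceFormInner κ n n = 1 ∧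
    spaceFormInner κ n (deriv γ s) = 0 ∧ covariantAcceleration κ γ s = k • n

/-! ### The homogeneous spaces `𝔼(κ, τ)` -/

/-- A 3-manifold with a metric and a projection to `ℝ³`. -/
structure FiberedThreeSpace where
  carrier : Type
  [top : TopologicalSpace carrier]
  [charted : ChartedSpace (Eu 3) carrier]
  [isManifold : IsManifold (𝓡 3) ∞ carrier]
  metric : MetricTensor 3 carrier
  proj : carrier → Eu 3

attribute [instance] FiberedThreeSpace.top FiberedThreeSpace.charted FiberedThreeSpace.isManifold

/-- `λ = 1 / (1 + (κ/4) (x² + y²))`. -/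
def conformalFactor (κ : ℝ) (P : Eu 3) : ℝ := (1 + κ / 4 * (P 0 ^ 2 + P 1 ^ 2))⁻¹

/-- The domain `1 + (κ/4) (x² + y²) > 0` of `ℝ³` (a round open disk times `ℝ` if `κ < 0`). -/
def cartanDomain (κ : ℝ) : TopologicalSpace.Opens (Eu 3) :=
  ⟨{P | 0 < 1 + κ / 4 * (P 0 ^ 2 + P 1 ^ 2)}, isOpen_lt continuous_const (by fun_prop)⟩

/-- The metric `λ² (dx² + dy²) + (dz + τ λ (y dx - x dy))²`. -/
def cartanMetric (κ τ : ℝ) : MetricTensor 3 (Eu 3) := fun P (v w : Eu 3) =>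
  conformalFactor κ P ^ 2 * (v 0 * w 0 + v 1 * w 1) +
    (v 2 + τ * conformalFactor κ P * (P 1 * v 0 - P 0 * v 1)) *
      (w 2 + τ * conformalFactor κ P * (P 1 * w 0 - P 0 * w 1))

/-- `𝔼(κ, τ)` for `κ ≤ 0`: the Cartan model. The projection is `(x, y, z) ↦ (x, y)`, followed by
the isometry of the conformal disk (plane) model of `𝕄²(κ)` with the quadric. -/
def cartanSpace (κ τ : ℝ) : FiberedThreeSpace where
  carrier := cartanDomain κ
  metric := (cartanMetric κ τ).pullback Subtype.val
  proj := fun P => !₂[conformalFactor κ P * P.1 0, conformalFactor κ P * P.1 1,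
    conformalFactor κ P * (1 - κ / 4 * (P.1 0 ^ 2 + P.1 1 ^ 2))]

/-- `ℝ³` without the origin. -/
def puncturedSpace : TopologicalSpace.Opens (Eu 3) := ⟨{0}ᶜ, isOpen_compl_singleton⟩

/-- The metric `(dx² + dy² + dz²) / (κ (x² + y² + z²))`. -/
def conicalMetric (κ : ℝ) : MetricTensor 3 (Eu 3) := fun P (v w : Eu 3) =>
  (κ * ‖P‖ ^ 2)⁻¹ * inner ℝ v w

/-- `𝔼(κ, 0) = 𝕊²(κ) × ℝ` for `κ > 0`, in polar coordinates: with `P = e^{√κ t} θ`, `|θ| = 1`, the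
metric `|dP|² / (κ |P|²)` of `ℝ³ ∖ {0}` is `κ⁻¹ |dθ|² + dt²`. The projection is
`(θ, t) ↦ θ`, with `θ` regarded as a point of the quadric. -/
def productSpace (κ : ℝ) : FiberedThreeSpace where
  carrier := puncturedSpace
  metric := (conicalMetric κ).pullback Subtype.val
  proj := fun P => !₂[P.1 0 / (Real.sqrt κ * ‖P.1‖), P.1 1 / (Real.sqrt κ * ‖P.1‖), P.1 2 / ‖P.1‖]

/-- The vector field `V = (i z, i w)` of `ℂ² = ℝ⁴`, where `(z, w) = (P₀ + i P₁, P₂ + i P₃)`. -/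
def hopfField (P : Eu 4) : Eu 4 := !₂[-P 1, P 0, -P 3, P 2]

/-- The bilinear forms `(4/κ) (⟨X, Y⟩ + (4τ²/κ - 1) ⟨X, V⟩ ⟨Y, V⟩)` on `ℝ⁴`. -/
def bergerForm (κ τ : ℝ) : MetricTensor 4 (Eu 4) := fun P (v w : Eu 4) =>
  4 / κ * (inner ℝ v w +
    (4 * τ ^ 2 / κ - 1) * (inner ℝ v (hopfField P) * inner ℝ w (hopfField P)))

/-- `𝔼(κ, τ)` for `κ > 0` and `τ ≠ 0`: the Berger sphere, that is the unit sphere of `ℂ²` with the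
metric above. The projection is the Hopf map `(z, w) ↦ (2 z w̄ / √κ, |z|² - |w|²)`. -/
def bergerSphere (κ τ : ℝ) : FiberedThreeSpace where
  carrier := Metric.sphere (0 : Eu 4) 1
  isManifold := IsManifold.of_le (n := ω) le_top
  metric := (bergerForm κ τ).pullback Subtype.val
  proj := fun P => !₂[2 * (P.1 0 * P.1 2 + P.1 1 * P.1 3) / Real.sqrt κ,
    2 * (P.1 1 * P.1 2 - P.1 0 * P.1 3) / Real.sqrt κ,
    P.1 0 ^ 2 + P.1 1 ^ 2 - P.1 2 ^ 2 - P.1 3 ^ 2]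

open Classical in
/-- The homogeneous space `𝔼(κ, τ)` with its Riemannian submersion `π` onto `𝕄²(κ)`. -/
def homogeneousSpace (κ τ : ℝ) : FiberedThreeSpace :=
  if κ ≤ 0 then cartanSpace κ τ else if τ = 0 then productSpace κ else bergerSphere κ τ

end

/-! Around each point of the cylinder there are Fermi coordinates `(s, r, t)`, with `r` the signed
distance to the cylinder, in which the ambient metric is `dr² + c(r)² ds² + (dt + a(r) ds)²`. Here
`c'' = -κ c`, `a' = 2 τ c`, `c(0) = 1`, `c'(0) = -k`, `a(0) = 0`, and the cylinder is `r = 0`.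
Everything local follows. The induced metric is `ds² + dt²`, hence flat. The second fundamental form
is, up to the sign of the normal, the matrix with rows `(k, -τ)` and `(-τ, 0)`, so `|A|² = k² +
2τ²`. The Ricci curvature of the normal is `κ - 2τ²`. The torsion `τ` cancels in the sum, which is
the constant `k² + κ` (`stabilityPotential_eq`, `exists_flatChart`). Since tensors are defined
through preferred charts, the Christoffel symbols and the Ricci form must be carried to Fermi
coordinates; this is `christoffel_ricci_pullback`.

If `k² + κ ≤ 0`, the integrand of the stability form is nonnegative at every point. If `q = k² + κ >
0`, the Frenet equations show that `γ` is periodic (`IsFrenetCurve.isCompact_range`). In the Berger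
sphere the cylinder is then compact, and the constant function `1` has negative energy. In the other
spaces a vertical translation acts on the cylinder with compact slabs. A cutoff in the height has
gradient only in two end slabs, so its Dirichlet energy is bounded, while its mass grows linearly
with the number of slabs (`exists_unstable_of_height`).

The Fermi coordinates are constructed explicitly in the Cartan model (`exists_cartanParam`): normal
geodesics of the base quadric are lifted by stereographic projection, and the vertical coordinate is
the primitive of a closed 1-form. For `κ > 0` the Cartan formulas, defined on all of `ℝ³`, are
mapped by local isometries into the product or the Berger sphere. The fibre over the pole that
stereographic projection misses is reached after a half turn of the base. -/

noncomputable section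

open Filter
open scoped Topology

/-! ### Behaviour of the Levi-Civita connection and its curvature under a change of coordinates -/

section Koszul

variable {E F : Type*} [NormedAddCommGroup E] [NormedSpace ℝ E]
  [NormedAddCommGroup F] [NormedSpace ℝ F]

/-- The right-hand side of the Koszul formula for constant vector fields. -/
def koszul (g : E → E →L[ℝ] E →L[ℝ] ℝ) (y u v w : E) : ℝ :=
  1 / 2 * (fderiv ℝ (fun x => g x v w) y u + fderiv ℝ (fun x => g x u w) y v
    - fderiv ℝ (fun x => g x u v) y w)

/-- The curvature of a connection `D + Γ`. -/
def curvatureOf (Γ : E → E →L[ℝ] E →L[ℝ] E) (y u v w : E) : E :=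
  fderiv ℝ (fun x => Γ x v w) y u - fderiv ℝ (fun x => Γ x u w) y v
    + Γ y u (Γ y v w) - Γ y v (Γ y u w)

/-- The product rule with all three slots varying. The derivative of `B` is taken with the vectors
frozen at `p y` and `q y`, which is how `koszul` and `curvatureOf` differentiate. -/
lemma hasFDerivAt_bilinear_comp {G : Type*} [NormedAddCommGroup G] [NormedSpace ℝ G]
    {θ : E → F} {B : F → F →L[ℝ] F →L[ℝ] G} {y : E} {p q : E → F} {p' q' : E →L[ℝ] F}
    (hθ : DifferentiableAt ℝ θ y) (hB : DifferentiableAt ℝ B (θ y))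
    (hp : HasFDerivAt p p' y) (hq : HasFDerivAt q q' y) (u : E) :
    fderiv ℝ (fun x => B (θ x) (p x) (q x)) y u =
      fderiv ℝ (fun x => B x (p y) (q y)) (θ y) (fderiv ℝ θ y u)
        + B (θ y) (p' u) (q y) + B (θ y) (p y) (q' u) := by
  have h1 : HasFDerivAt (fun x => B (θ x)) ((fderiv ℝ B (θ y)).comp (fderiv ℝ θ y)) y :=
    HasFDerivAt.comp (g := B) (f := θ) y hB.hasFDerivAt hθ.hasFDerivAt
  have h2 := ((h1.clm_apply hp).clm_apply hq).fderiv
  rw [h2]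
  have h3 := ((hB.hasFDerivAt.clm_apply (hasFDerivAt_const (p y) (θ y))).clm_apply
    (hasFDerivAt_const (q y) (θ y))).fderiv
  rw [h3]
  simp
  abel

/-- Differentiating the pulled back metric produces six terms with second derivatives of `θ`. By
symmetry of `D²θ` and of `g'`, four cancel in pairs and the remaining two are equal, which the
factor `1/2` absorbs. The surviving term is the inhomogeneous part of the transformation law of a
connection. -/
lemma koszul_pullback {g : E → E →L[ℝ] E →L[ℝ] ℝ} {g' : F → F →L[ℝ] F →L[ℝ] ℝ} {θ : E → F} {y : E}
    (hθ : ContDiffAt ℝ 2 θ y) (hg' : DifferentiableAt ℝ g' (θ y))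
    (hsymm : ∀ v w, g' (θ y) v w = g' (θ y) w v)
    (hg : ∀ᶠ x in 𝓝 y, ∀ v w, g x v w = g' (θ x) (fderiv ℝ θ x v) (fderiv ℝ θ x w)) (u v w : E) :
    koszul g y u v w =
      koszul g' (θ y) (fderiv ℝ θ y u) (fderiv ℝ θ y v) (fderiv ℝ θ y w)
        + g' (θ y) (fderiv ℝ (fderiv ℝ θ) y u v) (fderiv ℝ θ y w) := by
  have hd : DifferentiableAt ℝ (fderiv ℝ θ) y :=
    (hθ.fderiv_right (m := 1) (by norm_num)).differentiableAt (by norm_num)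
  have hdv : ∀ a, HasFDerivAt (fun x => fderiv ℝ θ x a) ((fderiv ℝ (fderiv ℝ θ) y).flip a) y :=
    fun a => by
      have := hd.hasFDerivAt.clm_apply (hasFDerivAt_const a y)
      convert this using 1
      ext; simp
  have hs : ∀ a b, fderiv ℝ (fderiv ℝ θ) y a b = fderiv ℝ (fderiv ℝ θ) y b a := fun a b =>
    (hθ.isSymmSndFDerivAt (by simp)) a b
  have key : ∀ a b c, fderiv ℝ (fun x => g x b c) y a =
      fderiv ℝ (fun x => g' x (fderiv ℝ θ y b) (fderiv ℝ θ y c)) (θ y) (fderiv ℝ θ y a)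
        + g' (θ y) (fderiv ℝ (fderiv ℝ θ) y a b) (fderiv ℝ θ y c)
        + g' (θ y) (fderiv ℝ θ y b) (fderiv ℝ (fderiv ℝ θ) y a c) := by
    intro a b c
    have h1 : (fun x => g x b c) =ᶠ[𝓝 y]
        fun x => g' (θ x) (fderiv ℝ θ x b) (fderiv ℝ θ x c) := by
      filter_upwards [hg] with x hx using hx b c
    rw [h1.fderiv_eq, hasFDerivAt_bilinear_comp (hθ.differentiableAt (by norm_num)) hg'
      (hdv b) (hdv c)]
    simp
  unfold koszul
  rw [key u v w, key v u w, key w u v, hs v u, hs w u, hs w v,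
    hsymm (fderiv ℝ θ y v), hsymm (fderiv ℝ θ y u) (fderiv ℝ (fderiv ℝ θ) y v w)]
  ring

/-- Surjectivity of `Dθ` makes every test vector of the form `Dθ w`, so the Koszul identities
determine `Dθ (Γ u v)` by nondegeneracy of `g'`. -/
lemma connection_pullback {g : E → E →L[ℝ] E →L[ℝ] ℝ} {g' : F → F →L[ℝ] F →L[ℝ] ℝ} {θ : E → F}
    {Γ : E → E →L[ℝ] E →L[ℝ] E} {Γ' : F → F →L[ℝ] F →L[ℝ] F} {y : E}
    (hθ : ContDiffAt ℝ 2 θ y) (hsurj : Function.Surjective (fderiv ℝ θ y))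
    (hg' : DifferentiableAt ℝ g' (θ y))
    (hsymm : ∀ v w, g' (θ y) v w = g' (θ y) w v)
    (hnd : ∀ v, (∀ w, g' (θ y) v w = 0) → v = 0)
    (hg : ∀ᶠ x in 𝓝 y, ∀ v w, g x v w = g' (θ x) (fderiv ℝ θ x v) (fderiv ℝ θ x w))
    (hΓ : ∀ u v w, g y (Γ y u v) w = koszul g y u v w)
    (hΓ' : ∀ u v w, g' (θ y) (Γ' (θ y) u v) w = koszul g' (θ y) u v w) (u v : E) :
    fderiv ℝ θ y (Γ y u v) = fderiv ℝ (fderiv ℝ θ) y u v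
      + Γ' (θ y) (fderiv ℝ θ y u) (fderiv ℝ θ y v) := by
  rw [← sub_eq_zero]
  apply hnd
  intro w'
  obtain ⟨w, rfl⟩ := hsurj w'
  have h1 := koszul_pullback hθ hg' hsymm hg u v w
  rw [← hΓ, hg.self_of_nhds, ← hΓ'] at h1
  simp only [map_sub, map_add, sub_apply, add_apply, h1]
  ring

/-- Tensoriality of curvature, obtained by differentiating the transformation law once more and
antisymmetrizing. No metric is involved, only the law and the symmetry of `Γ'`. -/
lemma curvatureOf_pullback {θ : E → F} {Γ : E → E →L[ℝ] E →L[ℝ] E} {Γ' : F → F →L[ℝ] F →L[ℝ] F}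
    {y : E} (hθ : ContDiffAt ℝ 3 θ y) (hdΓ : DifferentiableAt ℝ Γ y)
    (hdΓ' : DifferentiableAt ℝ Γ' (θ y)) (hsymm : ∀ u v, Γ' (θ y) u v = Γ' (θ y) v u)
    (h : ∀ᶠ x in 𝓝 y, ∀ u v, fderiv ℝ θ x (Γ x u v) = fderiv ℝ (fderiv ℝ θ) x u v
      + Γ' (θ x) (fderiv ℝ θ x u) (fderiv ℝ θ x v)) (u v w : E) :
    fderiv ℝ θ y (curvatureOf Γ y u v w) =
      curvatureOf Γ' (θ y) (fderiv ℝ θ y u) (fderiv ℝ θ y v) (fderiv ℝ θ y w) := by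
  have hθ2 : ContDiffAt ℝ 2 (fderiv ℝ θ) y := hθ.fderiv_right (by norm_num)
  have hd : DifferentiableAt ℝ (fderiv ℝ θ) y := hθ2.differentiableAt (by norm_num)
  have hdd : DifferentiableAt ℝ (fderiv ℝ (fderiv ℝ θ)) y :=
    (hθ2.fderiv_right (m := 1) (by norm_num)).differentiableAt (by norm_num)
  have hdv : ∀ a, HasFDerivAt (fun x => fderiv ℝ θ x a) ((fderiv ℝ (fderiv ℝ θ) y).flip a) y :=
    fun a => by
      have := hd.hasFDerivAt.clm_apply (hasFDerivAt_const a y)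
      convert this using 1
      ext; simp
  have hs : ∀ a b, fderiv ℝ (fderiv ℝ θ) y a b = fderiv ℝ (fderiv ℝ θ) y b a := fun a b =>
    ((hθ.of_le (by norm_num : (2 : WithTop ℕ∞) ≤ 3)).isSymmSndFDerivAt (by simp)) a b
  have hs3 : ∀ a b c, fderiv ℝ (fderiv ℝ (fderiv ℝ θ)) y a b c =
      fderiv ℝ (fderiv ℝ (fderiv ℝ θ)) y b a c := fun a b c =>
    congrArg (fun L => L c) ((hθ2.isSymmSndFDerivAt (by simp)) a b)
  -- The derivative in direction `a` of the transformation law evaluated on the constant vectors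
  -- `b`, `c`.
  have key : ∀ a b c, fderiv ℝ (fderiv ℝ θ) y a (Γ y b c)
        + fderiv ℝ θ y (fderiv ℝ (fun x => Γ x b c) y a) =
      fderiv ℝ (fderiv ℝ (fderiv ℝ θ)) y a b c
        + (fderiv ℝ (fun x => Γ' x (fderiv ℝ θ y b) (fderiv ℝ θ y c)) (θ y) (fderiv ℝ θ y a)
          + Γ' (θ y) (fderiv ℝ (fderiv ℝ θ) y a b) (fderiv ℝ θ y c)
          + Γ' (θ y) (fderiv ℝ θ y b) (fderiv ℝ (fderiv ℝ θ) y a c)) := by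
    intro a b c
    have hΓbc : DifferentiableAt ℝ (fun x => Γ x b c) y := by fun_prop
    have e1 := (hd.hasFDerivAt.clm_apply hΓbc.hasFDerivAt).fderiv
    have h1 : (fun x => fderiv ℝ θ x (Γ x b c)) =ᶠ[𝓝 y] fun x => fderiv ℝ (fderiv ℝ θ) x b c
        + Γ' (θ x) (fderiv ℝ θ x b) (fderiv ℝ θ x c) := by
      filter_upwards [h] with x hx using hx b c
    rw [h1.fderiv_eq] at e1
    have e2 : DifferentiableAt ℝ (fun x => fderiv ℝ (fderiv ℝ θ) x b c) y := by fun_prop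
    have hθ1 := hθ.differentiableAt (by norm_num)
    have hΓθ : DifferentiableAt ℝ (fun x => Γ' (θ x)) y :=
      DifferentiableAt.comp (g := Γ') (f := θ) y hdΓ' hθ1
    have e3 : DifferentiableAt ℝ (fun x => Γ' (θ x) (fderiv ℝ θ x b) (fderiv ℝ θ x c)) y :=
      (hΓθ.clm_apply (hdv b).differentiableAt).clm_apply (hdv c).differentiableAt
    rw [fderiv_fun_add e2 e3] at e1
    have e4 := congrArg (fun L => L a) e1
    simp only [add_apply] at e4
    rw [hasFDerivAt_bilinear_comp hθ1 hdΓ' (hdv b) (hdv c)] at e4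
    have e5 := ((hdd.hasFDerivAt.clm_apply (hasFDerivAt_const b y)).clm_apply
      (hasFDerivAt_const c y)).fderiv
    rw [e5] at e4
    simp at e4
    rw [e4]
    abel
  have law := h.self_of_nhds
  unfold curvatureOf
  have k1 := key u v w
  have k2 := key v u w
  -- The quadratic terms `Γ(u, Γ(v, w))` are transformed by applying the law twice; the resulting
  -- `D²θ` terms match those in `k1` and `k2`.
  have l1 := law u (Γ y v w)
  have l2 := law v (Γ y u w)
  rw [law v w, map_add] at l1
  rw [law u w, map_add] at l2
  rw [hs3 v u w, hs v u] at k2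
  rw [hsymm (fderiv ℝ θ y u) (fderiv ℝ (fderiv ℝ θ) y v w)] at l1 k2
  rw [hsymm (fderiv ℝ θ y v) (fderiv ℝ (fderiv ℝ θ) y u w)] at l2 k1
  simp only [map_add, map_sub, l1, l2]
  rw [← sub_eq_zero] at k1 k2 ⊢
  -- In the difference the third derivatives of `θ` cancel, since `hs3` has given them the same form
  -- in both identities.
  have := congrArg₂ (fun a b => a - b) k1 k2
  simp only [sub_zero] at this
  rw [← this]
  abel

end Koszul

/-! ### Bilinear forms from coefficients -/

section Coefficients

variable {n : ℕ} {F : Type*} [NormedAddCommGroup F] [NormedSpace ℝ F]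

/-- The bilinear map with the coefficients `c i j`. -/
def bilOf (c : Fin n → Fin n → F) : Eu n →L[ℝ] Eu n →L[ℝ] F :=
  ∑ i, ∑ j, ContinuousLinearMap.smulRight (EuclideanSpace.proj i : Eu n →L[ℝ] ℝ)
    (ContinuousLinearMap.smulRight (EuclideanSpace.proj j : Eu n →L[ℝ] ℝ) (c i j))

lemma bilOf_apply (c : Fin n → Fin n → F) (u v : Eu n) :
    bilOf c u v = ∑ i, ∑ j, (u i * v j) • c i j := by
  simp [bilOf, smul_smul]

lemma bilOf_coordVec (c : Fin n → Fin n → F) (i j : Fin n) :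
    bilOf c (coordVec i) (coordVec j) = c i j := by
  rw [bilOf_apply, Finset.sum_eq_single i, Finset.sum_eq_single j]
  all_goals simp +contextual [coordVec]

lemma differentiableAt_smulRight {E H : Type*} [NormedAddCommGroup E] [NormedSpace ℝ E]
    [NormedAddCommGroup H] [NormedSpace ℝ H] (L : H →L[ℝ] ℝ) {f : E → F} {y : E}
    (hf : DifferentiableAt ℝ f y) :
    DifferentiableAt ℝ (fun x => ContinuousLinearMap.smulRight L (f x)) y := by
  have h : HasFDerivAt (fun x => ContinuousLinearMap.smulRightL ℝ H F L (f x)) _ y :=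
    (ContinuousLinearMap.smulRightL ℝ H F L).hasFDerivAt.comp y hf.hasFDerivAt
  exact h.differentiableAt

lemma differentiableAt_bilOf {E : Type*} [NormedAddCommGroup E] [NormedSpace ℝ E]
    {c : E → Fin n → Fin n → F} {y : E}
    (h : ∀ i j, DifferentiableAt ℝ (fun x => c x i j) y) :
    DifferentiableAt ℝ (fun x => bilOf (c x)) y := by
  unfold bilOf
  have h2 : ∀ i j, DifferentiableAt ℝ (fun x => ContinuousLinearMap.smulRight
      (EuclideanSpace.proj i : Eu n →L[ℝ] ℝ) (ContinuousLinearMap.smulRight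
        (EuclideanSpace.proj j : Eu n →L[ℝ] ℝ) (c x i j))) y := fun i j =>
    differentiableAt_smulRight _ (differentiableAt_smulRight _ (h i j))
  exact DifferentiableAt.fun_sum (𝕜 := ℝ) (E := E) (F := Eu n →L[ℝ] Eu n →L[ℝ] F) fun i _ =>
    DifferentiableAt.fun_sum (𝕜 := ℝ) (E := E) (F := Eu n →L[ℝ] Eu n →L[ℝ] F) fun j _ => h2 i j

lemma eu_sum_coordVec (v : Eu n) : v = ∑ i, v i • coordVec i := by
  ext j
  simp [coordVec, Pi.single_apply]

lemma clm_apply_eq_sum (L : Eu n →L[ℝ] F) (v : Eu n) : L v = ∑ i, v i • L (coordVec i) := by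
  conv_lhs => rw [eu_sum_coordVec v]
  simp

/-- The metric with the coefficients `G`, as a field of bilinear forms. -/
def metricForm (G : Eu n → Matrix (Fin n) (Fin n) ℝ) (y : Eu n) : Eu n →L[ℝ] Eu n →L[ℝ] ℝ :=
  bilOf fun i j => G y i j

/-- The Christoffel symbols as a field of bilinear maps. -/
def christoffelForm (G : Eu n → Matrix (Fin n) (Fin n) ℝ) (y : Eu n) :
    Eu n →L[ℝ] Eu n →L[ℝ] Eu n :=
  bilOf fun i j => WithLp.toLp 2 fun k => christoffel G k i j y

lemma christoffelForm_coordVec (G : Eu n → Matrix (Fin n) (Fin n) ℝ) (y : Eu n) (i j k : Fin n) :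
    christoffelForm G y (coordVec i) (coordVec j) k = christoffel G k i j y := by
  rw [christoffelForm, bilOf_coordVec]

lemma christoffelForm_apply (G : Eu n → Matrix (Fin n) (Fin n) ℝ) (y u v : Eu n) (k : Fin n) :
    christoffelForm G y u v k = ∑ i, ∑ j, u i * v j * christoffel G k i j y := by
  rw [christoffelForm, bilOf_apply]
  simp

lemma metricForm_apply (G : Eu n → Matrix (Fin n) (Fin n) ℝ) (y u v : Eu n) :
    metricForm G y u v = ∑ i, ∑ j, u i * v j * G y i j := by
  simp [metricForm, bilOf_apply]

lemma metricForm_coordVec (G : Eu n → Matrix (Fin n) (Fin n) ℝ) (y : Eu n) (i j : Fin n) :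
    metricForm G y (coordVec i) (coordVec j) = G y i j := bilOf_coordVec _ i j

/-- The Christoffel symbols satisfy the Koszul formula. -/
lemma metricForm_christoffelForm {G : Eu n → Matrix (Fin n) (Fin n) ℝ} {y : Eu n}
    (hG : ∀ i j, DifferentiableAt ℝ (fun x => G x i j) y) (hsymm : (G y).IsSymm)
    (hdet : IsUnit (G y).det) (u v w : Eu n) :
    metricForm G y (christoffelForm G y u v) w = koszul (metricForm G) y u v w := by
  have hd : DifferentiableAt ℝ (metricForm G) y := differentiableAt_bilOf hG
  have hk : ∀ u v w, koszul (metricForm G) y u v w = 1 / 2 * (fderiv ℝ (metricForm G) y u v w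
      + fderiv ℝ (metricForm G) y v u w - fderiv ℝ (metricForm G) y w u v) := by
    intro u v w
    have : ∀ a b c, fderiv ℝ (fun x => metricForm G x a b) y c = fderiv ℝ (metricForm G) y c a b := by
      intro a b c
      rw [((hd.hasFDerivAt.clm_apply (hasFDerivAt_const a y)).clm_apply
        (hasFDerivAt_const b y)).fderiv]
      simp
    simp only [koszul, this]
  -- By `hk` the Koszul expression is linear in each vector, as is the left side, so it suffices to
  -- compare on coordinate vectors and then extend one slot at a time.
  have basis : ∀ i j l, metricForm G y (christoffelForm G y (coordVec i) (coordVec j)) (coordVec l) =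
      koszul (metricForm G) y (coordVec i) (coordVec j) (coordVec l) := by
    intro i j l
    rw [clm_apply_eq_sum (metricForm G y)]
    simp only [sum_apply, smul_apply, metricForm_coordVec, smul_eq_mul, christoffelForm_coordVec,
      koszul]
    change ∑ a, christoffel G a i j y * G y a l = 1 / 2 * (pd i (fun z => G z j l) y
      + pd j (fun z => G z i l) y - pd l (fun z => G z i j) y)
    unfold christoffel
    generalize hT : (fun m => pd i (fun z => G z j m) y + pd j (fun z => G z i m) y
      - pd m (fun z => G z i j) y) = t
    have hT' : ∀ m, pd i (fun z => G z j m) y + pd j (fun z => G z i m) y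
      - pd m (fun z => G z i j) y = t m := fun m => congrFun hT m
    simp only [hT']
    -- Lowering the upper index of the Christoffel symbol cancels the inverse metric in its
    -- definition.
    have h1 : (G y).mulVec ((G y)⁻¹.mulVec t) l = t l := by
      rw [Matrix.mulVec_mulVec, Matrix.mul_nonsing_inv _ hdet, Matrix.one_mulVec]
    rw [← h1]
    simp only [Matrix.mulVec, dotProduct, Finset.mul_sum, Finset.sum_mul]
    refine Finset.sum_congr rfl fun a _ => Finset.sum_congr rfl fun m _ => ?_
    rw [hsymm.apply l a]
    ring
  have hu : ∀ j l u, metricForm G y (christoffelForm G y u (coordVec j)) (coordVec l) =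
      koszul (metricForm G) y u (coordVec j) (coordVec l) := by
    intro j l u
    rw [eu_sum_coordVec u, hk]
    simp only [map_sum, map_smul, sum_apply, smul_apply, basis, smul_eq_mul, hk,
      ← Finset.sum_add_distrib, ← Finset.sum_sub_distrib, Finset.mul_sum]
    exact Finset.sum_congr rfl fun i _ => by ring
  have hv : ∀ l u v, metricForm G y (christoffelForm G y u v) (coordVec l) =
      koszul (metricForm G) y u v (coordVec l) := by
    intro l u v
    rw [eu_sum_coordVec v, hk]
    simp only [map_sum, map_smul, sum_apply, smul_apply, hu, smul_eq_mul, hk,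
      ← Finset.sum_add_distrib, ← Finset.sum_sub_distrib, Finset.mul_sum]
    exact Finset.sum_congr rfl fun i _ => by ring
  rw [eu_sum_coordVec w, hk]
  simp only [map_sum, map_smul, sum_apply, smul_apply, hv, smul_eq_mul, hk,
    ← Finset.sum_add_distrib, ← Finset.sum_sub_distrib, Finset.mul_sum]
  exact Finset.sum_congr rfl fun i _ => by ring

lemma christoffel_comm {G : Eu n → Matrix (Fin n) (Fin n) ℝ} {y : Eu n}
    (hsymm : ∀ᶠ x in 𝓝 y, (G x).IsSymm) (i j k : Fin n) :
    christoffel G k i j y = christoffel G k j i y := by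
  unfold christoffel
  congr 1
  refine Finset.sum_congr rfl fun l _ => ?_
  have : (fun z => G z i j) =ᶠ[𝓝 y] fun z => G z j i := by
    filter_upwards [hsymm] with x hx using hx.apply j i
  rw [show pd l (fun z => G z i j) y = pd l (fun z => G z j i) y by
    unfold pd; rw [this.fderiv_eq]]
  ring

lemma christoffelForm_comm {G : Eu n → Matrix (Fin n) (Fin n) ℝ} {y : Eu n}
    (hsymm : ∀ᶠ x in 𝓝 y, (G x).IsSymm) (u v : Eu n) :
    christoffelForm G y u v = christoffelForm G y v u := by
  ext k
  rw [christoffelForm_apply, christoffelForm_apply, Finset.sum_comm]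
  refine Finset.sum_congr rfl fun j _ => Finset.sum_congr rfl fun i _ => ?_
  rw [christoffel_comm hsymm]
  ring

lemma differentiableAt_christoffelForm {G : Eu n → Matrix (Fin n) (Fin n) ℝ} {y : Eu n}
    (h : ∀ k i j, DifferentiableAt ℝ (christoffel G k i j) y) :
    DifferentiableAt ℝ (christoffelForm G) y := by
  refine differentiableAt_bilOf fun i j => ?_
  rw [differentiableAt_euclidean]
  exact fun k => h k i j

/-- The Ricci tensor is the trace of the curvature. -/
lemma ricciCoeff_eq_trace {G : Eu n → Matrix (Fin n) (Fin n) ℝ} {y : Eu n}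
    (hsymm : ∀ᶠ x in 𝓝 y, (G x).IsSymm)
    (h : ∀ k i j, DifferentiableAt ℝ (christoffel G k i j) y) (i j : Fin n) :
    ricciCoeff G i j y =
      ∑ k, curvatureOf (christoffelForm G) y (coordVec k) (coordVec j) (coordVec i) k := by
  have hd := differentiableAt_christoffelForm h
  have h1 : ∀ a b c k, fderiv ℝ (fun x => christoffelForm G x (coordVec a) (coordVec b)) y
      (coordVec c) k = pd c (christoffel G k b a) y := by
    intro a b c k
    have hx : DifferentiableAt ℝ (fun x => christoffelForm G x (coordVec a) (coordVec b)) y := by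
      fun_prop
    have e := ((EuclideanSpace.proj k : Eu n →L[ℝ] ℝ).hasFDerivAt.comp y hx.hasFDerivAt).fderiv
    have e2 : (EuclideanSpace.proj k : Eu n →L[ℝ] ℝ) ∘
        (fun x => christoffelForm G x (coordVec a) (coordVec b)) =ᶠ[𝓝 y] christoffel G k b a := by
      -- The lower indices are exchanged under a derivative, so the symmetry of the symbols is
      -- needed at all nearby points.
      filter_upwards [hsymm.eventually_nhds] with x hx
      simp [christoffelForm_coordVec, christoffel_comm hx b a]
    rw [e2.fderiv_eq] at e
    rw [pd, e]
    simp
  have h2 : ∀ a b c k, christoffelForm G y (coordVec a)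
      (christoffelForm G y (coordVec b) (coordVec c)) k =
      ∑ l, christoffel G k a l y * christoffel G l c b y := by
    intro a b c k
    rw [clm_apply_eq_sum (christoffelForm G y (coordVec a))]
    simp only [WithLp.ofLp_sum, WithLp.ofLp_smul, Finset.sum_apply, Pi.smul_apply, smul_eq_mul,
      christoffelForm_coordVec]
    refine Finset.sum_congr rfl fun l _ => ?_
    rw [christoffel_comm hsymm b c]
    ring
  simp only [curvatureOf, PiLp.add_apply, PiLp.sub_apply, h1, h2, ricciCoeff]
  rw [← Finset.sum_add_distrib]
  refine Finset.sum_congr rfl fun k _ => ?_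
  rw [Finset.sum_sub_distrib]
  ring

lemma curvatureOf_eq {E : Type*} [NormedAddCommGroup E] [NormedSpace ℝ E]
    {Γ : E → E →L[ℝ] E →L[ℝ] E} {y : E} (h : DifferentiableAt ℝ Γ y) (u v w : E) :
    curvatureOf Γ y u v w = fderiv ℝ Γ y u v w - fderiv ℝ Γ y v u w
      + Γ y u (Γ y v w) - Γ y v (Γ y u w) := by
  have : ∀ a b c, fderiv ℝ (fun x => Γ x a b) y c = fderiv ℝ Γ y c a b := by
    intro a b c
    rw [((h.hasFDerivAt.clm_apply (hasFDerivAt_const a y)).clm_apply (hasFDerivAt_const b y)).fderiv]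
    simp
  simp only [curvatureOf, this]

/-- The endomorphism `u ↦ R(u, v) w`. -/
def curvatureEnd (Γ : Eu n → Eu n →L[ℝ] Eu n →L[ℝ] Eu n) (y v w : Eu n) : Eu n →ₗ[ℝ] Eu n where
  toFun u := fderiv ℝ Γ y u v w - fderiv ℝ Γ y v u w + Γ y u (Γ y v w) - Γ y v (Γ y u w)
  map_add' a b := by simp only [map_add, add_apply]; abel
  map_smul' a b := by
    simp only [map_smul, smul_apply, RingHom.id_apply, smul_sub, smul_add]

lemma curvatureEnd_apply (Γ : Eu n → Eu n →L[ℝ] Eu n →L[ℝ] Eu n) (y v w u : Eu n) :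
    curvatureEnd Γ y v w u =
      fderiv ℝ Γ y u v w - fderiv ℝ Γ y v u w + Γ y u (Γ y v w) - Γ y v (Γ y u w) := rfl

/-- Writing the Ricci form as the trace of one endomorphism removes the coordinates from it: its
invariance then reduces to the invariance of the trace under conjugation by `Dθ`. -/
lemma sum_ricciCoeff_eq_trace {G : Eu n → Matrix (Fin n) (Fin n) ℝ} {y : Eu n}
    (hsymm : ∀ᶠ x in 𝓝 y, (G x).IsSymm)
    (h : ∀ k i j, DifferentiableAt ℝ (christoffel G k i j) y) (c : Eu n) :
    ∑ i, ∑ j, ricciCoeff G i j y * c i * c j =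
      LinearMap.trace ℝ (Eu n) (curvatureEnd (christoffelForm G) y c c) := by
  have hd := differentiableAt_christoffelForm h
  rw [LinearMap.trace_eq_sum_inner _ (EuclideanSpace.basisFun (Fin n) ℝ)]
  have h1 : ∀ k, inner ℝ (EuclideanSpace.basisFun (Fin n) ℝ k)
      (curvatureEnd (christoffelForm G) y c c (EuclideanSpace.basisFun (Fin n) ℝ k)) =
      ∑ i, ∑ j, c i * c j *
        curvatureOf (christoffelForm G) y (coordVec k) (coordVec j) (coordVec i) k := by
    intro k
    have e1 : inner ℝ (EuclideanSpace.basisFun (Fin n) ℝ k)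
      (curvatureEnd (christoffelForm G) y c c (EuclideanSpace.basisFun (Fin n) ℝ k)) =
      (EuclideanSpace.proj k : Eu n →L[ℝ] ℝ)
        (curvatureEnd (christoffelForm G) y c c (coordVec k)) := by
      simp [coordVec, EuclideanSpace.inner_single_left]
    have e2 : ∀ i j, curvatureOf (christoffelForm G) y (coordVec k) (coordVec j) (coordVec i) k =
      (EuclideanSpace.proj k : Eu n →L[ℝ] ℝ)
        (curvatureOf (christoffelForm G) y (coordVec k) (coordVec j) (coordVec i)) :=
      fun i j => rfl
    rw [e1]
    simp only [e2, ← smul_eq_mul (a := c _ * c _), ← map_smul, ← map_sum]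
    congr 1
    rw [curvatureEnd_apply]
    simp only [curvatureOf_eq hd]
    conv_lhs => rw [eu_sum_coordVec c]
    simp only [map_sum, map_smul, sum_apply, smul_apply, Finset.smul_sum, smul_sub, smul_add,
      Finset.sum_add_distrib, Finset.sum_sub_distrib, smul_smul]
  simp only [h1, ricciCoeff_eq_trace hsymm h]
  symm
  rw [Finset.sum_comm]
  refine Finset.sum_congr rfl fun i _ => ?_
  rw [Finset.sum_comm]
  refine Finset.sum_congr rfl fun j _ => ?_
  rw [mul_assoc (Finset.sum _ _), Finset.sum_mul]
  exact Finset.sum_congr rfl fun k _ => by ring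

/-- Nondegeneracy phrased through the form rather than the determinant, because this is the version
that passes directly through an invertible differential. -/
lemma isUnit_det_iff_metricForm {G : Eu n → Matrix (Fin n) (Fin n) ℝ} {y : Eu n}
    (hsymm : (G y).IsSymm) :
    IsUnit (G y).det ↔ ∀ v, (∀ w, metricForm G y v w = 0) → v = 0 := by
  have hf : ∀ v w, metricForm G y v w = w.ofLp ⬝ᵥ (G y).mulVec v.ofLp := by
    intro v w
    simp only [metricForm_apply, dotProduct, Matrix.mulVec, Finset.mul_sum]
    rw [Finset.sum_comm]
    refine Finset.sum_congr rfl fun j _ => Finset.sum_congr rfl fun i _ => ?_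
    rw [hsymm.apply j i]
    ring
  have hz : ∀ v, (∀ w, metricForm G y v w = 0) ↔ (G y).mulVec v.ofLp = 0 := by
    intro v
    constructor
    · intro h
      have := h (WithLp.toLp 2 ((G y).mulVec v.ofLp))
      rw [hf] at this
      exact dotProduct_self_eq_zero.mp this
    · intro h w
      rw [hf, h, dotProduct_zero]
  simp only [hz]
  rw [isUnit_iff_ne_zero, Ne, ← Matrix.exists_mulVec_eq_zero_iff]
  push Not
  constructor
  · intro h v hv
    by_contra hne
    exact h v.ofLp (fun h0 => hne (by ext i; simp [h0])) hv
  · intro h v hv h0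
    exact hv (congrArg WithLp.ofLp (h (WithLp.toLp 2 v) h0))

end Coefficients

/-! ### Invariance of the connection and of the Ricci form under local diffeomorphisms. -/

section Pullback

variable {n : ℕ} {G G' : Eu n → Matrix (Fin n) (Fin n) ℝ} {θ : Eu n → Eu n} {z : Eu n}

lemma eventually_isInvertible_fderiv (hθ : ContDiffAt ℝ 1 θ z)
    (hinv : (fderiv ℝ θ z).IsInvertible) : ∀ᶠ x in 𝓝 z, (fderiv ℝ θ x).IsInvertible := by
  obtain ⟨e, he⟩ := hinv
  have hc : ContinuousAt (fderiv ℝ θ) z :=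
    (hθ.fderiv_right (m := 0) (by norm_num)).continuousAt
  have := hc.eventually_mem (s := Set.range ContinuousLinearEquiv.toContinuousLinearMap)
    (by rw [← he]; exact e.nhds)
  filter_upwards [this] with x hx
  exact hx

lemma isSymm_of_metricForm_pullback {x : Eu n} (hs : (G' (θ x)).IsSymm)
    (h : ∀ v w, metricForm G x v w = metricForm G' (θ x) (fderiv ℝ θ x v) (fderiv ℝ θ x w)) :
    (G x).IsSymm := by
  have hs' : ∀ v w, metricForm G' (θ x) v w = metricForm G' (θ x) w v := by
    intro v w
    rw [metricForm_apply, metricForm_apply, Finset.sum_comm]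
    exact Finset.sum_congr rfl fun j _ => Finset.sum_congr rfl fun i _ => by
      rw [hs.apply j i]; ring
  refine Matrix.IsSymm.ext fun i j => ?_
  rw [← metricForm_coordVec G x, ← metricForm_coordVec G x i j, h, h, hs']

/-- Invariance of the Christoffel symbols and of the Ricci tensor. -/
theorem christoffel_ricci_pullback (hθ : ContDiffAt ℝ ∞ θ z)
    (hinv : (fderiv ℝ θ z).IsInvertible)
    (hd' : ∀ᶠ x in 𝓝 (θ z), ∀ i j, DifferentiableAt ℝ (fun y => G' y i j) x)
    (hs' : ∀ᶠ x in 𝓝 (θ z), (G' x).IsSymm)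
    (hu' : ∀ᶠ x in 𝓝 (θ z), IsUnit (G' x).det)
    (hΓ' : ∀ k i j, DifferentiableAt ℝ (christoffel G' k i j) (θ z))
    (h : ∀ᶠ x in 𝓝 z, ∀ v w, metricForm G x v w =
      metricForm G' (θ x) (fderiv ℝ θ x v) (fderiv ℝ θ x w)) :
    (∀ u v, fderiv ℝ θ z (christoffelForm G z u v) = fderiv ℝ (fderiv ℝ θ) z u v
      + christoffelForm G' (θ z) (fderiv ℝ θ z u) (fderiv ℝ θ z v)) ∧
    ∀ c : Eu n, ∑ i, ∑ j, ricciCoeff G i j z * c i * c j =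
      ∑ i, ∑ j, ricciCoeff G' i j (θ z) * fderiv ℝ θ z c i * fderiv ℝ θ z c j := by
  have hθc : ContinuousAt θ z := hθ.continuousAt
  have hinv' := eventually_isInvertible_fderiv (hθ.of_le (by norm_cast)) hinv
  have hθe : ∀ᶠ x in 𝓝 z, ContDiffAt ℝ 3 θ x :=
    (hθ.of_le (m := 3) (by norm_cast)).eventually (by simp)
  have hs : ∀ᶠ x in 𝓝 z, (G x).IsSymm := by
    filter_upwards [h, hθc.eventually hs'] with x hx hsx using isSymm_of_metricForm_pullback hsx hx
  have hnd : ∀ᶠ x in 𝓝 z, ∀ v, (∀ w, metricForm G' (θ x) v w = 0) → v = 0 := by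
    filter_upwards [hθc.eventually hs', hθc.eventually hu'] with x h1 h2
      using (isUnit_det_iff_metricForm h1).mp h2
  have hu : ∀ᶠ x in 𝓝 z, IsUnit (G x).det := by
    filter_upwards [hs, hnd, hinv', h] with x hsx hndx hix hx
    rw [isUnit_det_iff_metricForm hsx]
    intro v hv
    obtain ⟨e, he⟩ := hix
    have : fderiv ℝ θ x v = 0 := by
      apply hndx
      intro w'
      have := hv (e.symm w')
      rw [hx, ← he] at this
      simpa [← he] using this
    rw [← he] at this
    simpa using this
  -- Regularity is assumed only for `G'`; that of `G` is inherited through the pullback identity.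
  have hdiff : ∀ᶠ x in 𝓝 z, ∀ i j, DifferentiableAt ℝ (fun y => G y i j) x := by
    filter_upwards [h.eventually_nhds, hθe, hθc.eventually hd'] with x hx h3 hdx i j
    have e : (fun y => G y i j) =ᶠ[𝓝 x] fun y =>
        metricForm G' (θ y) (fderiv ℝ θ y (coordVec i)) (fderiv ℝ θ y (coordVec j)) := by
      filter_upwards [hx] with y hy
      rw [← hy, metricForm_coordVec]
    refine DifferentiableAt.congr_of_eventuallyEq ?_ e
    have d1 : DifferentiableAt ℝ (fun y => metricForm G' (θ y)) x :=
      DifferentiableAt.comp (g := metricForm G') x (differentiableAt_bilOf hdx)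
        (h3.differentiableAt (by norm_num))
    have d2 : DifferentiableAt ℝ (fderiv ℝ θ) x :=
      (h3.fderiv_right (m := 1) (by norm_num)).differentiableAt (by norm_num)
    exact (d1.clm_apply (d2.clm_apply (differentiableAt_const _))).clm_apply
      (d2.clm_apply (differentiableAt_const _))
  have law : ∀ᶠ x in 𝓝 z, ∀ u v, fderiv ℝ θ x (christoffelForm G x u v) =
      fderiv ℝ (fderiv ℝ θ) x u v
        + christoffelForm G' (θ x) (fderiv ℝ θ x u) (fderiv ℝ θ x v) := by
    filter_upwards [h.eventually_nhds, hθe, hθc.eventually hd', hθc.eventually hs',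
      hθc.eventually hu', hs, hu, hnd, hinv', hdiff] with x hx h3 hdx hsx' hux' hsx hux hndx hix hgx
    refine connection_pullback (g := metricForm G) (g' := metricForm G')
      (Γ := christoffelForm G) (Γ' := christoffelForm G')
      (h3.of_le (by norm_num)) ?_ (differentiableAt_bilOf hdx) ?_ hndx hx ?_ ?_
    · obtain ⟨e, he⟩ := hix
      rw [← he]
      exact e.surjective
    · intro v w
      rw [metricForm_apply, metricForm_apply, Finset.sum_comm]
      exact Finset.sum_congr rfl fun j _ => Finset.sum_congr rfl fun i _ => by
        rw [hsx'.apply j i]; ring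
    · exact metricForm_christoffelForm hgx hsx hux
    · exact metricForm_christoffelForm hdx hsx' hux'
  have hdΓ' := differentiableAt_christoffelForm hΓ'
  -- The transformation law is solved for the symbols of `G` by inverting `Dθ`; inversion of
  -- operators is smooth, so differentiability passes from `G'` to `G`.
  have hΓ : ∀ k i j, DifferentiableAt ℝ (christoffel G k i j) z := by
    intro k i j
    have d0 : ContDiffAt ℝ 2 (fderiv ℝ θ) z := hθe.self_of_nhds.fderiv_right (by norm_num)
    have d1 : DifferentiableAt ℝ (fderiv ℝ θ) z := d0.differentiableAt (by norm_num)
    have d2 : DifferentiableAt ℝ (fderiv ℝ (fderiv ℝ θ)) z :=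
      (d0.fderiv_right (m := 1) (by norm_num)).differentiableAt (by norm_num)
    have d3 : DifferentiableAt ℝ (fun x => (fderiv ℝ θ x).inverse) z :=
      DifferentiableAt.comp (g := ContinuousLinearMap.inverse) z
        ((hinv.contDiffAt_map_inverse (n := 1)).differentiableAt (by norm_num)) d1
    have d4 : DifferentiableAt ℝ (fun x => christoffelForm G' (θ x)) z :=
      DifferentiableAt.comp (g := christoffelForm G') z hdΓ'
        (hθ.differentiableAt (by simp))
    have d5 : ∀ a, DifferentiableAt ℝ (fun x => fderiv ℝ θ x a) z := fun a =>
      d1.clm_apply (differentiableAt_const _)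
    have e : christoffel G k i j =ᶠ[𝓝 z] fun x => (EuclideanSpace.proj k : Eu n →L[ℝ] ℝ)
        ((fderiv ℝ θ x).inverse (fderiv ℝ (fderiv ℝ θ) x (coordVec i) (coordVec j)
        + christoffelForm G' (θ x) (fderiv ℝ θ x (coordVec i)) (fderiv ℝ θ x (coordVec j)))) := by
      filter_upwards [law, hinv'] with x hx hix
      rw [← hx, ← christoffelForm_coordVec]
      have := (hix.inverse_apply_eq (x := christoffelForm G x (coordVec i) (coordVec j))).mpr rfl
      rw [this]
      rfl
    refine DifferentiableAt.congr_of_eventuallyEq ?_ e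
    refine (EuclideanSpace.proj k : Eu n →L[ℝ] ℝ).differentiableAt.comp z (d3.clm_apply ?_)
    exact ((d2.clm_apply (differentiableAt_const _)).clm_apply (differentiableAt_const _)).add
      ((d4.clm_apply (d5 _)).clm_apply (d5 _))
  refine ⟨law.self_of_nhds, fun c => ?_⟩
  rw [sum_ricciCoeff_eq_trace hs hΓ, sum_ricciCoeff_eq_trace hs' hΓ']
  obtain ⟨e, he⟩ := hinv
  -- Conjugation by `Dθ` does not change the trace, and `curvatureOf_pullback` identifies the
  -- conjugated curvature endomorphism with that of `G'`.
  rw [← LinearMap.trace_conj' _ e.toLinearEquiv]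
  congr 1
  refine LinearMap.ext fun u => ?_
  have hcurv := curvatureOf_pullback hθe.self_of_nhds (differentiableAt_christoffelForm hΓ) hdΓ'
    (christoffelForm_comm hs') law (e.symm u) c c
  rw [curvatureOf_eq (differentiableAt_christoffelForm hΓ), curvatureOf_eq hdΓ'] at hcurv
  have hu1 : fderiv ℝ θ z (e.symm u) = u := by rw [← he]; simp
  rw [hu1] at hcurv
  refine Eq.trans ?_ hcurv
  rw [LinearEquiv.conj_apply_apply, ← he]
  rfl

end Pullback

/-! ### The metric of `𝔼(κ, τ)` in Fermi coordinates along a vertical cylinder -/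

/-- The functions `c`, `a` in the metric `dr² + c² ds² + (dt + a ds)²` (`r` is the distance to the
cylinder), together with `d = c'`. -/
structure FermiProfile (κ τ k : ℝ) (c d a : ℝ → ℝ) : Prop where
  contDiff_c : ContDiff ℝ ∞ c
  hasDerivAt_c : ∀ r, HasDerivAt c (d r) r
  hasDerivAt_d : ∀ r, HasDerivAt d (-κ * c r) r
  hasDerivAt_a : ∀ r, HasDerivAt a (2 * τ * c r) r
  c_zero : c 0 = 1
  d_zero : d 0 = -k
  a_zero : a 0 = 0

/-- The coefficients of `dr² + c(r)² ds² + (dt + a(r) ds)²` in the coordinates `(s, r, t)`. -/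
def fermiMetric (c a : ℝ → ℝ) (w : Eu 3) : Matrix (Fin 3) (Fin 3) ℝ :=
  !![c (w 1) ^ 2 + a (w 1) ^ 2, 0, a (w 1); 0, 1, 0; a (w 1), 0, 1]

namespace FermiProfile

variable {κ τ k : ℝ} {c d a : ℝ → ℝ}

/-- Half the `r`-derivative of the metric coefficients. -/
def halfDeriv (τ : ℝ) (c d a : ℝ → ℝ) (r : ℝ) : Matrix (Fin 3) (Fin 3) ℝ :=
  !![c r * d r + 2 * τ * a r * c r, 0, τ * c r; 0, 0, 0; τ * c r, 0, 0]

/-- The inverse of the metric. -/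
def inverseMetric (c a : ℝ → ℝ) (r : ℝ) : Matrix (Fin 3) (Fin 3) ℝ :=
  !![(c r ^ 2)⁻¹, 0, -a r * (c r ^ 2)⁻¹; 0, 1, 0;
    -a r * (c r ^ 2)⁻¹, 0, 1 + a r ^ 2 * (c r ^ 2)⁻¹]

/-- The Christoffel symbols, as functions of `r`. -/
def symbols (τ : ℝ) (c d a : ℝ → ℝ) (k i j : Fin 3) (r : ℝ) : ℝ :=
  ∑ l, inverseMetric c a r k l *
    ((if i = 1 then halfDeriv τ c d a r j l else 0)
      + (if j = 1 then halfDeriv τ c d a r i l else 0)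
      - (if l = 1 then halfDeriv τ c d a r i j else 0))

lemma det_fermiMetric (c a : ℝ → ℝ) (w : Eu 3) : (fermiMetric c a w).det = c (w 1) ^ 2 := by
  simp [fermiMetric, Matrix.det_fin_three]
  ring

lemma inv_fermiMetric {w : Eu 3} (h : c (w 1) ≠ 0) :
    (fermiMetric c a w)⁻¹ = inverseMetric c a (w 1) := by
  apply Matrix.inv_eq_right_inv
  ext i j
  fin_cases i <;> fin_cases j <;>
    simp [fermiMetric, inverseMetric, Matrix.mul_apply, Fin.sum_univ_three] <;>
    field_simp <;> ring

lemma isSymm_fermiMetric (c a : ℝ → ℝ) (w : Eu 3) : (fermiMetric c a w).IsSymm := by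
  refine Matrix.IsSymm.ext fun i j => ?_
  fin_cases i <;> fin_cases j <;> rfl

lemma hasFDerivAt_comp_coord {f : ℝ → ℝ} {f' : ℝ} {w : Eu 3} (h : HasDerivAt f f' (w 1)) :
    HasFDerivAt (fun z : Eu 3 => f (z 1)) (f' • (EuclideanSpace.proj 1 : Eu 3 →L[ℝ] ℝ)) w :=
  h.comp_hasFDerivAt w (EuclideanSpace.proj 1 : Eu 3 →L[ℝ] ℝ).hasFDerivAt

lemma pd_comp_coord {f : ℝ → ℝ} {f' : ℝ} {w : Eu 3} (h : HasDerivAt f f' (w 1)) (l : Fin 3) :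
    pd l (fun z : Eu 3 => f (z 1)) w = if l = 1 then f' else 0 := by
  rw [pd, (hasFDerivAt_comp_coord h).fderiv]
  fin_cases l <;> simp [coordVec]

lemma hasDerivAt_fermiMetric (h : FermiProfile κ τ k c d a) (i j : Fin 3) (r : ℝ) :
    HasDerivAt (fun r => (!![c r ^ 2 + a r ^ 2, 0, a r; 0, 1, 0; a r, 0, 1] :
      Matrix (Fin 3) (Fin 3) ℝ) i j) (2 * halfDeriv τ c d a r i j) r := by
  have hc := h.hasDerivAt_c r
  have ha := h.hasDerivAt_a r
  fin_cases i <;> fin_cases j <;> simp [halfDeriv]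
  · refine HasDerivAt.congr_deriv ((hc.pow 2).add (ha.pow 2)) ?_
    simp; ring
  · exact hasDerivAt_const _ _
  · exact ha.congr_deriv (by ring)
  · exact hasDerivAt_const _ _
  · exact hasDerivAt_const _ _
  · exact hasDerivAt_const _ _
  · exact ha.congr_deriv (by ring)
  · exact hasDerivAt_const _ _
  · exact hasDerivAt_const _ _

lemma differentiableAt_fermiMetric (h : FermiProfile κ τ k c d a) (i j : Fin 3) (w : Eu 3) :
    DifferentiableAt ℝ (fun z => fermiMetric c a z i j) w :=
  (hasFDerivAt_comp_coord (h.hasDerivAt_fermiMetric i j (w 1))).differentiableAt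

lemma pd_fermiMetric (h : FermiProfile κ τ k c d a) (i j l : Fin 3) (w : Eu 3) :
    pd l (fun z => fermiMetric c a z i j) w =
      if l = 1 then 2 * halfDeriv τ c d a (w 1) i j else 0 :=
  pd_comp_coord (h.hasDerivAt_fermiMetric i j (w 1)) l

lemma christoffel_fermiMetric (h : FermiProfile κ τ k c d a) {w : Eu 3} (hw : c (w 1) ≠ 0)
    (m i j : Fin 3) : christoffel (fermiMetric c a) m i j w = symbols τ c d a m i j (w 1) := by
  simp only [christoffel, symbols, inv_fermiMetric hw, h.pd_fermiMetric, Finset.mul_sum]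
  refine Finset.sum_congr rfl fun l _ => ?_
  split_ifs <;> ring

lemma eventually_ne_zero (h : FermiProfile κ τ k c d a) {w : Eu 3} (hw : w 1 = 0) :
    ∀ᶠ z : Eu 3 in 𝓝 w, c (z 1) ≠ 0 := by
  have : ContinuousAt (fun z : Eu 3 => c (z 1)) w :=
    (h.contDiff_c.continuous.comp (EuclideanSpace.proj 1 : Eu 3 →L[ℝ] ℝ).continuous).continuousAt
  exact this.eventually_ne (by simp [hw, h.c_zero])

/-- Equality on a whole neighbourhood, and not only on `r = 0`, because the Ricci tensor
differentiates the symbols. -/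
lemma christoffel_eventuallyEq (h : FermiProfile κ τ k c d a) {w : Eu 3} (hw : w 1 = 0)
    (m i j : Fin 3) :
    christoffel (fermiMetric c a) m i j =ᶠ[𝓝 w] fun z => symbols τ c d a m i j (z 1) := by
  filter_upwards [h.eventually_ne_zero hw] with z hz using h.christoffel_fermiMetric hz m i j

lemma differentiableAt_symbols (h : FermiProfile κ τ k c d a) {r : ℝ} (hr : c r ≠ 0)
    (m i j : Fin 3) : DifferentiableAt ℝ (symbols τ c d a m i j) r := by
  have hc := (h.hasDerivAt_c r).differentiableAt
  have hd := (h.hasDerivAt_d r).differentiableAt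
  have ha := (h.hasDerivAt_a r).differentiableAt
  have hT : ∀ i j, DifferentiableAt ℝ (fun r => halfDeriv τ c d a r i j) r := by
    intro i j
    fin_cases i <;> fin_cases j <;> simp [halfDeriv] <;> fun_prop
  have hI : ∀ i j, DifferentiableAt ℝ (fun r => inverseMetric c a r i j) r := by
    intro i j
    have : c r ^ 2 ≠ 0 := pow_ne_zero _ hr
    fin_cases i <;> fin_cases j <;> simp [inverseMetric] <;> fun_prop (disch := assumption)
  have hif : ∀ (p : Prop) [Decidable p] i j,
      DifferentiableAt ℝ (fun r => if p then halfDeriv τ c d a r i j else 0) r := by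
    intro p _ i j
    by_cases hp : p
    · simpa [hp] using hT i j
    · simp [hp]
  unfold symbols
  exact DifferentiableAt.fun_sum fun l _ =>
    (hI m l).mul (((hif _ j l).add (hif _ i l)).sub (hif _ i j))

lemma differentiableAt_christoffel (h : FermiProfile κ τ k c d a) {w : Eu 3} (hw : w 1 = 0)
    (m i j : Fin 3) : DifferentiableAt ℝ (christoffel (fermiMetric c a) m i j) w := by
  have := h.differentiableAt_symbols (r := w 1) (by simp [hw, h.c_zero]) m i j
  exact (hasFDerivAt_comp_coord this.hasDerivAt).differentiableAt.congr_of_eventuallyEq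
    (h.christoffel_eventuallyEq hw m i j)

lemma fermiMetric_of_eq_zero (h : FermiProfile κ τ k c d a) {w : Eu 3} (hw : w 1 = 0) :
    fermiMetric c a w = 1 := by
  ext i j
  fin_cases i <;> fin_cases j <;> simp [fermiMetric, hw, h.c_zero, h.a_zero]

lemma metricForm_fermiMetric (h : FermiProfile κ τ k c d a) {w : Eu 3} (hw : w 1 = 0)
    (u v : Eu 3) : metricForm (fermiMetric c a) w u v = ∑ i, u i * v i := by
  rw [metricForm_apply, h.fermiMetric_of_eq_zero hw]
  simp [Fin.sum_univ_three]

/-- The second fundamental form of the cylinder `r = 0`. -/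
lemma christoffel_one (h : FermiProfile κ τ k c d a) {w : Eu 3} (hw : w 1 = 0) (i j : Fin 3) :
    christoffel (fermiMetric c a) 1 i j w = !![k, 0, -τ; 0, 0, 0; -τ, 0, 0] i j := by
  -- For `i, j ≠ 1` this symbol is `-∂_r g_ij / 2`; at `r = 0` its entries come from `-c'(0) = k`
  -- and `-a'(0)/2 = -τ`.
  rw [h.christoffel_fermiMetric (by simp [hw, h.c_zero]), hw]
  fin_cases i <;> fin_cases j <;>
    simp [symbols, Fin.sum_univ_three, inverseMetric, halfDeriv, h.c_zero, h.a_zero, h.d_zero]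

/-- The Ricci curvature in the direction normal to the cylinder. -/
lemma ricciCoeff_one_one (h : FermiProfile κ τ k c d a) {w : Eu 3} (hw : w 1 = 0) :
    ricciCoeff (fermiMetric c a) 1 1 w = κ - 2 * τ ^ 2 := by
  have hpd : ∀ l m i j, pd l (christoffel (fermiMetric c a) m i j) w =
      pd l (fun z => symbols τ c d a m i j (z 1)) w := fun l m i j => by
    rw [pd, pd, (h.christoffel_eventuallyEq hw m i j).fderiv_eq]
  -- Each symbol is replaced by a closed formula in `r`, whose derivative at `0` is computed from
  -- the profile equations.
  have hpd' : ∀ l m i j (f : ℝ → ℝ) (f' : ℝ), (∀ r, symbols τ c d a m i j r = f r) →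
      HasDerivAt f f' 0 → pd l (christoffel (fermiMetric c a) m i j) w = if l = 1 then f' else 0 := by
    intro l m i j f f' hf hf'
    rw [hpd, funext hf |> fun e => (by rw [e] : (fun z : Eu 3 => symbols τ c d a m i j (z 1)) =
      fun z => f (z 1))]
    exact pd_comp_coord (by rw [hw]; exact hf') l
  have hc := h.hasDerivAt_c 0
  have hd := h.hasDerivAt_d 0
  have ha := h.hasDerivAt_a 0
  have hc2 : HasDerivAt (fun r => (c r ^ 2)⁻¹) (2 * k) 0 := by
    refine HasDerivAt.congr_deriv ((hc.pow 2).fun_inv (by simp [h.c_zero])) ?_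
    simp [h.c_zero, h.d_zero]
  have hcd : HasDerivAt (fun r => c r * d r + 2 * τ * a r * c r)
      (k ^ 2 - κ + 4 * τ ^ 2) 0 := by
    refine HasDerivAt.congr_deriv ((hc.mul hd).add ((ha.const_mul (2 * τ)).mul hc)) ?_
    simp [h.c_zero, h.d_zero, h.a_zero]
    ring
  have hac : HasDerivAt (fun r => -a r * (c r ^ 2)⁻¹) (-2 * τ) 0 := by
    refine HasDerivAt.congr_deriv (ha.neg.mul hc2) ?_
    simp [h.c_zero, h.a_zero]
  have htc : HasDerivAt (fun r => τ * c r) (-τ * k) 0 := by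
    refine HasDerivAt.congr_deriv (hc.const_mul τ) ?_
    simp [h.d_zero]
  have e00 : ∀ l, pd l (christoffel (fermiMetric c a) 0 1 0) w =
      if l = 1 then - k ^ 2 - κ + 2 * τ ^ 2 else 0 := fun l => by
    refine hpd' l 0 1 0 (fun r => (c r ^ 2)⁻¹ * (c r * d r + 2 * τ * a r * c r)
      + -a r * (c r ^ 2)⁻¹ * (τ * c r)) _ (fun r => ?_) ?_
    · simp [symbols, Fin.sum_univ_three, inverseMetric, halfDeriv]
    · refine HasDerivAt.congr_deriv ((hc2.mul hcd).add (hac.mul htc)) ?_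
      simp [h.c_zero, h.d_zero, h.a_zero]
      ring
  have e22 : ∀ l, pd l (christoffel (fermiMetric c a) 2 1 2) w =
      if l = 1 then - 2 * τ ^ 2 else 0 := fun l => by
    refine hpd' l 2 1 2 (fun r => -a r * (c r ^ 2)⁻¹ * (τ * c r)) _ (fun r => ?_) ?_
    · simp [symbols, Fin.sum_univ_three, inverseMetric, halfDeriv]
    · refine HasDerivAt.congr_deriv (hac.mul htc) ?_
      simp [h.c_zero, h.a_zero]
      ring
  -- The `r`-lines are geodesics, so these symbols vanish identically and only the derivatives of
  -- `Γ^m_1m` contribute to the Ricci coefficient.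
  have e0 : ∀ l m, pd l (christoffel (fermiMetric c a) m 1 1) w = 0 := fun l m => by
    refine (hpd' l m 1 1 (fun _ => 0) 0 (fun r => ?_) (hasDerivAt_const _ _)).trans (by simp)
    fin_cases m <;> simp [symbols, Fin.sum_univ_three, inverseMetric, halfDeriv]
  have hs : ∀ m i j, christoffel (fermiMetric c a) m i j w = symbols τ c d a m i j 0 :=
    fun m i j => by rw [h.christoffel_fermiMetric (by simp [hw, h.c_zero]), hw]
  simp only [ricciCoeff, Fin.sum_univ_three, e00, e22, e0, hs]
  simp [symbols, Fin.sum_univ_three, inverseMetric, halfDeriv, h.c_zero, h.d_zero, h.a_zero]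
  ring

end FermiProfile

/-! ### Differentials in the preferred charts -/

section Differential

variable {l m n : ℕ} {L M N : Type*} [TopologicalSpace L] [ChartedSpace (Eu l) L]
  [TopologicalSpace M] [ChartedSpace (Eu m) M] [TopologicalSpace N] [ChartedSpace (Eu n) N]

variable (m n) in
/-- The differential of `f` at `p`, as a linear map between the model spaces. -/
def dmf (f : M → N) (p : M) : Eu m →L[ℝ] Eu n := mfderiv (𝓡 m) (𝓡 n) f p

lemma dmf_comp {g : M → N} {f : L → M} {p : L} (hg : MDifferentiableAt (𝓡 m) (𝓡 n) g (f p))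
    (hf : MDifferentiableAt (𝓡 l) (𝓡 m) f p) :
    dmf l n (g ∘ f) p = (dmf m n g (f p)).comp (dmf l m f p) :=
  mfderiv_comp p hg hf

lemma dmf_comp_apply {g : M → N} {f : L → M} {p : L}
    (hg : MDifferentiableAt (𝓡 m) (𝓡 n) g (f p))
    (hf : MDifferentiableAt (𝓡 l) (𝓡 m) f p) (v : Eu l) :
    dmf l n (g ∘ f) p v = dmf m n g (f p) (dmf l m f p v) := by rw [dmf_comp hg hf]; rfl

lemma dmf_congr {f f' : M → N} {p : M} (h : f =ᶠ[𝓝 p] f') : dmf m n f p = dmf m n f' p :=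
  h.mfderiv_eq

lemma dmf_id (p : M) : dmf m m (fun q : M => q) p = ContinuousLinearMap.id ℝ (Eu m) :=
  mfderiv_id

lemma dmf_eq_fderiv (f : Eu m → Eu n) (p : Eu m) : dmf m n f p = fderiv ℝ f p :=
  mfderiv_eq_fderiv

/-- The preferred chart of the model space is the identity, so only the chart of the source appears.
-/
lemma dmf_eq_fderiv_comp_symm {f : M → Eu n} {p : M} (hf : MDifferentiableAt (𝓡 m) (𝓡 n) f p) :
    dmf m n f p = fderiv ℝ (f ∘ (chartAt (Eu m) p).symm) (chartAt (Eu m) p p) := by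
  have h : dmf m n f p = fderivWithin ℝ (writtenInExtChartAt (𝓡 m) (𝓡 n) p f)
    (Set.range (𝓡 m)) (extChartAt (𝓡 m) p p) := hf.mfderiv
  rw [h]
  simp [writtenInExtChartAt, extChartAt, fderivWithin_univ]
  rfl

lemma dmf_left_inverse {f : M → N} {g : N → M} {p : M}
    (hf : MDifferentiableAt (𝓡 m) (𝓡 n) f p) (hg : MDifferentiableAt (𝓡 n) (𝓡 m) g (f p))
    (h : ∀ᶠ q in 𝓝 p, g (f q) = q) (v : Eu m) :
    dmf n m g (f p) (dmf m n f p v) = v := by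
  rw [← dmf_comp_apply hg hf, dmf_congr (f := g ∘ f) (f' := fun q => q) h, dmf_id]
  rfl

lemma pullback_apply (g : MetricTensor n N) (f : M → N) (p : M) (v w : Eu m) :
    (g.pullback f : MetricTensor m M) p v w = g (f p) (dmf m n f p v) (dmf m n f p w) := rfl

lemma pullback_pullback (g : MetricTensor n N) {f : M → N} {h : L → M} {p : L}
    (hf : MDifferentiableAt (𝓡 m) (𝓡 n) f (h p)) (hh : MDifferentiableAt (𝓡 l) (𝓡 m) h p)
    (v w : Eu l) : ((g.pullback f : MetricTensor m M).pullback h : MetricTensor l L) p v w =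
      (g.pullback (f ∘ h) : MetricTensor l L) p v w := by
  rw [pullback_apply, pullback_apply, pullback_apply, dmf_comp_apply hf hh, dmf_comp_apply hf hh]
  rfl

lemma metricCoeff_apply (g : MetricTensor m M) (p : M) (y : Eu m) (i j : Fin m) :
    metricCoeff g p y i j = g ((chartAt (Eu m) p).symm y)
      (dmf m m (chartAt (Eu m) p).symm y (coordVec i)) (dmf m m (chartAt (Eu m) p).symm y (coordVec j)) :=
  rfl

variable [IsManifold (𝓡 m) ∞ M] [IsManifold (𝓡 n) ∞ N]

lemma mdifferentiableAt_chart_symm (p : M) {y : Eu m} (hy : y ∈ (chartAt (Eu m) p).target) :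
    MDifferentiableAt (𝓡 m) (𝓡 m) (chartAt (Eu m) p).symm y :=
  have : IsManifold (𝓡 m) 1 M := IsManifold.of_le (n := ∞) (by norm_cast)
  mdifferentiableAt_atlas_symm (chart_mem_atlas _ p) hy

lemma mdifferentiableAt_chart (p : M) {q : M} (hq : q ∈ (chartAt (Eu m) p).source) :
    MDifferentiableAt (𝓡 m) (𝓡 m) (chartAt (Eu m) p) q :=
  have : IsManifold (𝓡 m) 1 M := IsManifold.of_le (n := ∞) (by norm_cast)
  mdifferentiableAt_atlas (chart_mem_atlas _ p) hq

lemma contMDiffAt_chart_symm (p : M) {y : Eu m} (hy : y ∈ (chartAt (Eu m) p).target) :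
    ContMDiffAt (𝓡 m) (𝓡 m) ∞ (chartAt (Eu m) p).symm y :=
  contMDiffOn_chart_symm.contMDiffAt ((chartAt (Eu m) p).open_target.mem_nhds hy)

lemma contMDiffAt_chart' (p : M) {q : M} (hq : q ∈ (chartAt (Eu m) p).source) :
    ContMDiffAt (𝓡 m) (𝓡 m) ∞ (chartAt (Eu m) p) q :=
  contMDiffOn_chart.contMDiffAt ((chartAt (Eu m) p).open_source.mem_nhds hq)

/-- The coefficients of a pulled back metric. -/
lemma metricForm_metricCoeff {h : MetricTensor m M} {p : M} {Y : M → Eu n} {y : Eu m}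
    {B : Eu n →L[ℝ] Eu n →L[ℝ] ℝ} (hy : y ∈ (chartAt (Eu m) p).target)
    (hY : MDifferentiableAt (𝓡 m) (𝓡 n) Y ((chartAt (Eu m) p).symm y))
    (hh : ∀ v w : Eu m, h ((chartAt (Eu m) p).symm y) v w =
      B (dmf m n Y ((chartAt (Eu m) p).symm y) v) (dmf m n Y ((chartAt (Eu m) p).symm y) w))
    (v w : Eu m) :
    metricForm (metricCoeff h p) y v w = B (fderiv ℝ (Y ∘ (chartAt (Eu m) p).symm) y v)
      (fderiv ℝ (Y ∘ (chartAt (Eu m) p).symm) y w) := by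
  have key : ∀ a, dmf m n Y ((chartAt (Eu m) p).symm y) (dmf m m (chartAt (Eu m) p).symm y a) =
      fderiv ℝ (Y ∘ (chartAt (Eu m) p).symm) y a := fun a => by
    rw [← dmf_comp_apply hY (mdifferentiableAt_chart_symm p hy), dmf_eq_fderiv]
  have h2 : metricForm (metricCoeff h p) y = bilOf fun i j =>
      B (fderiv ℝ (Y ∘ (chartAt (Eu m) p).symm) y (coordVec i))
        (fderiv ℝ (Y ∘ (chartAt (Eu m) p).symm) y (coordVec j)) := by
    unfold metricForm
    congr 1
    ext i j
    rw [metricCoeff_apply, hh, key, key]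
  rw [h2, bilOf_apply, clm_apply_eq_sum (fderiv ℝ _ y) v, clm_apply_eq_sum (fderiv ℝ _ y) w]
  simp only [map_sum, map_smul, sum_apply, smul_apply, smul_eq_mul, Finset.mul_sum]
  rw [Finset.sum_comm]
  exact Finset.sum_congr rfl fun i _ => Finset.sum_congr rfl fun j _ => by ring

/-- `Y` is a coordinate system near `p` with inverse `Ψ`, in which the metric `h` is given by the
field of bilinear forms `B`. -/
structure IsLocalChart (h : MetricTensor n N) (B : Eu n → Eu n →L[ℝ] Eu n →L[ℝ] ℝ)
    (Y : N → Eu n) (Ψ : Eu n → N) (p : N) : Prop where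
  smooth : ∀ᶠ q in 𝓝 p, ContMDiffAt (𝓡 n) (𝓡 n) ∞ Y q
  smooth_symm : ∀ᶠ y in 𝓝 (Y p), ContMDiffAt (𝓡 n) (𝓡 n) ∞ Ψ y
  left_inv : ∀ᶠ q in 𝓝 p, Ψ (Y q) = q
  right_inv : ∀ᶠ y in 𝓝 (Y p), Y (Ψ y) = y
  metric : ∀ᶠ q in 𝓝 p, ∀ v w : Eu n, h q v w = B (Y q) (dmf n n Y q v) (dmf n n Y q w)

/-- The point `q` is a separate variable because tangent spaces depend on the base point: the
equality `Ψ y = q` is removed by substitution instead of by rewriting inside dependent types. -/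
lemma metric_eq_of_inverse {h : MetricTensor n N} {B : Eu n →L[ℝ] Eu n →L[ℝ] ℝ} {Ψ : Eu n → N}
    {y : Eu n} {q : N} (hq : Ψ y = q) {L : Eu n →L[ℝ] Eu n} (hL : ∀ v, dmf n n Ψ y (L v) = v)
    (hB : ∀ v w : Eu n, (h.pullback Ψ : MetricTensor n (Eu n)) y v w = B v w) (v w : Eu n) :
    h q v w = B (L v) (L w) := by
  subst hq
  rw [← hB, pullback_apply, hL, hL]

/-- The inverse function theorem. -/
theorem exists_isLocalChart {h : MetricTensor n N} {B : Eu n → Eu n →L[ℝ] Eu n →L[ℝ] ℝ}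
    {Ψ : Eu n → N} {y₀ : Eu n} (hΨ : ∀ᶠ y in 𝓝 y₀, ContMDiffAt (𝓡 n) (𝓡 n) ∞ Ψ y)
    (hB : ∀ᶠ y in 𝓝 y₀, ∀ v w : Eu n, (h.pullback Ψ : MetricTensor n (Eu n)) y v w = B y v w)
    (hpos : ∀ v, B y₀ v v = 0 → v = 0) :
    ∃ Y : N → Eu n, Y (Ψ y₀) = y₀ ∧ IsLocalChart h B Y Ψ (Ψ y₀) := by
  set e := chartAt (Eu n) (Ψ y₀) with he
  have hps : Ψ y₀ ∈ e.source := mem_chart_source _ _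
  have hΨ0 := hΨ.self_of_nhds
  have hΨc : ContinuousAt Ψ y₀ := hΨ0.continuousAt
  have hsrc : ∀ᶠ y in 𝓝 y₀, Ψ y ∈ e.source := hΨc.eventually (e.open_source.mem_nhds hps)
  have hφ : ∀ᶠ y in 𝓝 y₀, ContDiffAt ℝ ∞ (e ∘ Ψ) y := by
    filter_upwards [hΨ, hsrc] with y hy hys
    exact ((contMDiffAt_chart' (Ψ y₀) hys).comp y hy).contDiffAt
  have hφ0 := hφ.self_of_nhds
  -- A vector killed by `DΨ` is null for the form `B y₀`, hence zero by definiteness.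
  have hinj : Function.Injective (fderiv ℝ (e ∘ Ψ) y₀) := by
    rw [injective_iff_map_eq_zero]
    intro v hv
    rw [← dmf_eq_fderiv, dmf_comp_apply (mdifferentiableAt_chart (Ψ y₀) hps)
      (hΨ0.mdifferentiableAt (by simp))] at hv
    have h1 : dmf n n Ψ y₀ v = 0 := by
      have := dmf_left_inverse (mdifferentiableAt_chart (Ψ y₀) hps)
        (mdifferentiableAt_chart_symm (Ψ y₀) (e.map_source hps))
        (by filter_upwards [e.open_source.mem_nhds hps] with q hq using e.left_inv hq)
        (dmf n n Ψ y₀ v)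
      rw [← this, hv, map_zero]
    have h2 := hB.self_of_nhds
    apply hpos
    -- The field `h` is not assumed bilinear, so its value on zero vectors is found by comparison
    -- with `B y₀ 0 0`.
    have e1 : B y₀ v v = h (Ψ y₀) (0 : Eu n) (0 : Eu n) := by rw [← h2, pullback_apply, h1]
    have e2 : B y₀ 0 0 = h (Ψ y₀) (0 : Eu n) (0 : Eu n) := by
      rw [← h2, pullback_apply, map_zero]
    rw [e1, ← e2, map_zero]
  obtain ⟨E, hE⟩ : (fderiv ℝ (e ∘ Ψ) y₀).IsInvertible :=
    ⟨(LinearEquiv.ofInjectiveEndo (fderiv ℝ (e ∘ Ψ) y₀ : Eu n →ₗ[ℝ] Eu n)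
      hinj).toContinuousLinearEquiv, by ext v; rfl⟩
  have hder : HasFDerivAt (e ∘ Ψ) (E : Eu n →L[ℝ] Eu n) y₀ := by
    rw [hE]; exact (hφ0.differentiableAt (by simp)).hasFDerivAt
  set H := hφ0.toOpenPartialHomeomorph (e ∘ Ψ) hder (by simp) with hH
  have hHc : ∀ y, H y = e (Ψ y) := fun y => rfl
  have hmem : y₀ ∈ H.source := hφ0.mem_toOpenPartialHomeomorph_source hder (by simp)
  have hinv := eventually_isInvertible_fderiv (hφ0.of_le (by norm_cast)) ⟨E, hE⟩
  -- The coordinate map is the local inverse of `e ∘ Ψ` composed with the chart `e`.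
  set Y : N → Eu n := fun q => H.symm (e q) with hY
  have hY0 : Y (Ψ y₀) = y₀ := H.left_inv hmem
  have htgt : e (Ψ y₀) ∈ H.target := H.map_source hmem
  have hec : ContinuousAt e (Ψ y₀) := e.continuousAt hps
  have hYc : ContinuousAt Y (Ψ y₀) :=
    ContinuousAt.comp (g := H.symm) (H.continuousAt_symm htgt) hec
  have hYt : Tendsto Y (𝓝 (Ψ y₀)) (𝓝 y₀) := by
    have := hYc.tendsto
    rwa [hY0] at this
  have hsrcq : ∀ᶠ q in 𝓝 (Ψ y₀), q ∈ e.source := e.open_source.mem_nhds hps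
  have htgtq : ∀ᶠ q in 𝓝 (Ψ y₀), e q ∈ H.target := hec.eventually (H.open_target.mem_nhds htgt)
  have hleft : ∀ᶠ q in 𝓝 (Ψ y₀), Ψ (Y q) = q := by
    filter_upwards [hsrcq, htgtq, hYt.eventually hsrc] with q h1 h2 h3
    exact e.injOn h3 h1 (by rw [← hHc]; exact H.right_inv h2)
  -- Smoothness of the inverse at a nearby point needs an invertible differential there, which
  -- `hinv` supplies by openness.
  have hsm : ∀ᶠ q in 𝓝 (Ψ y₀), ContMDiffAt (𝓡 n) (𝓡 n) ∞ Y q := by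
    filter_upwards [hsrcq, htgtq, hYt.eventually hφ, hYt.eventually hinv] with q h1 h2 h3 h4
    obtain ⟨E', hE'⟩ := h4
    have hd : HasFDerivAt H (E' : Eu n →L[ℝ] Eu n) (H.symm (e q)) := by
      rw [hE']; exact (h3.differentiableAt (by simp)).hasFDerivAt
    have := H.contDiffAt_symm h2 hd h3
    exact this.contMDiffAt.comp q (contMDiffAt_chart' (Ψ y₀) h1)
  refine ⟨Y, hY0, hsm, ?_, hleft, ?_, ?_⟩
  · rwa [hY0]
  · rw [hY0]
    filter_upwards [H.open_source.mem_nhds hmem] with y hy using H.left_inv hy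
  · filter_upwards [hsm, hleft, hleft.eventually_nhds, hYt.eventually hB, hYt.eventually hΨ]
      with q h1 h2 h3 h4 h5
    exact metric_eq_of_inverse h2 (fun v => dmf_left_inverse (h1.mdifferentiableAt (by simp))
      (h5.mdifferentiableAt (by simp)) h3 v) h4

namespace IsLocalChart

variable {h : MetricTensor n N} {B : Eu n → Eu n →L[ℝ] Eu n →L[ℝ] ℝ}
    {Y : N → Eu n} {Ψ : Eu n → N} {p : N}

lemma continuousAt (hY : IsLocalChart h B Y Ψ p) : ContinuousAt Y p :=
  hY.smooth.self_of_nhds.continuousAt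

lemma symm_apply (hY : IsLocalChart h B Y Ψ p) : Ψ (Y p) = p := hY.left_inv.self_of_nhds

lemma continuousAt_symm (hY : IsLocalChart h B Y Ψ p) : ContinuousAt Ψ (Y p) :=
  hY.smooth_symm.self_of_nhds.continuousAt

/-- Every field is a statement about a neighbourhood, so being a local chart is an open condition.
Hence one pair `Y`, `Ψ` serves all nearby points. -/
lemma eventually (hY : IsLocalChart h B Y Ψ p) : ∀ᶠ q in 𝓝 p, IsLocalChart h B Y Ψ q := by
  filter_upwards [hY.smooth.eventually_nhds, hY.left_inv.eventually_nhds,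
    hY.metric.eventually_nhds, hY.continuousAt.eventually hY.smooth_symm.eventually_nhds,
    hY.continuousAt.eventually hY.right_inv.eventually_nhds] with q h1 h2 h3 h4 h5
  exact ⟨h1, h4, h2, h5, h3⟩

/-- Allows limits at `p` to be computed in coordinates. -/
lemma map_nhds (hY : IsLocalChart h B Y Ψ p) : map Ψ (𝓝 (Y p)) = 𝓝 p := by
  apply le_antisymm
  · have := hY.continuousAt_symm.tendsto
    rwa [hY.symm_apply] at this
  · intro U hU
    have h1 : ∀ᶠ q in 𝓝 p, Y q ∈ Ψ ⁻¹' U := hY.continuousAt.eventually hU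
    filter_upwards [h1, hY.left_inv] with q hq hq'
    rw [← hq']
    exact hq

end IsLocalChart

/-- The coordinate expression of a local chart in the preferred chart at `p`. -/
lemma IsLocalChart.inCoordinates {h : MetricTensor n N} {B : Eu n → Eu n →L[ℝ] Eu n →L[ℝ] ℝ}
    {Y : N → Eu n} {Ψ : Eu n → N} {p : N} (hY : IsLocalChart h B Y Ψ p) :
    ContDiffAt ℝ ∞ (Y ∘ (chartAt (Eu n) p).symm) (chartAt (Eu n) p p) ∧
    (fderiv ℝ (Y ∘ (chartAt (Eu n) p).symm) (chartAt (Eu n) p p)).IsInvertible ∧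
    ∀ᶠ y in 𝓝 (chartAt (Eu n) p p), ∀ v w, metricForm (metricCoeff h p) y v w =
      B ((Y ∘ (chartAt (Eu n) p).symm) y) (fderiv ℝ (Y ∘ (chartAt (Eu n) p).symm) y v)
        (fderiv ℝ (Y ∘ (chartAt (Eu n) p).symm) y w) := by
  set e := chartAt (Eu n) p
  have hps : p ∈ e.source := mem_chart_source _ _
  have hpt : e p ∈ e.target := e.map_source hps
  have hep : e.symm (e p) = p := e.left_inv hps
  have hsm : ∀ᶠ y in 𝓝 (e p), ContMDiffAt (𝓡 n) (𝓡 n) ∞ Y (e.symm y) :=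
    (e.continuousAt_symm hpt).eventually (by rw [hep]; exact hY.smooth)
  have hm : ∀ᶠ y in 𝓝 (e p), ∀ v w : Eu n, h (e.symm y) v w =
      B (Y (e.symm y)) (dmf n n Y (e.symm y) v) (dmf n n Y (e.symm y) w) :=
    (e.continuousAt_symm hpt).eventually (by rw [hep]; exact hY.metric)
  refine ⟨(hsm.self_of_nhds.comp _ (contMDiffAt_chart_symm p hpt)).contDiffAt, ?_, ?_⟩
  · have hYd : MDifferentiableAt (𝓡 n) (𝓡 n) Y p :=
      hY.smooth.self_of_nhds.mdifferentiableAt (by simp)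
    have hΨd : MDifferentiableAt (𝓡 n) (𝓡 n) Ψ (Y p) :=
      hY.smooth_symm.self_of_nhds.mdifferentiableAt (by simp)
    rw [← dmf_eq_fderiv_comp_symm hYd]
    have hinj : Function.Injective (dmf n n Y p) := by
      intro v w hvw
      rw [← dmf_left_inverse hYd hΨd hY.left_inv v, hvw,
        dmf_left_inverse hYd hΨd hY.left_inv w]
    exact ⟨(LinearEquiv.ofInjectiveEndo (dmf n n Y p : Eu n →ₗ[ℝ] Eu n)
      hinj).toContinuousLinearEquiv, by ext v; rfl⟩
  · filter_upwards [hsm, hm, e.open_target.mem_nhds hpt] with y h1 h2 h3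
    exact metricForm_metricCoeff h3 (h1.mdifferentiableAt (by simp)) h2

end Differential

/-! ### Flat charts: gradient and area -/

/-- The Euclidean inner product, as a constant field of bilinear forms. -/
def flatForm (n : ℕ) : Eu n → Eu n →L[ℝ] Eu n →L[ℝ] ℝ := fun _ => innerSL ℝ

lemma flatForm_apply {n : ℕ} (y v w : Eu n) : flatForm n y v w = inner ℝ v w := rfl

/-- The matrix of a linear map. -/
def jac {m n : ℕ} (L : Eu m →L[ℝ] Eu n) : Matrix (Fin n) (Fin m) ℝ :=
  Matrix.of fun a i => L (coordVec i) a

section Jac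

variable {n : ℕ}

lemma det_jac (L : Eu n →L[ℝ] Eu n) : (jac L).det = L.det := by
  have h : jac L = LinearMap.toMatrix (EuclideanSpace.basisFun (Fin n) ℝ).toBasis
      (EuclideanSpace.basisFun (Fin n) ℝ).toBasis (L : Eu n →ₗ[ℝ] Eu n) := by
    ext i j
    simp [jac, LinearMap.toMatrix_apply, coordVec]
  rw [h, LinearMap.det_toMatrix, ContinuousLinearMap.det]

lemma isUnit_det_jac {L : Eu n →L[ℝ] Eu n} (h : L.IsInvertible) : IsUnit (jac L).det := by
  obtain ⟨e, rfl⟩ := h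
  rw [det_jac]
  exact (LinearEquiv.isUnit_det' e.toLinearEquiv)

/-- For `G = JᵀJ` the inverse metric evaluated on the covector `Jᵀ d` gives `|d|²`: this is the
invariance of the gradient norm under a change to orthonormal coordinates. -/
lemma sum_inv_transpose_mul (J : Matrix (Fin n) (Fin n) ℝ) (hJ : IsUnit J.det) (d : Fin n → ℝ) :
    ∑ i, ∑ j, (J.transpose * J)⁻¹ i j * (∑ a, d a * J a i) * (∑ a, d a * J a j) =
      ∑ a, d a ^ 2 := by
  have h1 : ∀ i, ∑ a, d a * J a i = (J.transpose.mulVec d) i := fun i => by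
    simp [Matrix.mulVec, dotProduct, mul_comm]
  have h2 : ∑ i, ∑ j, (J.transpose * J)⁻¹ i j * (∑ a, d a * J a i) * (∑ a, d a * J a j) =
      J.transpose.mulVec d ⬝ᵥ ((J.transpose * J)⁻¹).mulVec (J.transpose.mulVec d) := by
    simp only [h1]
    generalize J.transpose.mulVec d = u
    simp only [dotProduct, Matrix.mulVec, Finset.mul_sum]
    exact Finset.sum_congr rfl fun i _ => Finset.sum_congr rfl fun j _ => by ring
  have hJt : IsUnit J.transpose.det := by rwa [Matrix.det_transpose]
  rw [h2, Matrix.mul_inv_rev, ← Matrix.mulVec_mulVec, Matrix.mulVec_mulVec d,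
    Matrix.nonsing_inv_mul _ hJt, Matrix.one_mulVec, Matrix.mulVec_transpose,
    ← Matrix.dotProduct_mulVec, Matrix.mulVec_mulVec, Matrix.mul_nonsing_inv _ hJ,
    Matrix.one_mulVec]
  simp [dotProduct, sq]

lemma metricCoeff_eq_jac {G : Eu n → Matrix (Fin n) (Fin n) ℝ}
    {y : Eu n} {L : Eu n →L[ℝ] Eu n}
    (hG : ∀ v w, metricForm G y v w = inner ℝ (L v) (L w)) :
    G y = (jac L).transpose * jac L := by
  ext i j
  rw [← metricForm_coordVec G, hG, Matrix.mul_apply]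
  simp [jac, PiLp.inner_apply, mul_comm]

end Jac

section FlatChart

variable {n : ℕ} {M : Type*} [TopologicalSpace M] [ChartedSpace (Eu n) M] [IsManifold (𝓡 n) ∞ M]
  {h : MetricTensor n M} {Y : M → Eu n} {Ψ : Eu n → M} {p : M}

/-- The gradient in a flat chart. -/
lemma gradSq_eq (hY : IsLocalChart h (flatForm n) Y Ψ p) {f : M → ℝ}
    (hf : DifferentiableAt ℝ (f ∘ Ψ) (Y p)) :
    gradSq h f p = ∑ i, pd i (f ∘ Ψ) (Y p) ^ 2 := by
  obtain ⟨h1, h2, h3⟩ := hY.inCoordinates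
  set e := chartAt (Eu n) p
  have hps : p ∈ e.source := mem_chart_source _ _
  have hep : e.symm (e p) = p := e.left_inv hps
  have hF : f ∘ e.symm =ᶠ[𝓝 (e p)] (f ∘ Ψ) ∘ (Y ∘ e.symm) := by
    have : ∀ᶠ y in 𝓝 (e p), Ψ (Y (e.symm y)) = e.symm y :=
      (e.continuousAt_symm (e.map_source hps)).eventually (by rw [hep]; exact hY.left_inv)
    filter_upwards [this] with y hy
    simp [hy]
  have hYp : (Y ∘ e.symm) (e p) = Y p := by simp [hep]
  have hpd : ∀ i, pd i (f ∘ e.symm) (e p) =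
      ∑ a, pd a (f ∘ Ψ) (Y p) * jac (fderiv ℝ (Y ∘ e.symm) (e p)) a i := by
    intro i
    rw [pd, hF.fderiv_eq, fderiv_comp _ (by rwa [hYp]) (h1.differentiableAt (by simp)), hYp]
    rw [ContinuousLinearMap.comp_apply, clm_apply_eq_sum]
    simp [jac, pd, mul_comm]
  have hG : metricCoeff h p (e p) = _ := metricCoeff_eq_jac h3.self_of_nhds
  unfold gradSq
  simp only []
  change ∑ i, ∑ j, (metricCoeff h p (e p))⁻¹ i j * pd i (f ∘ e.symm) (e p)
    * pd j (f ∘ e.symm) (e p) = _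
  rw [hG]
  simp only [hpd]
  exact sum_inv_transpose_mul _ (isUnit_det_jac h2) _

lemma gradSq_nonneg (hY : IsLocalChart h (flatForm n) Y Ψ p) {f : M → ℝ}
    (hf : ContMDiff (𝓡 n) 𝓘(ℝ, ℝ) ∞ f) : 0 ≤ gradSq h f p := by
  have : ContMDiffAt (𝓡 n) 𝓘(ℝ, ℝ) ∞ (f ∘ Ψ) (Y p) :=
    (hf _).comp _ hY.smooth_symm.self_of_nhds
  rw [gradSq_eq hY (this.contDiffAt.differentiableAt (by simp))]
  positivity

/-- Not visible from the definition, since `gradSq` uses the preferred chart of each point and this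
chart may jump. A single flat chart expresses it at all nearby points as a sum of squares of
continuous functions. -/
lemma continuousAt_gradSq (hY : IsLocalChart h (flatForm n) Y Ψ p) {f : M → ℝ}
    (hf : ContMDiff (𝓡 n) 𝓘(ℝ, ℝ) ∞ f) : ContinuousAt (gradSq h f) p := by
  have hs : ∀ᶠ y in 𝓝 (Y p), ContDiffAt ℝ ∞ (f ∘ Ψ) y := by
    filter_upwards [hY.smooth_symm] with y hy
    exact ((hf _).comp y hy).contDiffAt
  have hloc : ∀ᶠ y in 𝓝 (Y p), IsLocalChart h (flatForm n) Y Ψ (Ψ y) :=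
    hY.continuousAt_symm.eventually (by rw [hY.symm_apply]; exact hY.eventually)
  have heq : ∀ᶠ y in 𝓝 (Y p), gradSq h f (Ψ y) = ∑ i, pd i (f ∘ Ψ) y ^ 2 := by
    filter_upwards [hs, hloc, hY.right_inv] with y h1 h2 h3
    rw [gradSq_eq h2 (by rw [h3]; exact h1.differentiableAt (by simp)), h3]
  have hc : ContinuousAt (fun y => ∑ i, pd i (f ∘ Ψ) y ^ 2) (Y p) := by
    have h1 : ContinuousAt (fderiv ℝ (f ∘ Ψ)) (Y p) :=
      (hs.self_of_nhds.fderiv_right (m := 0) (by norm_cast)).continuousAt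
    have h2 : ∀ i, ContinuousAt (fun y => pd i (f ∘ Ψ) y) (Y p) := fun i =>
      h1.clm_apply continuousAt_const
    exact tendsto_finsetSum _ fun i _ => (h2 i).pow 2
  unfold ContinuousAt
  rw [← hY.map_nhds, tendsto_map'_iff, ← hY.symm_apply, heq.self_of_nhds, hY.symm_apply]
  exact hc.tendsto.congr' (by filter_upwards [heq] with y hy; exact hy.symm)

lemma gradSq_comp (hY : IsLocalChart h (flatForm n) Y Ψ p) {f : M → ℝ} {φ : ℝ → ℝ}
    (hf : ContMDiff (𝓡 n) 𝓘(ℝ, ℝ) ∞ f) (hφ : Differentiable ℝ φ) :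
    gradSq h (φ ∘ f) p = deriv φ (f p) ^ 2 * gradSq h f p := by
  have h1 : DifferentiableAt ℝ (f ∘ Ψ) (Y p) :=
    (((hf _).comp _ hY.smooth_symm.self_of_nhds).contDiffAt (n := ∞)).differentiableAt (by simp)
  have h2 : HasFDerivAt ((φ ∘ f) ∘ Ψ) (deriv φ (f p) • fderiv ℝ (f ∘ Ψ) (Y p)) (Y p) := by
    have h3 : HasDerivAt φ (deriv φ (f p)) ((f ∘ Ψ) (Y p)) := by
      have : (f ∘ Ψ) (Y p) = f p := by simp [hY.symm_apply]
      rw [this]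
      exact (hφ _).hasDerivAt
    exact h3.comp_hasFDerivAt (Y p) h1.hasFDerivAt
  rw [gradSq_eq hY h1, gradSq_eq hY h2.differentiableAt, Finset.mul_sum]
  refine Finset.sum_congr rfl fun i _ => ?_
  rw [pd, h2.fderiv]
  simp [pd, mul_pow]

/-- The image of a flat chart under an isometry. -/
lemma IsLocalChart.map_isometry {B : Eu n → Eu n →L[ℝ] Eu n →L[ℝ] ℝ}
    (hY : IsLocalChart h B Y Ψ p) {T T' : M → M}
    (hT : ContMDiff (𝓡 n) (𝓡 n) ∞ T) (hT' : ContMDiff (𝓡 n) (𝓡 n) ∞ T')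
    (h1 : ∀ q, T (T' q) = q) (h2 : ∀ q, T' (T q) = q)
    (hiso : ∀ q, ∀ v w : Eu n, h q v w = (h.pullback T' : MetricTensor n M) q v w) :
    IsLocalChart h B (Y ∘ T') (T ∘ Ψ) (T p) := by
  have hc : Tendsto T' (𝓝 (T p)) (𝓝 p) := by
    have := hT'.continuous.tendsto (T p)
    rwa [h2] at this
  refine ⟨?_, ?_, ?_, ?_, ?_⟩
  · filter_upwards [hc.eventually hY.smooth] with q hq using hq.comp q (hT' q)
  · simp only [Function.comp_apply, h2]
    filter_upwards [hY.smooth_symm] with y hy using (hT _).comp y hy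
  · filter_upwards [hc.eventually hY.left_inv] with q hq
    simp [hq, h1]
  · simp only [Function.comp_apply, h2]
    exact hY.right_inv
  · filter_upwards [hc.eventually hY.metric, hc.eventually hY.smooth] with q hq hq2 v w
    rw [hiso, pullback_apply, hq,
      dmf_comp_apply (hq2.mdifferentiableAt (by simp)) ((hT' q).mdifferentiableAt (by simp)),
      dmf_comp_apply (hq2.mdifferentiableAt (by simp)) ((hT' q).mdifferentiableAt (by simp))]
    rfl

/-! ### The Riemannian measure of a flat manifold. -/

section Measure

variable [MeasurableSpace M] [BorelSpace M] {U : Set M}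

/-- The measure of one coordinate domain, in a flat chart. -/
lemma chartMeasure_apply (hU : ∀ q ∈ U, IsLocalChart h (flatForm n) Y Ψ q) (p : M) {A : Set M}
    (hA : MeasurableSet A) (hAU : A ⊆ U) :
    Measure.map (chartAt (Eu n) p).symm ((volume.restrict (chartAt (Eu n) p).target).withDensity
      fun y => ENNReal.ofReal (Real.sqrt (metricCoeff h p y).det)) A =
      volume (Y '' (A ∩ (chartAt (Eu n) p).source)) := by
  set e := chartAt (Eu n) p
  have hta : MeasurableSet e.target := e.open_target.measurableSet
  have hm : AEMeasurable e.symm (volume.restrict e.target) :=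
    e.continuousOn_symm.aemeasurable hta
  set W : Set (Eu n) := e.symm ⁻¹' A ∩ e.target with hW
  have hWm : MeasurableSet W := by
    -- The inverse chart is continuous only on its target, so measurability of the preimage is
    -- established on that subtype and carried back.
    have h1 : Measurable (Set.domRestrict e.target e.symm) :=
      (continuousOn_iff_continuous_domRestrict.mp e.continuousOn_symm).measurable
    have h2 := hta.subtype_image (h1 hA)
    convert h2 using 1
    ext y
    simp only [hW, Set.mem_inter_iff, Set.mem_preimage, Set.mem_image, Subtype.exists,
      Set.domRestrict_apply, exists_and_right, exists_eq_right]
    exact ⟨fun hy => ⟨hy.2, hy.1⟩, fun ⟨h3, h4⟩ => ⟨h4, h3⟩⟩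
  rw [Measure.map_apply_of_aemeasurable (hm.mono_ac (withDensity_absolutelyContinuous _ _)) hA,
    withDensity_apply', Measure.restrict_restrict' hta]
  -- In a flat chart `√det G` is the Jacobian of the change of coordinates, so the area formula
  -- applies.
  have hd : ∀ y ∈ W, HasFDerivAt (Y ∘ e.symm) (fderiv ℝ (Y ∘ e.symm) y) y ∧
      Real.sqrt (metricCoeff h p y).det = |(fderiv ℝ (Y ∘ e.symm) y).det| := by
    intro y hy
    have hq := hU _ (hAU hy.1)
    have hs := hq.smooth.self_of_nhds
    constructor
    · exact ((hs.comp y (contMDiffAt_chart_symm p hy.2)).contDiffAt.differentiableAt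
        (by simp)).hasFDerivAt
    · have := metricCoeff_eq_jac (metricForm_metricCoeff (p := p) hy.2
        (hs.mdifferentiableAt (by simp)) hq.metric.self_of_nhds)
      rw [this, Matrix.det_mul, Matrix.det_transpose, Real.sqrt_mul_self_eq_abs, det_jac]
  have hinj : Set.InjOn (Y ∘ e.symm) W := by
    intro y hy y' hy' hyy
    have h1 := (hU _ (hAU hy.1)).symm_apply
    have h2 := (hU _ (hAU hy'.1)).symm_apply
    simp only [Function.comp_apply] at hyy
    rw [hyy, h2] at h1
    exact (e.symm.injOn hy'.2 hy.2 h1).symm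
  calc ∫⁻ y in W, ENNReal.ofReal (Real.sqrt (metricCoeff h p y).det)
      = ∫⁻ y in W, ENNReal.ofReal |(fderiv ℝ (Y ∘ e.symm) y).det| :=
        setLIntegral_congr_fun hWm fun y hy => by simp only [(hd y hy).2]
    _ = volume ((Y ∘ e.symm) '' W) := lintegral_abs_det_fderiv_eq_addHaar_image volume hWm
        (fun y hy => (hd y hy).1.hasFDerivWithinAt) hinj
    _ = volume (Y '' (A ∩ e.source)) := by
      rw [Set.image_comp]
      congr 2
      ext q
      constructor
      · rintro ⟨y, hy, rfl⟩
        exact ⟨hy.1, e.map_target hy.2⟩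
      · rintro ⟨hqA, hqe⟩
        exact ⟨e q, ⟨by simpa [e.left_inv hqe] using hqA, e.map_source hqe⟩, e.left_inv hqe⟩

lemma IsLocalChart.isOpen_image {B : Eu n → Eu n →L[ℝ] Eu n →L[ℝ] ℝ}
    (hUo : IsOpen U) (hU : ∀ q ∈ U, IsLocalChart h B Y Ψ q) : IsOpen (Y '' U) := by
  rw [isOpen_iff_mem_nhds]
  rintro _ ⟨q, hq, rfl⟩
  have h1 : ∀ᶠ y in 𝓝 (Y q), Ψ y ∈ U :=
    (hU q hq).continuousAt_symm.eventually
      (by rw [(hU q hq).symm_apply]; exact hUo.mem_nhds hq)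
  filter_upwards [h1, (hU q hq).right_inv] with y hy hy'
  exact ⟨Ψ y, hy, hy'⟩

/-- In a flat chart, the Riemannian measure is the Lebesgue measure. -/
theorem riemannianMeasure_apply [SecondCountableTopology M] (hUo : IsOpen U)
    (hU : ∀ q ∈ U, IsLocalChart h (flatForm n) Y Ψ q) {A : Set M}
    (hA : MeasurableSet A) (hAU : A ⊆ U) : riemannianMeasure h A = volume (Y '' A) := by
  have hYo : IsOpen (Y '' U) := IsLocalChart.isOpen_image hUo hU
  have hΨY : ∀ q ∈ U, Ψ (Y q) = q := fun q hq => (hU q hq).symm_apply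
  have hΨm : AEMeasurable Ψ (volume.restrict (Y '' U)) := by
    refine ContinuousOn.aemeasurable ?_ hYo.measurableSet
    rintro _ ⟨q, hq, rfl⟩
    exact (hU q hq).continuousAt_symm.continuousWithinAt
  set m : Measure M := Measure.map Ψ (volume.restrict (Y '' U)) with hm
  have hmA : ∀ B, MeasurableSet B → m B = volume (Y '' (B ∩ U)) := by
    intro B hB
    rw [hm, Measure.map_apply_of_aemeasurable hΨm hB, Measure.restrict_apply' hYo.measurableSet]
    congr 1
    ext y
    constructor
    · rintro ⟨hy, q, hq, rfl⟩
      rw [Set.mem_preimage, hΨY q hq] at hy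
      exact ⟨q, ⟨hy, hq⟩, rfl⟩
    · rintro ⟨q, ⟨hqB, hq⟩, rfl⟩
      exact ⟨by rwa [Set.mem_preimage, hΨY q hq], q, hq, rfl⟩
  set μ := riemannianMeasure h with hμ
  have hle : ∀ p : M, Measure.map (chartAt (Eu n) p).symm
      ((volume.restrict (chartAt (Eu n) p).target).withDensity
        fun y => ENNReal.ofReal (Real.sqrt (metricCoeff h p y).det)) ≤ μ :=
    fun p => le_iSup (fun p : M => Measure.map (chartAt (Eu n) p).symm
      ((volume.restrict (chartAt (Eu n) p).target).withDensity
        fun y => ENNReal.ofReal (Real.sqrt (metricCoeff h p y).det))) p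
  -- A supremum is bounded above by any measure dominating all chart measures. Inside `U` each of
  -- them is at most `m`; outside `U` the crude bound by `μ` itself suffices.
  have hupper : μ ≤ m + μ.restrict Uᶜ := by
    refine iSup_le fun p => Measure.le_iff.mpr fun B hB => ?_
    rw [← measure_inter_add_sdiff B hUo.measurableSet, Measure.add_apply]
    refine add_le_add ?_ ?_
    · rw [chartMeasure_apply hU p (hB.inter hUo.measurableSet) Set.inter_subset_right, hmA B hB]
      exact measure_mono (Set.image_mono Set.inter_subset_left)
    · rw [Measure.restrict_apply hB]
      exact hle p _
  have hmU : ∀ B, MeasurableSet B → B ⊆ U → μ B ≤ m B := by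
    intro B hB hBU
    refine (Measure.le_iff.mp hupper B hB).trans ?_
    rw [Measure.add_apply, Measure.restrict_apply hB]
    have : B ∩ Uᶜ = ∅ := by
      rw [← Set.sdiff_eq]; exact Set.sdiff_eq_empty.mpr hBU
    rw [this]
    simp
  -- The upper bound is `hmU`. For the lower bound, on each chart domain the single measure of that
  -- chart already equals `m`; countably many domains cover, so equality can be checked on each of
  -- them.
  have heq : μ.restrict U = m := by
    obtain ⟨s, hs, hsu⟩ := TopologicalSpace.countable_cover_nhds
      (f := fun p : M => (chartAt (Eu n) p).source) (fun p => chart_source_mem_nhds _ p)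
    refine (Measure.ext_iff_of_biUnion_eq_univ hs hsu).mpr fun p _ => ?_
    ext B hB
    have hsrc : MeasurableSet (chartAt (Eu n) p).source :=
      (chartAt (Eu n) p).open_source.measurableSet
    have hB' : MeasurableSet (B ∩ (chartAt (Eu n) p).source) := hB.inter hsrc
    have hB'' : MeasurableSet (B ∩ (chartAt (Eu n) p).source ∩ U) := hB'.inter hUo.measurableSet
    rw [Measure.restrict_apply hB, Measure.restrict_apply hB, Measure.restrict_apply hB']
    apply le_antisymm
    · exact (hmU _ hB'' Set.inter_subset_right).trans (measure_mono Set.inter_subset_left)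
    · rw [hmA _ hB']
      refine le_trans (le_of_eq ?_) (hle p _)
      rw [chartMeasure_apply hU p hB'' Set.inter_subset_right]
      congr 2
      ext q
      simp only [Set.mem_inter_iff]
      tauto
  have := hmA A hA
  rw [← heq, Measure.restrict_apply hA, Set.inter_eq_left.mpr hAU] at this
  exact this

/-- Every point of a flat manifold has a neighbourhood on which the flat chart is injective. -/
lemma IsLocalChart.exists_isOpen (hY : IsLocalChart h (flatForm n) Y Ψ p) {V : Set M}
    (hV : V ∈ 𝓝 p) : ∃ U ⊆ V, IsOpen U ∧ p ∈ U ∧ ∀ q ∈ U, IsLocalChart h (flatForm n) Y Ψ q := by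
  obtain ⟨U, hU, hUo, hp⟩ := mem_nhds_iff.mp (inter_mem hV hY.eventually)
  exact ⟨U, fun q hq => (hU hq).1, hUo, hp, fun q hq => (hU hq).2⟩

lemma isLocallyFiniteMeasure_of_flat [SecondCountableTopology M]
    (hflat : ∀ p, ∃ Y Ψ, IsLocalChart h (flatForm n) Y Ψ p) :
    IsLocallyFiniteMeasure (riemannianMeasure h) := by
  refine ⟨fun p => ?_⟩
  obtain ⟨Y, Ψ, hY⟩ := hflat p
  obtain ⟨U, hUV, hUo, hp, hU⟩ := hY.exists_isOpen
    (hY.continuousAt.preimage_mem_nhds (Metric.ball_mem_nhds (Y p) one_pos))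
  refine ⟨U, hUo.mem_nhds hp, ?_⟩
  rw [riemannianMeasure_apply hUo hU hUo.measurableSet subset_rfl]
  exact (measure_mono (Set.image_subset_iff.mpr hUV)).trans_lt measure_ball_lt_top

lemma riemannianMeasure_pos_of_flat [SecondCountableTopology M]
    (hflat : ∀ p, ∃ Y Ψ, IsLocalChart h (flatForm n) Y Ψ p) {V : Set M} (hVo : IsOpen V)
    (hV : V.Nonempty) : 0 < riemannianMeasure h V := by
  obtain ⟨p, hp⟩ := hV
  obtain ⟨Y, Ψ, hY⟩ := hflat p
  obtain ⟨U, hUV, hUo, hpU, hU⟩ := hY.exists_isOpen (hVo.mem_nhds hp)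
  refine lt_of_lt_of_le ?_ (measure_mono hUV)
  rw [riemannianMeasure_apply hUo hU hUo.measurableSet subset_rfl]
  exact (IsLocalChart.isOpen_image hUo hU).measure_pos _ ⟨Y p, p, hpU, rfl⟩

/-- Isometries preserve the Riemannian measure. -/
lemma riemannianMeasure_image_isometry [SecondCountableTopology M]
    (hflat : ∀ p, ∃ Y Ψ, IsLocalChart h (flatForm n) Y Ψ p) {T T' : M → M}
    (hT : ContMDiff (𝓡 n) (𝓡 n) ∞ T) (hT' : ContMDiff (𝓡 n) (𝓡 n) ∞ T')
    (h1 : ∀ q, T (T' q) = q) (h2 : ∀ q, T' (T q) = q)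
    (hiso : ∀ q, ∀ v w : Eu n, h q v w = (h.pullback T' : MetricTensor n M) q v w)
    {A : Set M} (hA : MeasurableSet A) :
    riemannianMeasure h (T' ⁻¹' A) = riemannianMeasure h A := by
  have hT'm : Measurable T' := hT'.continuous.measurable
  rw [← Measure.map_apply hT'm hA]
  suffices Measure.map T' (riemannianMeasure h) = riemannianMeasure h by rw [this]
  choose Y Ψ hY using hflat
  choose U _ hUo hpU hU using fun p => (hY p).exists_isOpen (V := Set.univ) univ_mem
  obtain ⟨s, hs, hsu⟩ := TopologicalSpace.countable_cover_nhds
    (f := U) (fun p => (hUo p).mem_nhds (hpU p))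
  refine (Measure.ext_iff_of_biUnion_eq_univ hs hsu).mpr fun p _ => ?_
  ext B hB
  have hBU : MeasurableSet (B ∩ U p) := hB.inter (hUo p).measurableSet
  rw [Measure.restrict_apply hB, Measure.restrict_apply hB, Measure.map_apply hT'm hBU,
    riemannianMeasure_apply (hUo p) (hU p) hBU Set.inter_subset_right]
  -- The preimage carries the flat chart `Y ∘ T'`, in which it has the same coordinate image, hence
  -- the same Lebesgue measure.
  have hloc : ∀ q ∈ T' ⁻¹' U p, IsLocalChart h (flatForm n) (Y p ∘ T') (T ∘ Ψ p) q := by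
    intro q hq
    have := (hU p _ hq).map_isometry hT hT' h1 h2 hiso
    rwa [h1] at this
  rw [riemannianMeasure_apply ((hUo p).preimage hT'.continuous) hloc (hT'm hBU)
    (Set.preimage_mono Set.inter_subset_right), Set.image_comp,
    Set.image_preimage_eq _ (fun q => ⟨T q, h2 q⟩)]

end Measure

end FlatChart

/-! ### Vertical cylinders in Fermi coordinates -/

/-- The plane `r = 0` in the coordinates `(s, r, t)`. -/
def cylIncl : Eu 2 →L[ℝ] Eu 3 :=
  (EuclideanSpace.proj 0 : Eu 2 →L[ℝ] ℝ).smulRight (coordVec 0)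
    + (EuclideanSpace.proj 1 : Eu 2 →L[ℝ] ℝ).smulRight (coordVec 2)

lemma cylIncl_zero (v : Eu 2) : cylIncl v 0 = v 0 := by simp [cylIncl, coordVec]

lemma cylIncl_one (v : Eu 2) : cylIncl v 1 = 0 := by simp [cylIncl, coordVec]

lemma cylIncl_two (v : Eu 2) : cylIncl v 2 = v 1 := by simp [cylIncl, coordVec]

lemma cylIncl_eq {w : Eu 3} (hw : w 1 = 0) : cylIncl !₂[w 0, w 2] = w := by
  ext i
  fin_cases i
  · simp [cylIncl_zero]
  · simp [cylIncl_one, hw]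
  · simp [cylIncl_two]

lemma second_fderiv_comp {E F G : Type*} [NormedAddCommGroup E] [NormedSpace ℝ E]
    [NormedAddCommGroup F] [NormedSpace ℝ F] [NormedAddCommGroup G] [NormedSpace ℝ G]
    {θ : F → G} {X : E → F} {u : E} (hθ : ContDiffAt ℝ 2 θ (X u)) (hX : ContDiffAt ℝ 2 X u)
    (a b : E) : fderiv ℝ (fderiv ℝ (θ ∘ X)) u a b =
      fderiv ℝ (fderiv ℝ θ) (X u) (fderiv ℝ X u a) (fderiv ℝ X u b)
        + fderiv ℝ θ (X u) (fderiv ℝ (fderiv ℝ X) u a b) := by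
  have h1 : (fun y => fderiv ℝ (θ ∘ X) y b) =ᶠ[𝓝 u]
      fun y => fderiv ℝ θ (X y) (fderiv ℝ X y b) := by
    filter_upwards [hX.continuousAt.eventually (hθ.eventually (by simp)), hX.eventually (by simp)]
      with y h1 h2
    rw [fderiv_comp _ (h1.differentiableAt (by norm_num)) (h2.differentiableAt (by norm_num))]
    rfl
  have hdX : DifferentiableAt ℝ (fderiv ℝ X) u :=
    (hX.fderiv_right (m := 1) (by norm_num)).differentiableAt (by norm_num)
  have hdθ : DifferentiableAt ℝ (fderiv ℝ θ) (X u) :=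
    (hθ.fderiv_right (m := 1) (by norm_num)).differentiableAt (by norm_num)
  have hdZ : DifferentiableAt ℝ (fderiv ℝ (θ ∘ X)) u :=
    ((hθ.comp u hX).fderiv_right (m := 1) (by norm_num)).differentiableAt (by norm_num)
  have h2 := ((hdZ.hasFDerivAt).clm_apply (hasFDerivAt_const b u)).fderiv
  rw [h1.fderiv_eq] at h2
  have h3 := ((HasFDerivAt.comp (g := fderiv ℝ θ) u hdθ.hasFDerivAt
    (hX.differentiableAt (by norm_num)).hasFDerivAt).clm_apply
    ((hdX.hasFDerivAt).clm_apply (hasFDerivAt_const b u))).fderiv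
  have h4 := congrArg (fun L => L a) (h2.symm.trans h3)
  simpa [add_comm] using h4

section Cylinder

variable {N : Type*} [TopologicalSpace N] [ChartedSpace (Eu 3) N]

/-- `Θ` parametrizes a neighbourhood of a point of the cylinder `C`; the metric `g` is the one of
the Fermi coordinates, and `C` contains the points with `r = 0`. -/
structure IsCylinderParam (g : MetricTensor 3 N) (C : Set N) (c a : ℝ → ℝ) (Θ : Eu 3 → N)
    (w₀ : Eu 3) : Prop where
  coord_eq_zero : w₀ 1 = 0
  smooth : ∀ᶠ w in 𝓝 w₀, ContMDiffAt (𝓡 3) (𝓡 3) ∞ Θ w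
  metric : ∀ᶠ w in 𝓝 w₀, ∀ v v' : Eu 3,
    (g.pullback Θ : MetricTensor 3 (Eu 3)) w v v' = metricForm (fermiMetric c a) w v v'
  mem : ∀ᶠ w in 𝓝 w₀, w 1 = 0 → Θ w ∈ C

variable {S : Type*} [TopologicalSpace S] [ChartedSpace (Eu 2) S]
  [IsManifold (𝓡 2) ∞ S] [IsManifold (𝓡 3) ∞ N] {g : MetricTensor 3 N} {C : Set N}
  {κ τ k : ℝ} {c d a : ℝ → ℝ} {Θ : Eu 3 → N} {w₀ : Eu 3} {x : S → N} {p : S}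

lemma pullback_congr {m n : ℕ} {M N : Type*} [TopologicalSpace M] [ChartedSpace (Eu m) M]
    [TopologicalSpace N] [ChartedSpace (Eu n) N] (g : MetricTensor n N) {f f' : M → N} {p : M}
    (h : f =ᶠ[𝓝 p] f') (v w : Eu m) :
    (g.pullback f : MetricTensor m M) p v w = (g.pullback f' : MetricTensor m M) p v w := by
  -- Forgetting that tangent vectors depend on the base point permits rewriting of `f p`.
  let G : N → Eu n → Eu n → ℝ := g
  change G (f p) (dmf m n f p v) (dmf m n f p w) = G (f' p) (dmf m n f' p v) (dmf m n f' p w)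
  rw [h.eq_of_nhds, dmf_congr h]

/-- The induced metric of the cylinder is flat. -/
theorem exists_flatChart (hprof : FermiProfile κ τ k c d a)
    (hΘ : IsCylinderParam g C c a Θ w₀) (hx : IsSmoothEmbedding (𝓡 2) (𝓡 3) ∞ x)
    (hC : Set.range x = C) (hp : Θ w₀ = x p) :
    ∃ Y Ψ, cylIncl (Y p) = w₀ ∧
      IsLocalChart (g.pullback x : MetricTensor 2 S) (flatForm 2) Y Ψ p ∧
      ∀ᶠ q in 𝓝 p, Θ (cylIncl (Y q)) = x q := by
  have : Nonempty S := ⟨p⟩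
  set y₀ : Eu 2 := !₂[w₀ 0, w₀ 2] with hy₀
  have hι : cylIncl y₀ = w₀ := cylIncl_eq hΘ.coord_eq_zero
  have hιt : Tendsto cylIncl (𝓝 y₀) (𝓝 w₀) := by
    have := cylIncl.continuous.tendsto y₀
    rwa [hι] at this
  -- The slice `r = 0` of the ambient parametrization lies in the image of `x`, so it lifts to `S`.
  set Ψ : Eu 2 → S := fun y => Function.invFun x (Θ (cylIncl y)) with hΨ
  have hxΨ : ∀ᶠ y in 𝓝 y₀, x (Ψ y) = Θ (cylIncl y) := by
    filter_upwards [hιt.eventually hΘ.mem] with y hy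
    have := hy (cylIncl_one y)
    rw [← hC] at this
    exact Function.invFun_eq this
  have hinj : Function.Injective x := hx.isEmbedding.injective
  have hΨp : Ψ y₀ = p := by
    apply hinj
    rw [hxΨ.self_of_nhds, hι, hp]
  have hsm : ∀ᶠ y in 𝓝 y₀, ContMDiffAt (𝓡 2) (𝓡 3) ∞ (Θ ∘ cylIncl) y := by
    filter_upwards [hιt.eventually hΘ.smooth] with y hy
    exact hy.comp y cylIncl.contDiff.contMDiff.contMDiffAt
  have hΨsm : ∀ᶠ y in 𝓝 y₀, ContMDiffAt (𝓡 2) (𝓡 2) ∞ Ψ y := by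
    filter_upwards [hsm, hxΨ.eventually_nhds] with y h1 h2
    have h3 : ContMDiffAt (𝓡 2) (𝓡 3) ∞ (x ∘ Ψ) y := h1.congr_of_eventuallyEq h2
    -- A lift through an immersion is smooth once it is continuous and its composite is smooth;
    -- continuity comes from `x` being a topological embedding.
    refine (ContMDiffAt.iff_comp_isImmersionAt (hx.isImmersion.isImmersionAt (Ψ y))).mpr ⟨?_, h3⟩
    exact hx.isEmbedding.isInducing.continuousAt_iff.mpr h3.continuousAt
  have hmet : ∀ᶠ y in 𝓝 y₀, ∀ v w : Eu 2,
      ((g.pullback x : MetricTensor 2 S).pullback Ψ : MetricTensor 2 (Eu 2)) y v w =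
        flatForm 2 y v w := by
    filter_upwards [hΨsm, hxΨ.eventually_nhds, hιt.eventually hΘ.metric,
      hιt.eventually hΘ.smooth] with y h1 h2 h3 h4 v w
    have hιd : MDifferentiableAt (𝓡 2) (𝓡 3) cylIncl y :=
      cylIncl.differentiableAt.mdifferentiableAt
    rw [pullback_pullback g ((hx.contMDiff _).mdifferentiableAt (by simp))
      (h1.mdifferentiableAt (by simp)), pullback_congr (f := x ∘ Ψ) (f' := Θ ∘ cylIncl) g h2,
      ← pullback_pullback g (h4.mdifferentiableAt (by simp)) hιd, pullback_apply, h3,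
      hprof.metricForm_fermiMetric (cylIncl_one y), dmf_eq_fderiv,
      ContinuousLinearMap.fderiv, flatForm_apply]
    simp [Fin.sum_univ_three, cylIncl_zero, cylIncl_one, cylIncl_two, PiLp.inner_apply, mul_comm]
  obtain ⟨Y, hY0, hY⟩ := exists_isLocalChart hΨsm hmet (fun v hv => by
    rw [flatForm_apply] at hv
    exact inner_self_eq_zero.mp hv)
  rw [hΨp] at hY hY0
  refine ⟨Y, Ψ, by rw [hY0, hι], hY, ?_⟩
  have hYc : Tendsto Y (𝓝 p) (𝓝 y₀) := by
    have := hY.continuousAt.tendsto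
    rwa [hY0] at this
  filter_upwards [hY.left_inv, hYc.eventually hxΨ] with q h1 h2
  rw [← h2, h1]

/-- The coordinate expressions of the second fundamental form, the metric and the normal field of
the cylinder. -/
theorem stabilityPotential_eq (hprof : FermiProfile κ τ k c d a)
    (hΘ : IsCylinderParam g C c a Θ w₀) (hx : IsSmoothEmbedding (𝓡 2) (𝓡 3) ∞ x)
    (hC : Set.range x = C) (hp : Θ w₀ = x p) {η : (q : S) → TangentSpace (𝓡 3) (x q)}
    (hη : IsUnitNormal g x η) : stabilityPotential g x η p = k ^ 2 + κ := by
  obtain ⟨Y, Ψ, hYp, hY, hxY⟩ := exists_flatChart hprof hΘ hx hC hp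
  -- Inverting `Θ` gives Fermi coordinates on the ambient space; the required definiteness holds
  -- because the Fermi metric is the identity at `r = 0`.
  obtain ⟨θ, hθ0, hθ⟩ := exists_isLocalChart hΘ.smooth hΘ.metric (fun v hv => by
    rw [hprof.metricForm_fermiMetric hΘ.coord_eq_zero, Fin.sum_univ_three] at hv
    ext i
    fin_cases i <;> simp <;> nlinarith [mul_self_nonneg (v 0), mul_self_nonneg (v 1),
      mul_self_nonneg (v 2)])
  rw [hp] at hθ hθ0
  have hw1 : (θ (x p)) 1 = 0 := by rw [hθ0, hΘ.coord_eq_zero]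
  obtain ⟨hL1, hL2, hL3⟩ := hY.inCoordinates
  obtain ⟨hc1, hc2, hc3⟩ := hθ.inCoordinates
  set ε := chartAt (Eu 2) p with hε
  set e := chartAt (Eu 3) (x p) with he
  have hps : p ∈ ε.source := mem_chart_source _ _
  have hεp : ε.symm (ε p) = p := ε.left_inv hps
  have hes : x p ∈ e.source := mem_chart_source _ _
  have hexp : e.symm (e (x p)) = x p := e.left_inv hes
  set u := ε p with hu
  set z := e (x p) with hz
  set G := metricCoeff g (x p) with hG
  set ν : Eu 3 := η p with hν
  set θc : Eu 3 → Eu 3 := θ ∘ e.symm with hθc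
  set X : Eu 2 → Eu 3 := fun y => e (x (ε.symm y)) with hX
  set Lf : Eu 2 → Eu 2 := Y ∘ ε.symm with hLf
  have hXu : X u = z := by simp only [hX, hεp, hz]
  have hθcz : θc z = θ (x p) := by simp only [hθc, Function.comp_apply, hexp]
  have hθcz1 : (θc z) 1 = 0 := by rw [hθcz, hw1]
  -- the surface in Fermi coordinates
  have hxc : ContinuousAt x p := hx.contMDiff.continuous.continuousAt
  have hZ : θc ∘ X =ᶠ[𝓝 u] cylIncl ∘ Lf := by
    have h1 : ∀ᶠ q in 𝓝 p, θ (x q) = cylIncl (Y q) := by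
      have hcY : Tendsto (fun q => cylIncl (Y q)) (𝓝 p) (𝓝 (θ (x p))) := by
        have := (cylIncl.continuous.continuousAt.comp hY.continuousAt).tendsto
        rwa [Function.comp_apply, hYp, ← hθ0] at this
      filter_upwards [hxY, hcY.eventually hθ.right_inv] with q h1 h2
      rw [← h1, h2]
    have h2 : ∀ᶠ q in 𝓝 p, x q ∈ e.source := hxc.eventually (e.open_source.mem_nhds hes)
    have h3 : Tendsto ε.symm (𝓝 u) (𝓝 p) := by
      have := (ε.continuousAt_symm (ε.map_source hps)).tendsto
      rwa [hεp] at this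
    filter_upwards [h3.eventually h1, h3.eventually h2] with y hy1 hy2
    simp only [hθc, hX, hLf, Function.comp_apply]
    rw [e.left_inv hy2, hy1]
  have hXs : ContDiffAt ℝ ∞ X u := by
    have h1 : ContMDiffAt (𝓡 2) (𝓡 3) ∞ x (ε.symm u) := hx.contMDiff _
    have h2 : ContMDiffAt (𝓡 3) (𝓡 3) ∞ e (x (ε.symm u)) := by
      rw [hεp]; exact contMDiffAt_chart' (x p) hes
    exact (h2.comp u (h1.comp u (contMDiffAt_chart_symm p (ε.map_source hps)))).contDiffAt
  set L := fderiv ℝ Lf u with hL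
  have hDZ : ∀ v, fderiv ℝ θc z (fderiv ℝ X u v) = cylIncl (L v) := by
    intro v
    have h1 : fderiv ℝ (θc ∘ X) u v = fderiv ℝ θc z (fderiv ℝ X u v) := by
      rw [fderiv_comp u (by rw [hXu]; exact hc1.differentiableAt (by simp))
        (hXs.differentiableAt (by simp)), hXu]
      rfl
    rw [← h1, hZ.fderiv_eq, fderiv_comp u cylIncl.differentiableAt
      (hL1.differentiableAt (by simp)), ContinuousLinearMap.fderiv]
    rfl
  -- In Fermi coordinates the surface lies in the plane `r = 0`, so the `r`-component of its second
  -- derivative vanishes. Through the connection law, the normal part of the covariant derivative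
  -- reduces to a Christoffel symbol.
  have hD2Z : ∀ v w, (fderiv ℝ (fderiv ℝ θc) z (fderiv ℝ X u v) (fderiv ℝ X u w)
      + fderiv ℝ θc z (fderiv ℝ (fderiv ℝ X) u v w)) 1 = 0 := by
    intro v w
    have h1 := second_fderiv_comp (θ := θc) (X := X) (u := u)
      (by rw [hXu]; exact hc1.of_le (by norm_cast)) (hXs.of_le (by norm_cast)) v w
    rw [hXu] at h1
    have h2 : fderiv ℝ (fderiv ℝ (θc ∘ X)) u v w = fderiv ℝ (fderiv ℝ (cylIncl ∘ Lf)) u v w := by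
      rw [hZ.fderiv.fderiv_eq]
    have h3 := second_fderiv_comp (θ := cylIncl) (X := Lf) (u := u)
      cylIncl.contDiff.contDiffAt (hL1.of_le (by norm_cast)) v w
    have h4 : fderiv ℝ (fderiv ℝ (cylIncl : Eu 2 → Eu 3)) (Lf u) = 0 := by
      have : fderiv ℝ (cylIncl : Eu 2 → Eu 3) = fun _ => cylIncl := by
        funext y; exact cylIncl.fderiv
      rw [this, fderiv_fun_const]
      rfl
    rw [← h1, h2, h3, h4, ContinuousLinearMap.fderiv]
    simp [cylIncl_one]
  -- the normal
  set ν' : Eu 3 := fderiv ℝ θc z ν with hν'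
  have hform : ∀ v w, metricForm G z v w = ∑ i, fderiv ℝ θc z v i * fderiv ℝ θc z w i := by
    intro v w
    rw [hc3.self_of_nhds v w]
    exact hprof.metricForm_fermiMetric hθcz1 _ _
  have hθd : MDifferentiableAt (𝓡 3) (𝓡 3) θ (x p) :=
    hθ.smooth.self_of_nhds.mdifferentiableAt (by simp)
  have hxd : MDifferentiableAt (𝓡 2) (𝓡 3) x p := (hx.contMDiff p).mdifferentiableAt (by simp)
  have hθdm : dmf 3 3 θ (x p) = fderiv ℝ θc z := dmf_eq_fderiv_comp_symm hθd
  have hgp : ∀ v w : Eu 3, g (x p) v w = ∑ i, fderiv ℝ θc z v i * fderiv ℝ θc z w i := by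
    intro v w
    rw [hθ.metric.self_of_nhds, hθdm]
    exact hprof.metricForm_fermiMetric hw1 _ _
  have hxdm : ∀ v : Eu 2, fderiv ℝ θc z (dmf 2 3 x p v) = cylIncl (L v) := by
    intro v
    have h1 : MDifferentiableAt (𝓡 2) (𝓡 3) (θ ∘ x) p := hθd.comp p hxd
    have h2 : (θ ∘ x) ∘ ε.symm =ᶠ[𝓝 u] cylIncl ∘ Lf := by
      refine EventuallyEq.trans ?_ hZ
      have h3 : Tendsto ε.symm (𝓝 u) (𝓝 p) := by
        have := (ε.continuousAt_symm (ε.map_source hps)).tendsto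
        rwa [hεp] at this
      filter_upwards [h3.eventually (hxc.eventually (e.open_source.mem_nhds hes))] with y hy
      simp only [hθc, hX, Function.comp_apply]
      rw [e.left_inv hy]
    rw [← hθdm, ← dmf_comp_apply hθd hxd, dmf_eq_fderiv_comp_symm h1, h2.fderiv_eq,
      fderiv_comp u cylIncl.differentiableAt (hL1.differentiableAt (by simp)),
      ContinuousLinearMap.fderiv]
    rfl
  obtain ⟨hη1, hη2⟩ := hη p
  have hn1 : ν' 0 ^ 2 + ν' 1 ^ 2 + ν' 2 ^ 2 = 1 := by
    have := (hgp ν ν).symm.trans hη1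
    rw [Fin.sum_univ_three] at this
    linarith
  have hn2 : ∀ v, ν' 0 * L v 0 + ν' 2 * L v 1 = 0 := by
    intro v
    have := (hgp ν (dmf 2 3 x p v)).symm.trans (hη2 v)
    rw [hxdm, Fin.sum_univ_three, cylIncl_zero, cylIncl_one, cylIncl_two] at this
    linarith
  -- Since `L` is invertible, the normal is orthogonal to the whole plane `r = 0`; being a unit
  -- vector, it is `±∂_r`.
  have hn3 : ∀ v : Eu 2, ν' 0 * v 0 + ν' 2 * v 1 = 0 := by
    intro v
    obtain ⟨E, hE⟩ := hL2
    have := hn2 (E.symm v)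
    rw [← hE] at this
    simpa using this
  have hn0 : ν' 0 = 0 := by simpa [coordVec] using hn3 (coordVec 0)
  have hn2' : ν' 2 = 0 := by simpa [coordVec] using hn3 (coordVec 1)
  have hnn : ν' 1 ^ 2 = 1 := by rw [hn0, hn2'] at hn1; linarith
  -- connection and curvature
  obtain ⟨hlaw, hric⟩ := christoffel_ricci_pullback (G := G) (G' := fermiMetric c a) (θ := θc)
    (z := z) hc1 hc2
    (Eventually.of_forall fun y i j => hprof.differentiableAt_fermiMetric i j y)
    (Eventually.of_forall fun y => FermiProfile.isSymm_fermiMetric c a y)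
    (by
      filter_upwards [hprof.eventually_ne_zero hθcz1] with y hy
      rw [FermiProfile.det_fermiMetric]
      exact (pow_ne_zero 2 hy).isUnit)
    (fun m i j => hprof.differentiableAt_christoffel hθcz1 m i j) hc3
  have hricci : ricci g (x p) (η p) = κ - 2 * τ ^ 2 := by
    have h1 : ricci g (x p) (η p) = ∑ i, ∑ j, ricciCoeff G i j z * ν i * ν j := rfl
    rw [h1, hric, ← hν']
    simp only [Fin.sum_univ_three, hn0, hn2', mul_zero, zero_mul, add_zero, zero_add]
    rw [hprof.ricciCoeff_one_one hθcz1]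
    linear_combination (κ - 2 * τ ^ 2) * hnn
  set J := jac L with hJ
  set Bm : Matrix (Fin 2) (Fin 2) ℝ := !![k, -τ; -τ, 0] with hBm
  have hII : secondFF g x η p = ν' 1 • (J.transpose * Bm * J) := by
    ext i j
    have hpd1 : ∀ᶠ y in 𝓝 u, ∀ b j, pd j (fun y => X y b) y = fderiv ℝ X y (coordVec j) b := by
      have hX1 : ContDiffAt ℝ 1 X u := hXs.of_le (by norm_cast)
      filter_upwards [hX1.eventually (by simp)] with y hy b j
      have := ((EuclideanSpace.proj b : Eu 3 →L[ℝ] ℝ).hasFDerivAt.comp y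
        (hy.differentiableAt (by norm_num)).hasFDerivAt).fderiv
      change fderiv ℝ ((EuclideanSpace.proj b : Eu 3 →L[ℝ] ℝ) ∘ X) y (coordVec j) = _
      rw [this]
      simp
    have hpd2 : ∀ b i j, pd i (pd j (fun y => X y b)) u =
        fderiv ℝ (fderiv ℝ X) u (coordVec i) (coordVec j) b := by
      intro b i j
      have h1 : pd j (fun y => X y b) =ᶠ[𝓝 u] fun y =>
          (EuclideanSpace.proj b : Eu 3 →L[ℝ] ℝ) (fderiv ℝ X y (coordVec j)) := by
        filter_upwards [hpd1] with y hy
        rw [hy]; rfl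
      have hd : DifferentiableAt ℝ (fderiv ℝ X) u :=
        (hXs.fderiv_right (m := 1) (by norm_cast)).differentiableAt (by norm_num)
      have h2 := ((EuclideanSpace.proj b : Eu 3 →L[ℝ] ℝ).hasFDerivAt.comp u
        (hd.hasFDerivAt.clm_apply (hasFDerivAt_const (coordVec j) u))).fderiv
      rw [pd, h1.fderiv_eq]
      change fderiv ℝ ((EuclideanSpace.proj b : Eu 3 →L[ℝ] ℝ) ∘
        fun y => fderiv ℝ X y (coordVec j)) u (coordVec i) = _
      rw [h2]
      simp
    -- The covariant derivative of `∂_j x` along `∂_i`, expressed in the preferred ambient chart.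
    set V : Eu 3 := fderiv ℝ (fderiv ℝ X) u (coordVec i) (coordVec j)
      + christoffelForm G z (fderiv ℝ X u (coordVec i)) (fderiv ℝ X u (coordVec j)) with hV
    have h1 : secondFF g x η p i j = metricForm G z V ν := by
      have h0 : secondFF g x η p i j = ∑ a, ∑ b, G z a b *
        (pd i (pd j (fun y => X y a)) u + ∑ c, ∑ d, christoffel G a c d z *
          pd i (fun y => X y c) u * pd j (fun y => X y d) u) * ν b := rfl
      rw [h0, metricForm_apply]
      refine Finset.sum_congr rfl fun b _ => Finset.sum_congr rfl fun b' _ => ?_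
      have h2 : V b = pd i (pd j (fun y => X y b)) u + ∑ c, ∑ d, christoffel G b c d z *
          pd i (fun y => X y c) u * pd j (fun y => X y d) u := by
        rw [hV, PiLp.add_apply, hpd2, christoffelForm_apply]
        congr 1
        refine Finset.sum_congr rfl fun c _ => Finset.sum_congr rfl fun d _ => ?_
        rw [hpd1.self_of_nhds, hpd1.self_of_nhds]
        ring
      rw [← h2]
      ring
    rw [h1, hform, ← hν', Fin.sum_univ_three, hn0, hn2']
    have h3 : fderiv ℝ θc z V 1 = christoffelForm (fermiMetric c a) (θc z)
        (cylIncl (L (coordVec i))) (cylIncl (L (coordVec j))) 1 := by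
      have := hD2Z (coordVec i) (coordVec j)
      rw [hV, map_add, hlaw, hDZ, hDZ, PiLp.add_apply, PiLp.add_apply]
      rw [PiLp.add_apply] at this
      linarith
    rw [h3, christoffelForm_apply]
    simp only [hprof.christoffel_one hθcz1]
    have hJi : ∀ b i, L (coordVec i) b = J b i := fun b i => rfl
    simp [Fin.sum_univ_three, cylIncl_zero, cylIncl_one, cylIncl_two, hJi, Matrix.mul_apply,
      Fin.sum_univ_two, hBm]
    ring
  have hJu : IsUnit J.det := isUnit_det_jac hL2
  have hJt : IsUnit J.transpose.det := by rwa [Matrix.det_transpose]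
  have hGS : metricCoeff (g.pullback x : MetricTensor 2 S) p u = J.transpose * J :=
    metricCoeff_eq_jac hL3.self_of_nhds
  have hA : shapeOp g x η p = ν' 1 • (J⁻¹ * Bm * J) := by
    have : shapeOp g x η p =
      (metricCoeff (g.pullback x : MetricTensor 2 S) p u)⁻¹ * secondFF g x η p := rfl
    rw [this, hGS, hII, Matrix.mul_inv_rev, Matrix.mul_smul]
    congr 1
    rw [Matrix.mul_assoc J⁻¹, ← Matrix.mul_assoc J.transpose⁻¹, ← Matrix.mul_assoc J.transpose⁻¹,
      Matrix.nonsing_inv_mul _ hJt, Matrix.one_mul, Matrix.mul_assoc]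
  -- The sign of the normal is squared away and the trace is invariant under conjugation by `J`,
  -- leaving the trace of `Bm * Bm`.
  have htr : (shapeOp g x η p * shapeOp g x η p).trace = k ^ 2 + 2 * τ ^ 2 := by
    have h1 : J⁻¹ * Bm * J * (J⁻¹ * Bm * J) = J⁻¹ * (Bm * Bm * J) := by
      calc J⁻¹ * Bm * J * (J⁻¹ * Bm * J) = J⁻¹ * Bm * (J * J⁻¹) * Bm * J := by
            simp only [Matrix.mul_assoc]
        _ = J⁻¹ * (Bm * Bm * J) := by
            rw [Matrix.mul_nonsing_inv _ hJu, Matrix.mul_one]; simp only [Matrix.mul_assoc]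
    rw [hA, Matrix.smul_mul, Matrix.mul_smul, smul_smul, ← sq, hnn, one_smul, h1,
      Matrix.trace_mul_comm, Matrix.mul_assoc, Matrix.mul_nonsing_inv _ hJu, Matrix.mul_one]
    simp [hBm, Matrix.trace_fin_two]
    ring
  rw [stabilityPotential, htr, hricci]
  ring

end Cylinder

/-! ### Test functions and stability -/

section Transition

open Real

/-- The function attains its minimum at such points, which covers the junction `y = 0` without
one-sided limits. -/
lemma deriv_smoothTransition_of_nonpos {y : ℝ} (hy : y ≤ 0) : deriv smoothTransition y = 0 :=
  IsLocalMin.deriv_eq_zero (Eventually.of_forall fun z => by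
    rw [smoothTransition.zero_of_nonpos hy]; exact smoothTransition.nonneg z)

lemma deriv_smoothTransition_of_one_le {y : ℝ} (hy : 1 ≤ y) : deriv smoothTransition y = 0 :=
  IsLocalMax.deriv_eq_zero (Eventually.of_forall fun z => by
    rw [smoothTransition.one_of_one_le hy]; exact smoothTransition.le_one z)

lemma exists_deriv_smoothTransition_le : ∃ D, ∀ y, |deriv smoothTransition y| ≤ D := by
  have hc : Continuous (deriv smoothTransition) :=
    (smoothTransition.contDiff (n := 1)).continuous_deriv le_rfl
  obtain ⟨D, hD⟩ := (isCompact_Icc (a := (0 : ℝ)) (b := 1)).exists_bound_of_continuousOn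
    hc.continuousOn
  refine ⟨max D 0, fun y => ?_⟩
  by_cases h : y ∈ Set.Icc (0 : ℝ) 1
  · exact (hD y h).trans (le_max_left _ _)
  · have : deriv smoothTransition y = 0 := by
      rw [Set.mem_Icc, not_and_or, not_le, not_le] at h
      rcases h with h | h
      · exact deriv_smoothTransition_of_nonpos h.le
      · exact deriv_smoothTransition_of_one_le h.le
    rw [this, abs_zero]
    exact le_max_right _ _

/-- A cutoff function, equal to `1` on `[1, R]` and to `0` outside `[0, R + 1]`. -/
def plateau (R : ℝ) (z : ℝ) : ℝ := smoothTransition z * smoothTransition (R + 1 - z)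

variable {R : ℝ}

lemma contDiff_plateau : ContDiff ℝ ∞ (plateau R) :=
  smoothTransition.contDiff.mul (smoothTransition.contDiff.comp (by fun_prop))

lemma plateau_eq_one {z : ℝ} (h1 : 1 ≤ z) (h2 : z ≤ R) : plateau R z = 1 := by
  rw [plateau, smoothTransition.one_of_one_le h1, smoothTransition.one_of_one_le (by linarith),
    one_mul]

lemma plateau_eq_zero {z : ℝ} (h : z ∉ Set.Ioo 0 (R + 1)) : plateau R z = 0 := by
  rw [Set.mem_Ioo, not_and_or, not_lt, not_lt] at h
  rcases h with h | h
  · rw [plateau, smoothTransition.zero_of_nonpos h, zero_mul]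
  · rw [plateau, smoothTransition.zero_of_nonpos (x := R + 1 - z) (by linarith), mul_zero]

lemma plateau_nonneg (z : ℝ) : 0 ≤ plateau R z :=
  mul_nonneg (smoothTransition.nonneg _) (smoothTransition.nonneg _)

lemma plateau_le_one (z : ℝ) : plateau R z ≤ 1 :=
  mul_le_one₀ (smoothTransition.le_one _) (smoothTransition.nonneg _) (smoothTransition.le_one _)

/-- Extremality gives the vanishing also at the endpoints of the two regions, so half-open slabs can
be used later. -/
lemma deriv_plateau_eq_zero {z : ℝ} (h : z ∈ Set.Icc 1 R ∨ z ∉ Set.Ioo 0 (R + 1)) :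
    deriv (plateau R) z = 0 := by
  rcases h with h | h
  · exact IsLocalMax.deriv_eq_zero (Eventually.of_forall fun y => by
      rw [plateau_eq_one h.1 h.2]; exact plateau_le_one y)
  · exact IsLocalMin.deriv_eq_zero (Eventually.of_forall fun y => by
      rw [plateau_eq_zero h]; exact plateau_nonneg y)

/-- The bound does not depend on `R`: each factor is at most `1` and has derivative at most `D` in
absolute value. This uniformity keeps the energy of the cutoffs bounded as they get longer. -/
lemma exists_deriv_plateau_le : ∃ D, ∀ R z, deriv (plateau R) z ^ 2 ≤ D := by
  obtain ⟨D, hD⟩ := exists_deriv_smoothTransition_le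
  refine ⟨(2 * D) ^ 2, fun R z => ?_⟩
  have hd : ∀ y, HasDerivAt smoothTransition (deriv smoothTransition y) y := fun y =>
    ((smoothTransition.contDiff (n := 1)).differentiable (by norm_num) y).hasDerivAt
  have h1 := ((hd z).mul ((hd (R + 1 - z)).comp z ((hasDerivAt_id z).const_sub (R + 1)))).deriv
  have h2 : deriv (plateau R) z = deriv smoothTransition z * smoothTransition (R + 1 - z) +
      smoothTransition z * (deriv smoothTransition (R + 1 - z) * -1) := h1
  have hD0 : 0 ≤ D := (abs_nonneg _).trans (hD 0)
  have hst : ∀ y, |smoothTransition y| ≤ 1 := fun y => by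
    rw [abs_of_nonneg (smoothTransition.nonneg y)]; exact smoothTransition.le_one y
  rw [h2, sq_le_sq, abs_of_nonneg (a := 2 * D) (by positivity)]
  refine (abs_add_le _ _).trans ?_
  rw [abs_mul, abs_mul, abs_mul, abs_neg, abs_one, mul_one]
  have h3 := mul_le_mul (hD z) (hst (R + 1 - z)) (abs_nonneg _) hD0
  have h4 := mul_le_mul (hst z) (hD (R + 1 - z)) (abs_nonneg _) zero_le_one
  linarith

end Transition

/-! ### Instability of flat manifolds with a positive constant potential. -/

section FlatStability

variable {n : ℕ} {M : Type*} [TopologicalSpace M] [ChartedSpace (Eu n) M]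
  [IsManifold (𝓡 n) ∞ M] [MeasurableSpace M] [BorelSpace M] [SecondCountableTopology M]
  {h : MetricTensor n M}

lemma gradSq_const (hflat : ∀ p, ∃ Y Ψ, IsLocalChart h (flatForm n) Y Ψ p) (b : ℝ) (p : M) :
    gradSq h (fun _ => b) p = 0 := by
  obtain ⟨Y, Ψ, hY⟩ := hflat p
  have : (fun _ : M => b) ∘ Ψ = fun _ => b := rfl
  rw [gradSq_eq hY (by rw [this]; exact differentiableAt_const b), this]
  simp [pd]

/-- The constant `1` has no gradient, and its energy is `-q` times the volume, which is positive
and, by compactness, finite. -/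
lemma exists_unstable_of_compactSpace [CompactSpace M] [Nonempty M]
    (hflat : ∀ p, ∃ Y Ψ, IsLocalChart h (flatForm n) Y Ψ p) {q : ℝ} (hq : 0 < q) :
    ∃ f : M → ℝ, ContMDiff (𝓡 n) 𝓘(ℝ, ℝ) ∞ f ∧ HasCompactSupport f ∧
      ∫ p, (gradSq h f p - q * f p ^ 2) ∂(riemannianMeasure h) < 0 := by
  have := isLocallyFiniteMeasure_of_flat hflat
  refine ⟨fun _ => 1, contMDiff_const, HasCompactSupport.of_compactSpace _, ?_⟩
  have hpos := riemannianMeasure_pos_of_flat hflat isOpen_univ Set.univ_nonempty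
  have hfin : riemannianMeasure h Set.univ < ⊤ := isCompact_univ.measure_lt_top
  simp only [gradSq_const hflat, one_pow, mul_one, zero_sub, integral_const, smul_eq_mul]
  have : 0 < (riemannianMeasure h).real Set.univ := ENNReal.toReal_pos hpos.ne' hfin.ne
  nlinarith

/-- The constant in `ζ ∘ T = ζ + 1` disappears on differentiation. -/
lemma gradSq_isometry {p : M} {Y : M → Eu n} {Ψ : Eu n → M}
    (hY : IsLocalChart h (flatForm n) Y Ψ p) {T T' : M → M}
    (hT : ContMDiff (𝓡 n) (𝓡 n) ∞ T) (hT' : ContMDiff (𝓡 n) (𝓡 n) ∞ T')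
    (h1 : ∀ q, T (T' q) = q) (h2 : ∀ q, T' (T q) = q)
    (hiso : ∀ q, ∀ v w : Eu n, h q v w = (h.pullback T' : MetricTensor n M) q v w)
    {ζ : M → ℝ} (hζ : ContMDiff (𝓡 n) 𝓘(ℝ, ℝ) ∞ ζ) (hζT : ∀ q, ζ (T q) = ζ q + 1) :
    gradSq h ζ (T p) = gradSq h ζ p := by
  have hd : DifferentiableAt ℝ (ζ ∘ Ψ) (Y p) :=
    (((hζ _).comp _ hY.smooth_symm.self_of_nhds).contDiffAt (n := ∞)).differentiableAt (by simp)
  have he : ζ ∘ (T ∘ Ψ) = fun y => (ζ ∘ Ψ) y + 1 := by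
    funext y; simp [hζT]
  rw [gradSq_eq hY hd, gradSq_eq (hY.map_isometry hT hT' h1 h2 hiso), he]
  · simp only [pd, Function.comp_apply, h2]
    refine Finset.sum_congr rfl fun i _ => ?_
    rw [fderiv_add_const]
    rfl
  · rw [he, Function.comp_apply, h2]
    exact hd.add_const 1

/-- The unit slabs of the height are translates of one another, so they have a common volume `m`. A
plateau in the height has gradient only in its two end slabs, with total energy at most `2 D B m`,
while it equals `1` on `j` middle slabs and gains `q j m` there. A large `j` makes the form
negative. -/
theorem exists_unstable_of_height (hflat : ∀ p, ∃ Y Ψ, IsLocalChart h (flatForm n) Y Ψ p)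
    {q : ℝ} (hq : 0 < q) {T T' : M → M}
    (hT : ContMDiff (𝓡 n) (𝓡 n) ∞ T) (hT' : ContMDiff (𝓡 n) (𝓡 n) ∞ T')
    (h1 : ∀ q, T (T' q) = q) (h2 : ∀ q, T' (T q) = q)
    (hiso : ∀ q, ∀ v w : Eu n, h q v w = (h.pullback T' : MetricTensor n M) q v w)
    {ζ : M → ℝ} (hζ : ContMDiff (𝓡 n) 𝓘(ℝ, ℝ) ∞ ζ) (hζT : ∀ q, ζ (T q) = ζ q + 1)
    (hcpt : ∀ R, IsCompact (ζ ⁻¹' Set.Icc 0 R)) (hne : (ζ ⁻¹' Set.Ioo 0 1).Nonempty) :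
    ∃ f : M → ℝ, ContMDiff (𝓡 n) 𝓘(ℝ, ℝ) ∞ f ∧ HasCompactSupport f ∧
      ∫ p, (gradSq h f p - q * f p ^ 2) ∂(riemannianMeasure h) < 0 := by
  have := isLocallyFiniteMeasure_of_flat hflat
  set μ := riemannianMeasure h with hμ
  have hζc : Continuous ζ := hζ.continuous
  have hgc : ∀ f : M → ℝ, ContMDiff (𝓡 n) 𝓘(ℝ, ℝ) ∞ f → Continuous (gradSq h f) := fun f hf =>
    continuous_iff_continuousAt.mpr fun p => by
      obtain ⟨Y, Ψ, hY⟩ := hflat p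
      exact continuousAt_gradSq hY hf
  have hζT' : ∀ q, ζ (T' q) = ζ q - 1 := fun q => by
    have := hζT (T' q)
    rw [h1] at this
    linarith
  -- the gradient of the height is bounded
  have hbdd : ∃ B, 0 ≤ B ∧ ∀ p, 0 ≤ ζ p → gradSq h ζ p ≤ B := by
    obtain ⟨B, hB⟩ := (hcpt 1).exists_bound_of_continuousOn (hgc ζ hζ).continuousOn
    refine ⟨max B 0, le_max_right _ _, ?_⟩
    -- Repeated downward translation moves any point of nonnegative height into the compact slab
    -- `[0, 1]` without changing the gradient norm.
    have hind : ∀ j : ℕ, ∀ p, 0 ≤ ζ p → ζ p ≤ j + 1 → gradSq h ζ p ≤ max B 0 := by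
      intro j
      induction j with
      | zero =>
        intro p hp hp'
        exact (le_abs_self _).trans ((hB p ⟨hp, by simpa using hp'⟩).trans (le_max_left _ _))
      | succ j ih =>
        intro p hp hp'
        by_cases hp1 : ζ p ≤ 1
        · exact (le_abs_self _).trans ((hB p ⟨hp, hp1⟩).trans (le_max_left _ _))
        · have h3 := ih (T' p) (by rw [hζT']; linarith) (by rw [hζT']; push_cast at hp'; linarith)
          obtain ⟨Y, Ψ, hY⟩ := hflat (T' p)
          rwa [← gradSq_isometry hY hT hT' h1 h2 hiso hζ hζT, h1] at h3
    intro p hp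
    obtain ⟨j, hj⟩ := exists_nat_ge (ζ p)
    exact hind j p hp (by linarith)
  obtain ⟨B, hB0, hB⟩ := hbdd
  obtain ⟨D, hD⟩ := exists_deriv_plateau_le
  have hD0 : 0 ≤ D := (sq_nonneg _).trans (hD 0 0)
  have hmeas : ∀ a b : ℝ, MeasurableSet (ζ ⁻¹' Set.Ico a b) := fun a b =>
    hζc.measurable measurableSet_Ico
  have hfin : ∀ a b : ℝ, 0 ≤ a → μ (ζ ⁻¹' Set.Ico a b) < ⊤ := fun a b ha =>
    (measure_mono (Set.preimage_mono (Set.Ico_subset_Icc_self.trans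
      (Set.Icc_subset_Icc_left ha)))).trans_lt (hcpt b).measure_lt_top
  set m := μ.real (ζ ⁻¹' Set.Ico 0 1) with hm
  have hmpos : 0 < m := by
    refine ENNReal.toReal_pos (ne_of_gt ?_) (hfin 0 1 le_rfl).ne
    exact (riemannianMeasure_pos_of_flat hflat (isOpen_Ioo.preimage hζc) hne).trans_le
      (measure_mono (Set.preimage_mono Set.Ioo_subset_Ico_self))
  have hmj : ∀ j : ℕ, μ.real (ζ ⁻¹' Set.Ico (j : ℝ) (j + 1)) = m := by
    intro j
    induction j with
    | zero => simp [hm]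
    | succ j ih =>
      rw [← ih, Measure.real, Measure.real,
        ← riemannianMeasure_image_isometry hflat hT hT' h1 h2 hiso (hmeas j (j + 1))]
      congr 2
      ext p
      simp only [Set.mem_preimage, Set.mem_Ico, hζT']
      push_cast
      constructor <;> rintro ⟨h3, h4⟩ <;> constructor <;> linarith
  have hmB : ∀ j : ℕ, μ.real (ζ ⁻¹' Set.Ico (1 : ℝ) (j + 1)) = j * m := by
    intro j
    induction j with
    | zero => simp
    | succ j ih =>
      have h3 : ζ ⁻¹' Set.Ico (1 : ℝ) ((j + 1 : ℕ) + 1) =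
          ζ ⁻¹' Set.Ico (1 : ℝ) (j + 1) ∪ ζ ⁻¹' Set.Ico ((j + 1 : ℕ) : ℝ) ((j + 1 : ℕ) + 1) := by
        rw [← Set.preimage_union, Nat.cast_succ, Set.Ico_union_Ico_eq_Ico] <;>
          linarith [(Nat.cast_nonneg j : (0 : ℝ) ≤ j)]
      rw [h3, measureReal_union (Disjoint.preimage _ (by
        rw [Nat.cast_succ]; exact Set.Ico_disjoint_Ico_same)) (hmeas _ _)
        (hfin _ _ zero_le_one).ne (hfin _ _ (by positivity)).ne, ih, hmj]
      push_cast
      ring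
  -- Enough middle slabs for the mass `q j` to exceed the energy `2 D B` of the two ends. With `R =
  -- j + 1` the interval `[1, R)` consists of exactly `j` unit slabs.
  obtain ⟨j, hj⟩ := exists_nat_gt (2 * (D * B) / q)
  have hj' : 2 * (D * B) < j * q := by rwa [div_lt_iff₀ hq] at hj
  set R : ℝ := j + 1 with hR
  have hR1 : 1 ≤ R := by rw [hR]; linarith [(Nat.cast_nonneg j : (0 : ℝ) ≤ j)]
  have hfs : ContMDiff (𝓡 n) 𝓘(ℝ, ℝ) ∞ (plateau R ∘ ζ) := contDiff_plateau.contMDiff.comp hζ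
  have hcs : IsCompact (ζ ⁻¹' Set.Icc 0 (R + 1)) := hcpt _
  have hcl : IsClosed (ζ ⁻¹' Set.Icc 0 (R + 1)) := isClosed_Icc.preimage hζc
  have hgrad : ∀ p, gradSq h (plateau R ∘ ζ) p = deriv (plateau R) (ζ p) ^ 2 * gradSq h ζ p := by
    intro p
    obtain ⟨Y, Ψ, hY⟩ := hflat p
    exact gradSq_comp hY hζ (contDiff_plateau.differentiable (by simp))
  have hsupp : ∀ p ∉ ζ ⁻¹' Set.Icc 0 (R + 1), plateau R (ζ p) = 0 := fun p hp =>
    plateau_eq_zero fun h3 => hp (Set.Ioo_subset_Icc_self h3)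
  refine ⟨plateau R ∘ ζ, hfs, HasCompactSupport.intro' hcs hcl hsupp, ?_⟩
  set A₀ := ζ ⁻¹' Set.Ico (0 : ℝ) 1
  set A₁ := ζ ⁻¹' Set.Ico (1 : ℝ) (j + 1)
  set A₂ := ζ ⁻¹' Set.Ico ((j + 1 : ℕ) : ℝ) ((j + 1 : ℕ) + 1)
  have hi : ∀ A : Set M, MeasurableSet A → μ A < ⊤ → ∀ b : ℝ,
      Integrable (A.indicator fun _ => b) μ := fun A hA hA' b =>
    (integrable_indicator_iff hA).mpr (integrableOn_const hA'.ne)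
  have hi₀ := hi A₀ (hmeas _ _) (hfin _ _ le_rfl) (D * B)
  have hi₁ := hi A₁ (hmeas _ _) (hfin _ _ zero_le_one) (-q)
  have hi₂ := hi A₂ (hmeas _ _) (hfin _ _ (by positivity)) (D * B)
  have hF : Integrable (fun p => gradSq h (plateau R ∘ ζ) p - q * (plateau R ∘ ζ) p ^ 2) μ := by
    refine Continuous.integrable_of_hasCompactSupport ?_ ?_
    · exact (hgc _ hfs).sub (continuous_const.mul (hfs.continuous.pow 2))
    · refine HasCompactSupport.intro' hcs hcl fun p hp => ?_
      rw [hgrad, deriv_plateau_eq_zero (Or.inr fun h3 => hp (Set.Ioo_subset_Icc_self h3)),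
        Function.comp_apply, hsupp p hp]
      simp
  -- The integrand is dominated by a step function: `D * B` on the two end slabs, `-q` on the middle
  -- ones, zero elsewhere. Its integral is `(2 D B - q j) m`.
  have hle : ∀ p, gradSq h (plateau R ∘ ζ) p - q * (plateau R ∘ ζ) p ^ 2 ≤
      A₀.indicator (fun _ => D * B) p + A₁.indicator (fun _ => -q) p
        + A₂.indicator (fun _ => D * B) p := by
    intro p
    rw [hgrad, Function.comp_apply]
    have hbound : 0 ≤ ζ p → deriv (plateau R) (ζ p) ^ 2 * gradSq h ζ p ≤ D * B := fun h0 =>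
      (mul_le_mul_of_nonneg_left (hB p h0) (sq_nonneg _)).trans
        (mul_le_mul_of_nonneg_right (hD _ _) hB0)
    have hsq : 0 ≤ q * plateau R (ζ p) ^ 2 := by positivity
    have hjR : ((j + 1 : ℕ) : ℝ) = R := by push_cast; rfl
    rcases lt_or_ge (ζ p) 0 with h0 | h0
    · have e0 : p ∉ A₀ := fun h3 => by linarith [h3.1]
      have e1 : p ∉ A₁ := fun h3 => by linarith [h3.1]
      have e2 : p ∉ A₂ := fun h3 => by have := h3.1; rw [hjR] at this; linarith
      rw [Set.indicator_of_notMem e0, Set.indicator_of_notMem e1, Set.indicator_of_notMem e2,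
        deriv_plateau_eq_zero (Or.inr fun h3 => by linarith [h3.1])]
      linarith
    rcases lt_or_ge (ζ p) 1 with h1' | h1'
    · have e0 : p ∈ A₀ := ⟨h0, h1'⟩
      have e1 : p ∉ A₁ := fun h3 => by linarith [h3.1]
      have e2 : p ∉ A₂ := fun h3 => by have := h3.1; rw [hjR] at this; linarith
      rw [Set.indicator_of_mem e0, Set.indicator_of_notMem e1, Set.indicator_of_notMem e2]
      linarith [hbound h0]
    rcases lt_or_ge (ζ p) R with h2' | h2'
    · have e0 : p ∉ A₀ := fun h3 => by linarith [h3.2]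
      have e1 : p ∈ A₁ := ⟨h1', h2'⟩
      have e2 : p ∉ A₂ := fun h3 => by have := h3.1; rw [hjR] at this; linarith
      rw [Set.indicator_of_notMem e0, Set.indicator_of_mem e1, Set.indicator_of_notMem e2,
        deriv_plateau_eq_zero (Or.inl ⟨h1', h2'.le⟩), plateau_eq_one h1' h2'.le]
      linarith
    have e0 : p ∉ A₀ := fun h3 => by linarith [h3.2]
    have e1 : p ∉ A₁ := fun h3 => by linarith [h3.2]
    rcases lt_or_ge (ζ p) (R + 1) with h3' | h3'
    · have e2 : p ∈ A₂ := ⟨by rw [hjR]; exact h2', by rw [hjR]; exact h3'⟩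
      rw [Set.indicator_of_notMem e0, Set.indicator_of_notMem e1, Set.indicator_of_mem e2]
      linarith [hbound h0]
    · have e2 : p ∉ A₂ := fun h3 => by have := h3.2; rw [hjR] at this; linarith
      rw [Set.indicator_of_notMem e0, Set.indicator_of_notMem e1, Set.indicator_of_notMem e2,
        deriv_plateau_eq_zero (Or.inr fun h3 => by linarith [h3.2])]
      linarith
  refine (integral_mono hF ((hi₀.add hi₁).add hi₂) hle).trans_lt ?_
  rw [integral_add' (hi₀.add hi₁) hi₂, integral_add' hi₀ hi₁,
    integral_indicator_const _ (hmeas _ _), integral_indicator_const _ (hmeas _ _),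
    integral_indicator_const _ (hmeas _ _), hmj, hmB]
  simp only [smul_eq_mul]
  have : μ.real A₀ = m := rfl
  rw [this]
  nlinarith

end FlatStability

/-! ### The main statement for a cylinder with Fermi coordinates -/

section Core

variable {N : Type*} [TopologicalSpace N] [ChartedSpace (Eu 3) N] [IsManifold (𝓡 3) ∞ N]

/-- Fermi coordinates exist around every point of `C`. -/
def HasFermiCoordinates (κ k : ℝ) (g : MetricTensor 3 N) (C : Set N) : Prop :=
  ∀ q ∈ C, ∃ τ' k' : ℝ, ∃ c d a : ℝ → ℝ, ∃ Θ : Eu 3 → N, ∃ w₀ : Eu 3, k' ^ 2 = k ^ 2 ∧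
    FermiProfile κ τ' k' c d a ∧ IsCylinderParam g C c a Θ w₀ ∧ Θ w₀ = q

/-- `T` is an isometry which preserves `C` and increases the height `ζ` by one; the slabs of `C`
are compact. -/
structure IsVerticalTranslation (g : MetricTensor 3 N) (C : Set N) (ζ : N → ℝ) (T T' : N → N) :
    Prop where
  smooth_height : ContMDiff (𝓡 3) 𝓘(ℝ, ℝ) ∞ ζ
  smooth : ContMDiff (𝓡 3) (𝓡 3) ∞ T
  smooth' : ContMDiff (𝓡 3) (𝓡 3) ∞ T'
  right_inv : ∀ q, T (T' q) = q
  left_inv : ∀ q, T' (T q) = q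
  isometry : ∀ q, ∀ v w : Eu 3, g q v w = (g.pullback T' : MetricTensor 3 N) q v w
  map_mem : ∀ q ∈ C, T q ∈ C
  map_mem' : ∀ q ∈ C, T' q ∈ C
  height_map : ∀ q, ζ (T q) = ζ q + 1
  isCompact : ∀ R, IsCompact (C ∩ ζ ⁻¹' Set.Icc 0 R)
  nonempty : ∃ q ∈ C, ζ q ∈ Set.Ioo 0 1

variable {S : Type*} [TopologicalSpace S] [ChartedSpace (Eu 2) S] [IsManifold (𝓡 2) ∞ S]
  {g : MetricTensor 3 N} {C : Set N} {κ k : ℝ} {x : S → N}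

/-- Maps of `N` preserving an embedded surface restrict to it. -/
lemma exists_restriction (hx : IsSmoothEmbedding (𝓡 2) (𝓡 3) ∞ x) (hC : Set.range x = C)
    {T : N → N} (hT : ContMDiff (𝓡 3) (𝓡 3) ∞ T) (hTC : ∀ q ∈ C, T q ∈ C) :
    ∃ t : S → S, ContMDiff (𝓡 2) (𝓡 2) ∞ t ∧ ∀ p, x (t p) = T (x p) := by
  have h1 : ∀ p, ∃ p', x p' = T (x p) := fun p => by
    have := hTC (x p) (hC ▸ Set.mem_range_self p)
    rwa [← hC] at this
  choose t ht using h1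
  refine ⟨t, fun p => ?_, ht⟩
  have h3 : ContMDiffAt (𝓡 2) (𝓡 3) ∞ (x ∘ t) p := by
    have : x ∘ t = T ∘ x := funext ht
    rw [this]
    exact (hT.comp hx.contMDiff) p
  refine (ContMDiffAt.iff_comp_isImmersionAt (hx.isImmersion.isImmersionAt (t p))).mpr ⟨?_, h3⟩
  exact hx.isEmbedding.isInducing.continuousAt_iff.mpr h3.continuousAt

/-- Fermi coordinates make the potential constant and the induced metric flat, after which only
global information on `C` matters. The curvature in the Fermi profile may differ in sign from `k`,
which is harmless because only its square enters. -/
theorem cylinder_stability [T2Space N] [SecondCountableTopology N] [MeasurableSpace S]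
    [BorelSpace S] (hfermi : HasFermiCoordinates κ k g C)
    (hunstable : 0 < k ^ 2 + κ → (IsCompact C ∧ C.Nonempty) ∨
      ∃ ζ T T', IsVerticalTranslation g C ζ T T')
    (hx : IsSmoothEmbedding (𝓡 2) (𝓡 3) ∞ x) (hC : Set.range x = C)
    (η : (p : S) → TangentSpace (𝓡 3) (x p)) (hη : IsUnitNormal g x η) :
    (IsStableSurface g x η ↔ κ ≤ -k ^ 2) ∧
    (∀ f : S → ℝ, ContMDiff (𝓡 2) 𝓘(ℝ, ℝ) ∞ f → ∀ p : S,
      stabilityOperator g x η f p =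
        laplacian (g.pullback x : MetricTensor 2 S) f p + (k ^ 2 + κ) * f p) ∧
    IsFlatMetric (g.pullback x : MetricTensor 2 S) := by
  have hxc : Continuous x := hx.isEmbedding.continuous
  have : SecondCountableTopology S := hx.isEmbedding.isInducing.secondCountableTopology
  have hmem : ∀ p, x p ∈ C := fun p => hC ▸ Set.mem_range_self p
  have hpot : ∀ p, stabilityPotential g x η p = k ^ 2 + κ := by
    intro p
    obtain ⟨τ', k', c, d, a, Θ, w₀, hk, hprof, hΘ, hp⟩ := hfermi (x p) (hmem p)
    rw [stabilityPotential_eq hprof hΘ hx hC hp hη, hk]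
  have hflat : ∀ p, ∃ Y Ψ, IsLocalChart (g.pullback x : MetricTensor 2 S) (flatForm 2) Y Ψ p := by
    intro p
    obtain ⟨τ', k', c, d, a, Θ, w₀, hk, hprof, hΘ, hp⟩ := hfermi (x p) (hmem p)
    obtain ⟨Y, Ψ, -, hY, -⟩ := exists_flatChart hprof hΘ hx hC hp
    exact ⟨Y, Ψ, hY⟩
  refine ⟨?_, fun f _ p => by rw [stabilityOperator, hpot], fun p => ?_⟩
  · have hint : ∀ f : S → ℝ, ∫ p, (gradSq (g.pullback x : MetricTensor 2 S) f p
        - stabilityPotential g x η p * f p ^ 2) ∂(riemannianMeasure (g.pullback x : MetricTensor 2 S))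
        = ∫ p, (gradSq (g.pullback x : MetricTensor 2 S) f p - (k ^ 2 + κ) * f p ^ 2)
          ∂(riemannianMeasure (g.pullback x : MetricTensor 2 S)) := fun f => by simp only [hpot]
    constructor
    · intro hst
      by_contra hκ
      have hq : 0 < k ^ 2 + κ := by linarith
      suffices ∃ f : S → ℝ, ContMDiff (𝓡 2) 𝓘(ℝ, ℝ) ∞ f ∧ HasCompactSupport f ∧
          ∫ p, (gradSq (g.pullback x : MetricTensor 2 S) f p - (k ^ 2 + κ) * f p ^ 2)
            ∂(riemannianMeasure (g.pullback x : MetricTensor 2 S)) < 0 by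
        obtain ⟨f, hf, hfc, hneg⟩ := this
        have := hst f hf hfc
        rw [hint] at this
        linarith
      rcases hunstable hq with ⟨hcpt, hne⟩ | ⟨ζ, T, T', hT⟩
      · have : CompactSpace S := by
          rw [← hC, ← Set.image_univ] at hcpt
          exact ⟨hx.isEmbedding.isInducing.isCompact_iff.mpr hcpt⟩
        have : Nonempty S := by
          rw [← hC] at hne
          exact Set.range_nonempty_iff_nonempty.mp hne
        exact exists_unstable_of_compactSpace hflat hq
      -- The ambient translation and its inverse restrict to isometries of the surface, and the
      -- ambient height restricts to a height on it.
      · obtain ⟨t, ht, hxt⟩ := exists_restriction hx hC hT.smooth hT.map_mem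
        obtain ⟨t', ht', hxt'⟩ := exists_restriction hx hC hT.smooth' hT.map_mem'
        have hinj := hx.isEmbedding.injective
        refine exists_unstable_of_height hflat hq ht ht'
          (fun p => hinj (by rw [hxt, hxt', hT.right_inv]))
          (fun p => hinj (by rw [hxt', hxt, hT.left_inv])) ?_
          (ζ := ζ ∘ x) (hT.smooth_height.comp hx.contMDiff)
          (fun p => by rw [Function.comp_apply, hxt, hT.height_map]; rfl) (fun R => ?_) ?_
        · intro p v w
          have hxd : ∀ p, MDifferentiableAt (𝓡 2) (𝓡 3) x p := fun p =>
            (hx.contMDiff p).mdifferentiableAt (by simp)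
          have h1 : x ∘ t' = T' ∘ x := funext hxt'
          rw [pullback_pullback g (hxd _) ((ht' p).mdifferentiableAt (by simp)), h1,
            ← pullback_pullback g ((hT.smooth' _).mdifferentiableAt (by simp)) (hxd p)]
          exact hT.isometry (x p) _ _
        · rw [hx.isEmbedding.isInducing.isCompact_iff, Set.preimage_comp,
            Set.image_preimage_eq_range_inter, hC]
          exact hT.isCompact R
        · obtain ⟨q, hq, hq'⟩ := hT.nonempty
          rw [← hC] at hq
          obtain ⟨p, rfl⟩ := hq
          exact ⟨p, hq'⟩
    · intro hκ f hf _
      rw [hint]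
      refine integral_nonneg fun p => ?_
      obtain ⟨Y, Ψ, hY⟩ := hflat p
      have h1 := gradSq_nonneg hY hf
      have h2 : (k ^ 2 + κ) * f p ^ 2 ≤ 0 :=
        mul_nonpos_of_nonpos_of_nonneg (by linarith) (sq_nonneg _)
      simp only [Pi.zero_apply]
      linarith
  · obtain ⟨Y, Ψ, hY⟩ := hflat p
    obtain ⟨U, -, hUo, hpU, hU⟩ := hY.exists_isOpen univ_mem
    refine ⟨U, hUo, hpU, Y, fun q hq => (hU q hq).smooth.self_of_nhds.contMDiffWithinAt,
      fun q hq => ?_⟩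
    funext v w
    exact (hU q hq).metric.self_of_nhds v w

end Core

/-! ### Frames and curves of constant curvature in the quadric -/

/-- The tangent vector `v` at `P`, rotated by a right angle. -/
def rot (κ : ℝ) (P v : Eu 3) : Eu 3 :=
  !₂[P 1 * v 2 - P 2 * v 1, P 2 * v 0 - P 0 * v 2, κ * (P 0 * v 1 - P 1 * v 0)]

@[simp] lemma rot_zero (κ : ℝ) (P v : Eu 3) : rot κ P v 0 = P 1 * v 2 - P 2 * v 1 := rfl
@[simp] lemma rot_one (κ : ℝ) (P v : Eu 3) : rot κ P v 1 = P 2 * v 0 - P 0 * v 2 := rfl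
@[simp] lemma rot_two (κ : ℝ) (P v : Eu 3) : rot κ P v 2 = κ * (P 0 * v 1 - P 1 * v 0) := rfl

/-- `v` is a unit tangent vector of the quadric at `P`. -/
structure IsUnitTangent (κ : ℝ) (P v : Eu 3) : Prop where
  quadric : κ * (P 0 ^ 2 + P 1 ^ 2) + P 2 ^ 2 = 1
  tangent : κ * (P 0 * v 0 + P 1 * v 1) + P 2 * v 2 = 0
  unit : v 0 * v 0 + v 1 * v 1 + κ⁻¹ * (v 2 * v 2) = 1

namespace IsUnitTangent

variable {κ : ℝ} {P v : Eu 3}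

/-- For `κ = 0` the unit condition says nothing about the last component because `κ⁻¹ = 0`; it is
tangency that forces it to vanish. -/
lemma two_eq_zero (h : IsUnitTangent 0 P v) : v 2 = 0 := by
  have h1 := h.quadric
  have h2 := h.tangent
  rw [zero_mul, zero_add] at h1 h2
  rcases mul_eq_zero.mp h2 with h3 | h3
  · rw [h3] at h1; norm_num at h1
  · exact h3

/-- The unit condition cleared of `κ⁻¹`, a polynomial identity that allows later computations to
treat all signs of `κ` together. -/
lemma norm_sq (h : IsUnitTangent κ P v) : κ * (v 0 ^ 2 + v 1 ^ 2) + v 2 ^ 2 = κ := by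
  by_cases hκ : κ = 0
  · subst hκ
    rw [h.two_eq_zero]; ring
  · have := h.unit
    field_simp at this
    linarith

/-- With `n = rot κ P v` the left side is `v 0 * n 1 - v 1 * n 0`: the factor by which the
projection to the first two coordinates changes area. -/
lemma det_eq (h : IsUnitTangent κ P v) :
    P 2 * (v 0 ^ 2 + v 1 ^ 2) - v 2 * (P 0 * v 0 + P 1 * v 1) = P 2 := by
  by_cases hκ : κ = 0
  · subst hκ
    have h1 := h.unit
    rw [h.two_eq_zero] at h1 ⊢
    linear_combination P 2 * h1
  · refine mul_left_cancel₀ hκ ?_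
    linear_combination P 2 * h.norm_sq - v 2 * h.tangent

lemma rot_rot (h : IsUnitTangent κ P v) : rot κ P (rot κ P v) = -v := by
  ext i
  fin_cases i
  · simp
    linear_combination -v 0 * h.quadric + P 0 * h.tangent
  · simp
    linear_combination -v 1 * h.quadric + P 1 * h.tangent
  · simp
    linear_combination -v 2 * h.quadric + P 2 * h.tangent

lemma rot_rot_left (h : IsUnitTangent κ P v) : rot κ (rot κ P v) v = -κ • P := by
  ext i
  fin_cases i
  · simp
    linear_combination v 0 * h.tangent - P 0 * h.norm_sq
  · simp
    linear_combination v 1 * h.tangent - P 1 * h.norm_sq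
  · simp
    linear_combination v 2 * h.tangent - P 2 * h.norm_sq

lemma tangent_rot (P v : Eu 3) : κ * (P 0 * rot κ P v 0 + P 1 * rot κ P v 1)
    + P 2 * rot κ P v 2 = 0 := by
  simp only [rot_zero, rot_one, rot_two]; ring

lemma inner_rot (h : IsUnitTangent κ P v) : spaceFormInner κ v (rot κ P v) = 0 := by
  rw [spaceFormInner]
  by_cases hκ : κ = 0
  · subst hκ
    simp [h.two_eq_zero]; ring
  · simp only [rot_zero, rot_one, rot_two]
    field_simp
    ring

lemma rot_unit (h : IsUnitTangent κ P v) : IsUnitTangent κ P (rot κ P v) := by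
  refine ⟨h.quadric, tangent_rot P v, ?_⟩
  by_cases hκ : κ = 0
  · subst hκ
    have h1 := h.unit
    have h2 := h.quadric
    simp only [rot_zero, rot_one, rot_two, h.two_eq_zero] at *
    linear_combination (v 0 ^ 2 + v 1 ^ 2) * h2 + h1
  · have e : ∀ t : ℝ, κ⁻¹ * (κ * t * (κ * t)) = κ * t ^ 2 := fun t => by field_simp
    simp only [rot_zero, rot_one, rot_two, e]
    refine mul_left_cancel₀ hκ ?_
    linear_combination (κ * (P 0 ^ 2 + P 1 ^ 2) + P 2 ^ 2 ) * h.norm_sq + κ * h.quadric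
      - (κ * (P 0 * v 0 + P 1 * v 1) + P 2 * v 2) * h.tangent

/-- Conformality of stereographic projection. The bracketed expressions are, up to the factor `1 + P
2`, the differentials of `P 0 / (1 + P 2)` and `P 1 / (1 + P 2)`. -/
lemma spaceFormInner_eq (h : IsUnitTangent κ P v) {u w : Eu 3} (hP : 1 + P 2 ≠ 0)
    (hu : IsTangentTo κ P u) (hw : IsTangentTo κ P w) :
    (u 0 - P 0 * u 2 / (1 + P 2)) * (w 0 - P 0 * w 2 / (1 + P 2)) +
      (u 1 - P 1 * u 2 / (1 + P 2)) * (w 1 - P 1 * w 2 / (1 + P 2)) = spaceFormInner κ u w := by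
  rw [spaceFormInner]
  have hq := h.quadric
  rw [IsTangentTo] at hu hw
  by_cases hκ : κ = 0
  · subst hκ
    have h2 : P 2 = 1 := by
      have : (P 2 - 1) * (1 + P 2) = 0 := by linear_combination hq
      rcases mul_eq_zero.mp this with h3 | h3
      · linarith
      · exact absurd h3 hP
    have hu2 : u 2 = 0 := by rw [h2] at hu; linarith
    have hw2 : w 2 = 0 := by rw [h2] at hw; linarith
    simp [hu2, hw2]
  · field_simp
    linear_combination -(1 + P 2) * w 2 * hu - (1 + P 2) * u 2 * hw + u 2 * w 2 * hq

lemma eq_rot_or_eq_neg_rot (h : IsUnitTangent κ P v) {m : Eu 3} (hm : IsUnitTangent κ P m)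
    (hmv : spaceFormInner κ m v = 0) : m = rot κ P v ∨ m = -rot κ P v := by
  set n := rot κ P v with hn
  have hnn := h.rot_unit.unit
  rw [← hn] at hnn
  have hmm := hm.unit
  have hmt := hm.tangent
  rw [spaceFormInner] at hmv
  -- The cross product of `m` and `n` vanishes, which gives parallelism in the tangent plane without
  -- a dimension count.
  have hcross : n 1 * m 2 = n 2 * m 1 ∧ n 2 * m 0 = n 0 * m 2 ∧ n 0 * m 1 = n 1 * m 0 := by
    simp only [hn, rot_zero, rot_one, rot_two]
    by_cases hκ : κ = 0
    · subst hκ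
      rw [h.two_eq_zero, hm.two_eq_zero] at *
      refine ⟨by ring, by ring, ?_⟩
      linear_combination -P 2 * hmv
    · have hQ : κ * (m 0 * v 0 + m 1 * v 1) + m 2 * v 2 = 0 := by
        field_simp at hmv
        linarith
      refine ⟨?_, ?_, mul_left_cancel₀ hκ ?_⟩
      · linear_combination v 0 * hmt - P 0 * hQ
      · linear_combination v 1 * hmt - P 1 * hQ
      · linear_combination v 2 * hmt - P 2 * hQ
  obtain ⟨c1, c2, c3⟩ := hcross
  set σ := m 0 * n 0 + m 1 * n 1 + κ⁻¹ * (m 2 * n 2) with hσ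
  have hmσ : m = σ • n := by
    ext i
    fin_cases i
    · simp only [Fin.zero_eta, PiLp.smul_apply, smul_eq_mul, hσ]
      linear_combination -m 0 * hnn - n 1 * c3 + κ⁻¹ * n 2 * c2
    · simp only [Fin.mk_one, PiLp.smul_apply, smul_eq_mul, hσ]
      linear_combination -m 1 * hnn + n 0 * c3 - κ⁻¹ * n 2 * c1
    · simp only [Fin.reduceFinMk, PiLp.smul_apply, smul_eq_mul, hσ]
      linear_combination -m 2 * hnn - n 0 * c2 + n 1 * c1
  have hσ2 : σ ^ 2 = 1 := by
    rw [hmσ] at hmm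
    simp only [PiLp.smul_apply, smul_eq_mul] at hmm
    linear_combination hmm - σ ^ 2 * hnn
  rcases sq_eq_one_iff.mp hσ2 with h1 | h1
  · left; rw [hmσ, h1, one_smul]
  · right; rw [hmσ, h1, neg_one_smul]

/-- Moving along the normal geodesic. -/
lemma geodesic (h : IsUnitTangent κ P v) {C S : ℝ} (hCS : C ^ 2 + κ * S ^ 2 = 1) :
    IsUnitTangent κ (C • P + S • rot κ P v) v := by
  have h1 := h.rot_unit.norm_sq
  have h2 := tangent_rot (κ := κ) P v
  refine ⟨?_, ?_, h.unit⟩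
  · simp only [PiLp.add_apply, PiLp.smul_apply, smul_eq_mul]
    linear_combination C ^ 2 * h.quadric + 2 * C * S * h2 + S ^ 2 * h1 + hCS
  · simp only [PiLp.add_apply, PiLp.smul_apply, smul_eq_mul, rot_zero, rot_one, rot_two]
    linear_combination C * h.tangent

/-- When `C' = -κ S` and `S' = C`, the new coefficients are the derivatives of the old ones: the
rotated tangent is the velocity of the normal geodesic. -/
lemma rot_geodesic (h : IsUnitTangent κ P v) (C S : ℝ) :
    rot κ (C • P + S • rot κ P v) v = (-κ * S) • P + C • rot κ P v := by
  have h1 : rot κ (C • P + S • rot κ P v) v = C • rot κ P v + S • rot κ (rot κ P v) v := by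
    ext i
    fin_cases i <;> simp <;> ring
  rw [h1, h.rot_rot_left, smul_smul, add_comm]
  congr 2
  ring

end IsUnitTangent

/-- A curve of constant signed curvature `k` with its Frenet equations. -/
structure IsFrenetCurve (κ k : ℝ) (γ v : ℝ → Eu 3) : Prop where
  contDiff : ContDiff ℝ ∞ γ
  contDiff_deriv : ContDiff ℝ ∞ v
  hasDerivAt : ∀ s, HasDerivAt γ (v s) s
  hasDerivAt_deriv : ∀ s, HasDerivAt v (-κ • γ s + k • rot κ (γ s) (v s)) s
  frame : ∀ s, IsUnitTangent κ (γ s) (v s)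

lemma hasDerivAt_of_apply {n : ℕ} {f : ℝ → Eu n} {f' : Eu n} {s : ℝ}
    (h : ∀ i, HasDerivAt (fun s => f s i) (f' i) s) : HasDerivAt f f' s := by
  have h1 := hasDerivAt_pi.mpr h
  exact ((EuclideanSpace.equiv (Fin n) ℝ).symm : (Fin n → ℝ) →L[ℝ] Eu n).hasFDerivAt.comp_hasDerivAt
    s h1

lemma hasDerivAt_rot {κ : ℝ} {γ v : ℝ → Eu 3} {γ' v' : Eu 3} {s : ℝ} (h1 : HasDerivAt γ γ' s)
    (h2 : HasDerivAt v v' s) :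
    HasDerivAt (fun s => rot κ (γ s) (v s)) (rot κ γ' (v s) + rot κ (γ s) v') s := by
  have e1 : ∀ i, HasDerivAt (fun s => γ s i) (γ' i) s := fun i =>
    ((EuclideanSpace.proj i : Eu 3 →L[ℝ] ℝ).hasFDerivAt).comp_hasDerivAt s h1
  have e2 : ∀ i, HasDerivAt (fun s => v s i) (v' i) s := fun i =>
    ((EuclideanSpace.proj i : Eu 3 →L[ℝ] ℝ).hasFDerivAt).comp_hasDerivAt s h2
  refine hasDerivAt_of_apply fun i => ?_
  fin_cases i
  · refine HasDerivAt.congr_deriv (((e1 1).mul (e2 2)).sub ((e1 2).mul (e2 1))) ?_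
    simp; ring
  · refine HasDerivAt.congr_deriv (((e1 2).mul (e2 0)).sub ((e1 0).mul (e2 2))) ?_
    simp; ring
  · refine HasDerivAt.congr_deriv
      ((((e1 0).mul (e2 1)).sub ((e1 1).mul (e2 0))).const_mul κ) ?_
    simp; ring

lemma contDiff_rot {κ : ℝ} {γ v : ℝ → Eu 3} (h1 : ContDiff ℝ ∞ γ) (h2 : ContDiff ℝ ∞ v) :
    ContDiff ℝ ∞ fun s => rot κ (γ s) (v s) := by
  rw [contDiff_euclidean] at *
  intro i
  fin_cases i
  · exact ((h1 1).mul (h2 2)).sub ((h1 2).mul (h2 1))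
  · exact ((h1 2).mul (h2 0)).sub ((h1 0).mul (h2 2))
  · exact contDiff_const.mul (((h1 0).mul (h2 1)).sub ((h1 1).mul (h2 0)))

lemma rot_self (κ : ℝ) (v : Eu 3) : rot κ v v = 0 := by
  ext i
  fin_cases i <;> simp [mul_comm]

namespace IsFrenetCurve

variable {κ k : ℝ} {γ v : ℝ → Eu 3}

lemma hasDerivAt_normal (h : IsFrenetCurve κ k γ v) (s : ℝ) :
    HasDerivAt (fun s => rot κ (γ s) (v s)) (-k • v s) s := by
  refine HasDerivAt.congr_deriv (hasDerivAt_rot (h.hasDerivAt s) (h.hasDerivAt_deriv s)) ?_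
  have h1 : rot κ (γ s) (-κ • γ s + k • rot κ (γ s) (v s)) =
      -κ • rot κ (γ s) (γ s) + k • rot κ (γ s) (rot κ (γ s) (v s)) := by
    ext i
    fin_cases i <;> simp <;> ring
  rw [h1, rot_self, rot_self, (h.frame s).rot_rot]
  simp

lemma contDiff_normal (h : IsFrenetCurve κ k γ v) :
    ContDiff ℝ ∞ fun s => rot κ (γ s) (v s) := contDiff_rot h.contDiff h.contDiff_deriv

/-- If `κ + k² > 0` the curve is closed. -/
lemma isCompact_range (h : IsFrenetCurve κ k γ v) (hk : 0 < k ^ 2 + κ) :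
    IsCompact (Set.range γ) := by
  obtain ⟨b, hb, hb2⟩ : ∃ b : ℝ, 0 < b ∧ b ^ 2 = k ^ 2 + κ :=
    ⟨√(k ^ 2 + κ), Real.sqrt_pos.mpr hk, Real.sq_sqrt hk.le⟩
  -- This is `γ''`. Its derivative is `-b² v`, so the velocity solves a harmonic oscillator of
  -- frequency `b`.
  set u : ℝ → Eu 3 := fun s => -κ • γ s + k • rot κ (γ s) (v s) with hu
  have hu' : ∀ s, HasDerivAt u (-(b ^ 2) • v s) s := fun s => by
    refine HasDerivAt.congr_deriv
      (((h.hasDerivAt s).const_smul (-κ)).add ((h.hasDerivAt_normal s).const_smul k)) ?_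
    rw [hb2, smul_smul, ← add_smul]
    congr 1
    ring
  have hcos : ∀ s, HasDerivAt (fun s => Real.cos (b * s)) (-(b * Real.sin (b * s))) s := fun s => by
    refine HasDerivAt.congr_deriv ((Real.hasDerivAt_cos (b * s)).comp s
      ((hasDerivAt_id s).const_mul b)) ?_
    ring
  have hsin : ∀ s, HasDerivAt (fun s => Real.sin (b * s)) (b * Real.cos (b * s)) s := fun s => by
    refine HasDerivAt.congr_deriv ((Real.hasDerivAt_sin (b * s)).comp s
      ((hasDerivAt_id s).const_mul b)) ?_
    ring
  -- the constants of integration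
  obtain ⟨w, hw⟩ : ∃ w, ∀ s, u s + b ^ 2 • γ s = w := by
    have hd : ∀ s, HasDerivAt (fun s => u s + b ^ 2 • γ s) 0 s := fun s => by
      refine HasDerivAt.congr_deriv ((hu' s).add ((h.hasDerivAt s).const_smul (b ^ 2))) ?_
      module
    exact ⟨_, fun s => is_const_of_deriv_eq_zero (fun s => (hd s).differentiableAt)
      (fun s => (hd s).deriv) s 0⟩
  obtain ⟨A, hA⟩ : ∃ A, ∀ s, (b * Real.cos (b * s)) • v s - Real.sin (b * s) • u s = A := by
    have hd : ∀ s, HasDerivAt (fun s => (b * Real.cos (b * s)) • v s - Real.sin (b * s) • u s)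
        0 s := fun s => by
      refine HasDerivAt.congr_deriv ((((hcos s).const_mul b).smul (h.hasDerivAt_deriv s)).sub
        ((hsin s).smul (hu' s))) ?_
      change (b * Real.cos (b * s)) • u s + _ - _ = _
      module
    exact ⟨_, fun s => is_const_of_deriv_eq_zero (fun s => (hd s).differentiableAt)
      (fun s => (hd s).deriv) s 0⟩
  obtain ⟨B, hB⟩ : ∃ B, ∀ s, (b * Real.sin (b * s)) • v s + Real.cos (b * s) • u s = B := by
    have hd : ∀ s, HasDerivAt (fun s => (b * Real.sin (b * s)) • v s + Real.cos (b * s) • u s)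
        0 s := fun s => by
      refine HasDerivAt.congr_deriv ((((hsin s).const_mul b).smul (h.hasDerivAt_deriv s)).add
        ((hcos s).smul (hu' s))) ?_
      change (b * Real.sin (b * s)) • u s + _ + _ = _
      module
    exact ⟨_, fun s => is_const_of_deriv_eq_zero (fun s => (hd s).differentiableAt)
      (fun s => (hd s).deriv) s 0⟩
  -- Combining `A` and `B` recovers `u`, and then `w` recovers `γ`; the resulting formula has period
  -- `2π / b`.
  have hγ : ∀ s, γ s = (b ^ 2)⁻¹ • (w - (Real.cos (b * s) • B - Real.sin (b * s) • A)) := by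
    intro s
    have h1 : u s = Real.cos (b * s) • B - Real.sin (b * s) • A := by
      rw [← hA s, ← hB s]
      have := Real.sin_sq_add_cos_sq (b * s)
      calc u s = (Real.sin (b * s) ^ 2 + Real.cos (b * s) ^ 2) • u s := by rw [this, one_smul]
        _ = _ := by module
    rw [← h1, ← hw s, add_sub_cancel_left, smul_smul, inv_mul_cancel₀ (by positivity), one_smul]
  have hper : Function.Periodic γ (2 * Real.pi / b) := by
    intro s
    rw [hγ, hγ s, show b * (s + 2 * Real.pi / b) = b * s + 2 * Real.pi by field_simp,
      Real.cos_add_two_pi, Real.sin_add_two_pi]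
  exact hper.compact_of_continuous (by positivity) h.contDiff.continuous

end IsFrenetCurve

/-- Curves of constant geodesic curvature satisfy the Frenet equations. -/
theorem exists_isFrenetCurve {κ k : ℝ} {γ : ℝ → Eu 3} (hγ : IsCompleteCurve κ γ)
    (hk : HasGeodesicCurvature κ γ k) :
    ∃ k', k' ^ 2 = k ^ 2 ∧ IsFrenetCurve κ k' γ (deriv γ) := by
  obtain ⟨hs, hγ⟩ := hγ
  have hd1 : ContDiff ℝ ∞ (deriv γ) := (contDiff_infty_iff_deriv.mp hs).2
  have hγ' : ∀ s, HasDerivAt γ (deriv γ s) s := fun s =>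
    (hs.differentiable (by simp) s).hasDerivAt
  have hγ'' : ∀ s, HasDerivAt (deriv γ) (deriv (deriv γ) s) s := fun s =>
    (hd1.differentiable (by simp) s).hasDerivAt
  have hfr : ∀ s, IsUnitTangent κ (γ s) (deriv γ s) := by
    intro s
    refine ⟨(hγ s).1.1, ?_, (hγ s).2⟩
    have e1 : ∀ i, HasDerivAt (fun s => γ s i) (deriv γ s i) s := fun i =>
      ((EuclideanSpace.proj i : Eu 3 →L[ℝ] ℝ).hasFDerivAt).comp_hasDerivAt s (hγ' s)
    have h1 := ((((e1 0).pow 2).add ((e1 1).pow 2)).const_mul κ).add ((e1 2).pow 2)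
    have h2 : (fun s => κ * (γ s 0 ^ 2 + γ s 1 ^ 2) + γ s 2 ^ 2) = fun _ => 1 :=
      funext fun s => (hγ s).1.1
    have h3 := h1.unique ((hasDerivAt_const s (1 : ℝ)).congr_of_eventuallyEq
      (Eventually.of_forall fun s => congrFun h2 s))
    simp at h3
    linarith
  set n : ℝ → Eu 3 := fun s => rot κ (γ s) (deriv γ s) with hn
  -- The signed curvature. The hypothesis chooses the unit normal separately at each `s`, so at
  -- first only `K² = k²` is known.
  set K : ℝ → ℝ := fun s => spaceFormInner κ (covariantAcceleration κ γ s) (n s) with hK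
  have hacc : ∀ s, covariantAcceleration κ γ s = deriv (deriv γ) s + κ • γ s := fun s => by
    rw [covariantAcceleration, (hγ s).2, mul_one]
  have hKc : Continuous K := by
    have h1 : ContDiff ℝ ∞ (deriv (deriv γ)) := (contDiff_infty_iff_deriv.mp hd1).2
    have h2 : ContDiff ℝ ∞ n := contDiff_rot hs hd1
    have h3 : Continuous (covariantAcceleration κ γ) := by
      have : covariantAcceleration κ γ = fun s => deriv (deriv γ) s + κ • γ s := funext hacc
      rw [this]
      exact h1.continuous.add (hs.continuous.const_smul κ)
    have e1 : ∀ i, Continuous fun s => covariantAcceleration κ γ s i := fun i =>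
      (EuclideanSpace.proj i : Eu 3 →L[ℝ] ℝ).continuous.comp h3
    have e2 : ∀ i, Continuous fun s => n s i := fun i =>
      (EuclideanSpace.proj i : Eu 3 →L[ℝ] ℝ).continuous.comp h2.continuous
    exact (((e1 0).mul (e2 0)).add ((e1 1).mul (e2 1))).add
      (continuous_const.mul ((e1 2).mul (e2 2)))
  have hpt : ∀ s, covariantAcceleration κ γ s = K s • n s ∧ K s ^ 2 = k ^ 2 := by
    intro s
    obtain ⟨m, hm1, hm2, hm3, hm4⟩ := hk s
    have hm : IsUnitTangent κ (γ s) m := ⟨(hγ s).1.1, hm1, hm2⟩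
    have := hfr s
    set P := γ s
    set v := deriv γ s
    suffices hmn : m = n s ∨ m = -n s by
      have hnn : spaceFormInner κ (n s) (n s) = 1 := this.rot_unit.unit
      rcases hmn with h1 | h1
      · have : K s = k := by
          simp only [hK, hm4, h1]
          rw [spaceFormInner] at hnn ⊢
          simp only [PiLp.smul_apply, smul_eq_mul]
          linear_combination k * hnn
        rw [this, hm4, h1]; exact ⟨rfl, rfl⟩
      · have : K s = -k := by
          simp only [hK, hm4, h1]
          rw [spaceFormInner] at hnn ⊢
          simp only [PiLp.smul_apply, PiLp.neg_apply, smul_eq_mul]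
          linear_combination -k * hnn
        rw [this, hm4, h1]; exact ⟨by simp, by ring⟩
    exact this.eq_rot_or_eq_neg_rot hm hm3
  -- A continuous function on the line whose square is a nonzero constant cannot change sign.
  have hconst : ∃ k', k' ^ 2 = k ^ 2 ∧ ∀ s, K s = k' := by
    by_cases hk0 : k = 0
    · refine ⟨0, by rw [hk0], fun s => ?_⟩
      have := (hpt s).2
      rw [hk0] at this
      simpa using this
    · rcases isPreconnected_univ.eq_or_eq_neg_of_sq_eq (f := K) (g := fun _ => k) hKc.continuousOn
        continuousOn_const (fun s _ => (hpt s).2) (fun _ => hk0) with h1 | h1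
      · exact ⟨k, rfl, fun s => h1 (Set.mem_univ s)⟩
      · exact ⟨-k, by ring, fun s => h1 (Set.mem_univ s)⟩
  obtain ⟨k', hk', hKk⟩ := hconst
  refine ⟨k', hk', hs, hd1, hγ', fun s => (hγ'' s).congr_deriv ?_, hfr⟩
  have h1 := (hpt s).1
  rw [hacc, hKk] at h1
  rw [neg_smul, ← h1]
  abel

/-! ### Fermi coordinates in the Cartan model -/

/-- The solutions `C`, `S` of `f'' = -κ f` with the standard initial values, and the
antiderivative `E` of `S`. -/
structure IsTrigTriple (κ : ℝ) (C S E : ℝ → ℝ) : Prop where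
  contDiff_C : ContDiff ℝ ∞ C
  contDiff_S : ContDiff ℝ ∞ S
  contDiff_E : ContDiff ℝ ∞ E
  hasDerivAt_C : ∀ r, HasDerivAt C (-κ * S r) r
  hasDerivAt_S : ∀ r, HasDerivAt S (C r) r
  hasDerivAt_E : ∀ r, HasDerivAt E (S r) r
  C_zero : C 0 = 1
  S_zero : S 0 = 0
  E_zero : E 0 = 0
  sq_add_sq : ∀ r, C r ^ 2 + κ * S r ^ 2 = 1

lemma exists_isTrigTriple (κ : ℝ) : ∃ C S E, IsTrigTriple κ C S E := by
  rcases lt_trichotomy κ 0 with hκ | hκ | hκ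
  · obtain ⟨b, hb, hb2⟩ : ∃ b : ℝ, 0 < b ∧ b ^ 2 = -κ :=
      ⟨√(-κ), Real.sqrt_pos.mpr (by linarith), Real.sq_sqrt (by linarith)⟩
    obtain rfl : κ = -b ^ 2 := by linarith
    have hi : ∀ r, HasDerivAt (fun r => b * r) b r := fun r => by
      simpa using (hasDerivAt_id r).const_mul b
    have hc : ∀ r, HasDerivAt (fun r => Real.cosh (b * r)) (Real.sinh (b * r) * b) r := fun r =>
      (Real.hasDerivAt_cosh (b * r)).comp r (hi r)
    have hs : ∀ r, HasDerivAt (fun r => Real.sinh (b * r)) (Real.cosh (b * r) * b) r := fun r =>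
      (Real.hasDerivAt_sinh (b * r)).comp r (hi r)
    have hcc : ContDiff ℝ ∞ fun r => Real.cosh (b * r) := Real.contDiff_cosh.comp (by fun_prop)
    have hss : ContDiff ℝ ∞ fun r => Real.sinh (b * r) := Real.contDiff_sinh.comp (by fun_prop)
    refine ⟨fun r => Real.cosh (b * r), fun r => Real.sinh (b * r) / b,
      fun r => (Real.cosh (b * r) - 1) / b ^ 2, hcc, hss.div_const _,
      (hcc.sub contDiff_const).div_const _, fun r => ?_, fun r => ?_, fun r => ?_, by simp,
      by simp, by simp, fun r => ?_⟩
    · refine (hc r).congr_deriv ?_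
      field_simp
    · refine ((hs r).div_const b).congr_deriv ?_
      field_simp
    · refine (((hc r).sub_const 1).div_const (b ^ 2)).congr_deriv ?_
      field_simp
    · have := Real.cosh_sq (b * r)
      field_simp
      linarith
  · subst hκ
    refine ⟨fun _ => 1, fun r => r, fun r => r ^ 2 / 2, contDiff_const, contDiff_id,
      (contDiff_id.pow 2).div_const _, fun r => ?_, fun r => hasDerivAt_id r, fun r => ?_, rfl,
      rfl, by simp, fun r => by simp⟩
    · simpa using hasDerivAt_const r (1 : ℝ)
    · refine ((hasDerivAt_pow 2 r).div_const 2).congr_deriv ?_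
      simp
  · obtain ⟨b, hb, hb2⟩ : ∃ b : ℝ, 0 < b ∧ b ^ 2 = κ :=
      ⟨√κ, Real.sqrt_pos.mpr hκ, Real.sq_sqrt hκ.le⟩
    subst hb2
    have hi : ∀ r, HasDerivAt (fun r => b * r) b r := fun r => by
      simpa using (hasDerivAt_id r).const_mul b
    have hc : ∀ r, HasDerivAt (fun r => Real.cos (b * r)) (-Real.sin (b * r) * b) r := fun r =>
      (Real.hasDerivAt_cos (b * r)).comp r (hi r)
    have hs : ∀ r, HasDerivAt (fun r => Real.sin (b * r)) (Real.cos (b * r) * b) r := fun r =>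
      (Real.hasDerivAt_sin (b * r)).comp r (hi r)
    have hcc : ContDiff ℝ ∞ fun r => Real.cos (b * r) := Real.contDiff_cos.comp (by fun_prop)
    have hss : ContDiff ℝ ∞ fun r => Real.sin (b * r) := Real.contDiff_sin.comp (by fun_prop)
    refine ⟨fun r => Real.cos (b * r), fun r => Real.sin (b * r) / b,
      fun r => (1 - Real.cos (b * r)) / b ^ 2, hcc, hss.div_const _,
      (contDiff_const.sub hcc).div_const _, fun r => ?_, fun r => ?_, fun r => ?_, by simp,
      by simp, by simp, fun r => ?_⟩
    · refine (hc r).congr_deriv ?_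
      field_simp
    · refine ((hs r).div_const b).congr_deriv ?_
      field_simp
    · refine (((hc r).const_sub 1).div_const (b ^ 2)).congr_deriv ?_
      field_simp
    · have := Real.cos_sq_add_sin_sq (b * r)
      field_simp
      linarith

/-- Parallel curves at distance `r` have length element `C - k S`, and `a` is `2 τ` times its
primitive. -/
lemma IsTrigTriple.fermiProfile {κ : ℝ} {C S E : ℝ → ℝ} (h : IsTrigTriple κ C S E) (τ k : ℝ) :
    FermiProfile κ τ k (fun r => C r - k * S r) (fun r => -κ * S r - k * C r)
      (fun r => 2 * τ * (S r - k * E r)) where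
  contDiff_c := h.contDiff_C.sub (contDiff_const.mul h.contDiff_S)
  hasDerivAt_c r := (h.hasDerivAt_C r).sub ((h.hasDerivAt_S r).const_mul k)
  hasDerivAt_d r := by
    refine (((h.hasDerivAt_S r).const_mul (-κ)).sub
      ((h.hasDerivAt_C r).const_mul k)).congr_deriv ?_
    ring
  hasDerivAt_a r := ((h.hasDerivAt_S r).sub ((h.hasDerivAt_E r).const_mul k)).const_mul (2 * τ)
  c_zero := by simp [h.C_zero, h.S_zero]
  d_zero := by simp [h.C_zero, h.S_zero]
  a_zero := by simp [h.S_zero, h.E_zero]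

/-- The projection of the Cartan model. -/
def cartanBase (κ : ℝ) (P : Eu 3) : Eu 3 :=
  !₂[conformalFactor κ P * P 0, conformalFactor κ P * P 1,
    conformalFactor κ P * (1 - κ / 4 * (P 0 ^ 2 + P 1 ^ 2))]

/-- The section `(F, z) ↦ (2 F₀ / (1 + F₂), 2 F₁ / (1 + F₂), z)` of the projection: the inverse
stereographic coordinates. -/
def cartanLift (F : Eu 3) (z : ℝ) : Eu 3 := !₂[2 * F 0 / (1 + F 2), 2 * F 1 / (1 + F 2), z]

/-- The quadric equation turns `1/λ` into `2 / (1 + F 2)`, so the lift lies in the Cartan domain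
wherever `1 + F 2 > 0`. -/
lemma one_add_cartanLift {κ : ℝ} {F : Eu 3} (z : ℝ)
    (hF : κ * (F 0 ^ 2 + F 1 ^ 2) + F 2 ^ 2 = 1) (hF2 : 1 + F 2 ≠ 0) :
    1 + κ / 4 * (cartanLift F z 0 ^ 2 + cartanLift F z 1 ^ 2) = 2 / (1 + F 2) := by
  simp only [cartanLift, PiLp.toLp_apply, Matrix.cons_val_zero, Matrix.cons_val_one]
  field_simp
  linear_combination 4 * hF

lemma conformalFactor_cartanLift {κ : ℝ} {F : Eu 3} (z : ℝ)
    (hF : κ * (F 0 ^ 2 + F 1 ^ 2) + F 2 ^ 2 = 1) (hF2 : 1 + F 2 ≠ 0) :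
    conformalFactor κ (cartanLift F z) = (1 + F 2) / 2 := by
  rw [conformalFactor, one_add_cartanLift z hF hF2, inv_div]

lemma cartanBase_cartanLift {κ : ℝ} {F : Eu 3} (z : ℝ)
    (hF : κ * (F 0 ^ 2 + F 1 ^ 2) + F 2 ^ 2 = 1) (hF2 : 1 + F 2 ≠ 0) :
    cartanBase κ (cartanLift F z) = F := by
  have h := one_add_cartanLift z hF hF2
  have h3 : 1 - κ / 4 * (cartanLift F z 0 ^ 2 + cartanLift F z 1 ^ 2) = 2 - 2 / (1 + F 2) := by
    linarith
  rw [cartanBase, h3, conformalFactor_cartanLift z hF hF2]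
  ext i
  fin_cases i <;> simp [cartanLift] <;> field_simp
  ring

lemma fderiv_coord {m n : ℕ} {f : Eu m → Eu n} {w : Eu m} (hf : DifferentiableAt ℝ f w) (u : Eu m)
    (i : Fin n) : fderiv ℝ f w u i = fderiv ℝ (fun w => f w i) w u := by
  have := ((EuclideanSpace.proj i : Eu n →L[ℝ] ℝ).hasFDerivAt.comp w hf.hasFDerivAt).fderiv
  change _ = fderiv ℝ ((EuclideanSpace.proj i : Eu n →L[ℝ] ℝ) ∘ f) w u
  rw [this]
  rfl

section FermiCartan

variable {κ τ k : ℝ} {γ v : ℝ → Eu 3} {C S E : ℝ → ℝ}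

variable (κ γ v C S) in
/-- The Fermi coordinates of the quadric along `γ`. -/
def fermiPoint (w : Eu 3) : Eu 3 := C (w 1) • γ (w 0) + S (w 1) • rot κ (γ (w 0)) (v (w 0))

variable (κ γ v C S) in
/-- The unit normal field in Fermi coordinates. -/
def fermiNormal (w : Eu 3) : Eu 3 := rot κ (fermiPoint κ γ v C S w) (v (w 0))

lemma isUnitTangent_fermiPoint (hγ : IsFrenetCurve κ k γ v) (hT : IsTrigTriple κ C S E) (w : Eu 3) :
    IsUnitTangent κ (fermiPoint κ γ v C S w) (v (w 0)) :=
  (hγ.frame (w 0)).geodesic (hT.sq_add_sq (w 1))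

lemma fermiNormal_eq (hγ : IsFrenetCurve κ k γ v) (w : Eu 3) : fermiNormal κ γ v C S w =
    (-κ * S (w 1)) • γ (w 0) + C (w 1) • rot κ (γ (w 0)) (v (w 0)) :=
  (hγ.frame (w 0)).rot_geodesic _ _

lemma hasFDerivAt_coord (i : Fin 3) (w : Eu 3) :
    HasFDerivAt (fun w : Eu 3 => w i) (EuclideanSpace.proj i : Eu 3 →L[ℝ] ℝ) w :=
  (EuclideanSpace.proj i : Eu 3 →L[ℝ] ℝ).hasFDerivAt

lemma hasFDerivAt_comp_coord {f : ℝ → Eu 3} {f' : Eu 3} {i : Fin 3} {w : Eu 3}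
    (hf : HasDerivAt f f' (w i)) (j : Fin 3) : HasFDerivAt (fun w : Eu 3 => f (w i) j)
      (f' j • (EuclideanSpace.proj i : Eu 3 →L[ℝ] ℝ)) w := by
  have h : HasDerivAt (fun s => f s j) (f' j) (w i) :=
    ((EuclideanSpace.proj j : Eu 3 →L[ℝ] ℝ).hasFDerivAt).comp_hasDerivAt (w i) hf
  exact h.comp_hasFDerivAt w (hasFDerivAt_coord i w)

/-- From `γ' = v` and `n' = -k v`, moving along `s` gives `(C - k S) v`; moving along `r` gives the
normal. -/
lemma hasFDerivAt_fermiPoint (hγ : IsFrenetCurve κ k γ v) (hT : IsTrigTriple κ C S E) (w : Eu 3)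
    (j : Fin 3) : HasFDerivAt (fun w => fermiPoint κ γ v C S w j)
      (((C (w 1) - k * S (w 1)) * v (w 0) j) • (EuclideanSpace.proj 0 : Eu 3 →L[ℝ] ℝ)
        + fermiNormal κ γ v C S w j • (EuclideanSpace.proj 1 : Eu 3 →L[ℝ] ℝ)) w := by
  have h1 := ((hT.hasDerivAt_C (w 1)).comp_hasFDerivAt w (hasFDerivAt_coord 1 w)).mul
    (hasFDerivAt_comp_coord (hγ.hasDerivAt (w 0)) j)
  have h2 := ((hT.hasDerivAt_S (w 1)).comp_hasFDerivAt w (hasFDerivAt_coord 1 w)).mul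
    (hasFDerivAt_comp_coord (hγ.hasDerivAt_normal (w 0)) j)
  refine (h1.add h2).congr_fderiv (ContinuousLinearMap.ext fun u => ?_)
  rw [fermiNormal_eq hγ]
  simp
  ring

lemma hasFDerivAt_fermiNormal (hγ : IsFrenetCurve κ k γ v) (hT : IsTrigTriple κ C S E) (w : Eu 3)
    (j : Fin 3) : HasFDerivAt (fun w => fermiNormal κ γ v C S w j)
      (((-κ * S (w 1) - k * C (w 1)) * v (w 0) j) • (EuclideanSpace.proj 0 : Eu 3 →L[ℝ] ℝ)
        + (-κ * fermiPoint κ γ v C S w j) • (EuclideanSpace.proj 1 : Eu 3 →L[ℝ] ℝ)) w := by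
  have h1 := (((hT.hasDerivAt_S (w 1)).const_mul (-κ)).comp_hasFDerivAt w
    (hasFDerivAt_coord 1 w)).mul (hasFDerivAt_comp_coord (hγ.hasDerivAt (w 0)) j)
  have h2 := ((hT.hasDerivAt_C (w 1)).comp_hasFDerivAt w (hasFDerivAt_coord 1 w)).mul
    (hasFDerivAt_comp_coord (hγ.hasDerivAt_normal (w 0)) j)
  have h3 : (fun w => fermiNormal κ γ v C S w j) = fun w =>
      -κ * S (w 1) * γ (w 0) j + C (w 1) * rot κ (γ (w 0)) (v (w 0)) j := by
    funext w
    rw [fermiNormal_eq hγ]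
    simp
  rw [h3]
  refine (h1.add h2).congr_fderiv (ContinuousLinearMap.ext fun u => ?_)
  simp [fermiPoint]
  ring

/-- The Frenet equation for `v'` rewritten in the frame at the Fermi point. The relation `C² + κ S²
= 1` inverts the passage from the frame along `γ`. -/
lemma hasFDerivAt_fermiTangent (hγ : IsFrenetCurve κ k γ v) (hT : IsTrigTriple κ C S E) (w : Eu 3)
    (j : Fin 3) : HasFDerivAt (fun w : Eu 3 => v (w 0) j)
      ((-κ * (C (w 1) - k * S (w 1)) * fermiPoint κ γ v C S w j
        - (-κ * S (w 1) - k * C (w 1)) * fermiNormal κ γ v C S w j) •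
          (EuclideanSpace.proj 0 : Eu 3 →L[ℝ] ℝ)) w := by
  refine (hasFDerivAt_comp_coord (hγ.hasDerivAt_deriv (w 0)) j).congr_fderiv ?_
  congr 1
  rw [fermiNormal_eq hγ, fermiPoint]
  simp only [PiLp.add_apply, PiLp.smul_apply, smul_eq_mul]
  linear_combination (k * rot κ (γ (w 0)) (v (w 0)) j - κ * γ (w 0) j) * -(hT.sq_add_sq (w 1))

lemma contDiff_fermiPoint (hγ : IsFrenetCurve κ k γ v) (hT : IsTrigTriple κ C S E) :
    ContDiff ℝ ∞ (fermiPoint κ γ v C S) := by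
  have h0 : ∀ i : Fin 3, ContDiff ℝ ∞ fun w : Eu 3 => w i := fun i =>
    (EuclideanSpace.proj i : Eu 3 →L[ℝ] ℝ).contDiff
  exact ((hT.contDiff_C.comp (h0 1)).smul (hγ.contDiff.comp (h0 0))).add
    ((hT.contDiff_S.comp (h0 1)).smul (hγ.contDiff_normal.comp (h0 0)))

/-! ### The vertical coordinate of the Fermi chart. -/

section Connection

variable (κ τ k γ v C S E) in
/-- The coefficient of `ds` in the vertical coordinate. -/
def verticalCoeff₀ (w : Eu 3) : ℝ :=
  2 * τ * (S (w 1) - k * E (w 1)) - 2 * τ * ((C (w 1) - k * S (w 1)) *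
    ((fermiPoint κ γ v C S w 1 * v (w 0) 0 - fermiPoint κ γ v C S w 0 * v (w 0) 1) *
      (1 + fermiPoint κ γ v C S w 2)⁻¹))

variable (κ τ γ v C S) in
/-- The coefficient of `dr` in the vertical coordinate. -/
def verticalCoeff₁ (w : Eu 3) : ℝ :=
  -2 * τ * ((fermiPoint κ γ v C S w 1 * fermiNormal κ γ v C S w 0
    - fermiPoint κ γ v C S w 0 * fermiNormal κ γ v C S w 1) * (1 + fermiPoint κ γ v C S w 2)⁻¹)

variable (κ τ k γ v C S E) in
/-- The differential of the vertical coordinate. -/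
def verticalForm (w : Eu 3) : Eu 3 →L[ℝ] ℝ :=
  verticalCoeff₀ κ τ k γ v C S E w • (EuclideanSpace.proj 0 : Eu 3 →L[ℝ] ℝ)
    + verticalCoeff₁ κ τ γ v C S w • (EuclideanSpace.proj 1 : Eu 3 →L[ℝ] ℝ)
    + (EuclideanSpace.proj 2 : Eu 3 →L[ℝ] ℝ)

/-- The shared number `p₁` expresses that `verticalForm` is closed. The term `a' = 2 τ c` balances
the exterior derivative of `τ λ (y dx - x dy)`, which is a multiple of the area form. -/
lemma exists_hasFDerivAt_verticalCoeff (hγ : IsFrenetCurve κ k γ v) (hT : IsTrigTriple κ C S E)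
    {w : Eu 3} (hw : 1 + fermiPoint κ γ v C S w 2 ≠ 0) :
    ∃ p₀ p₁ q₁ : ℝ,
      HasFDerivAt (verticalCoeff₀ κ τ k γ v C S E)
        (p₀ • (EuclideanSpace.proj 0 : Eu 3 →L[ℝ] ℝ)
          + p₁ • (EuclideanSpace.proj 1 : Eu 3 →L[ℝ] ℝ)) w ∧
      HasFDerivAt (verticalCoeff₁ κ τ γ v C S) (p₁ • (EuclideanSpace.proj 0 : Eu 3 →L[ℝ] ℝ)
          + q₁ • (EuclideanSpace.proj 1 : Eu 3 →L[ℝ] ℝ)) w := by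
  have hF := hasFDerivAt_fermiPoint hγ hT w
  have hN := hasFDerivAt_fermiNormal hγ hT w
  have hV := hasFDerivAt_fermiTangent hγ hT w
  have hg := (hasDerivAt_inv hw).comp_hasFDerivAt w ((hF 2).const_add 1)
  have hc := (((hT.hasDerivAt_C (w 1)).sub ((hT.hasDerivAt_S (w 1)).const_mul k)).comp_hasFDerivAt
    w (hasFDerivAt_coord 1 w))
  have ha := ((((hT.hasDerivAt_S (w 1)).sub ((hT.hasDerivAt_E (w 1)).const_mul k)).const_mul
    (2 * τ)).comp_hasFDerivAt w (hasFDerivAt_coord 1 w))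
  have hp := ha.sub ((hc.mul ((((hF 1).mul (hV 0)).sub ((hF 0).mul (hV 1))).mul hg)).const_mul
    (2 * τ))
  have hq := ((((hF 1).mul (hN 0)).sub ((hF 0).mul (hN 1))).mul hg).const_mul (-2 * τ)
  have hfr := isUnitTangent_fermiPoint hγ hT w
  -- The two frame determinants behind the equality of mixed partials: `hd` is the projected area
  -- element, and `he` collects the terms in which `(1 + F 2)⁻¹` is differentiated.
  have hd : v (w 0) 0 * fermiNormal κ γ v C S w 1 - v (w 0) 1 * fermiNormal κ γ v C S w 0 =
      fermiPoint κ γ v C S w 2 := by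
    simp only [fermiNormal, rot_zero, rot_one]
    linear_combination hfr.det_eq
  have he : (fermiPoint κ γ v C S w 1 * v (w 0) 0 - fermiPoint κ γ v C S w 0 * v (w 0) 1) *
      fermiNormal κ γ v C S w 2 - (fermiPoint κ γ v C S w 1 * fermiNormal κ γ v C S w 0
        - fermiPoint κ γ v C S w 0 * fermiNormal κ γ v C S w 1) * v (w 0) 2 =
      -(1 - fermiPoint κ γ v C S w 2 ^ 2) := by
    simp only [fermiNormal, rot_zero, rot_one, rot_two]
    generalize fermiPoint κ γ v C S w = F at hfr ⊢
    generalize v (w 0) = V at hfr ⊢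
    linear_combination -(F 0 ^ 2 + F 1 ^ 2) * hfr.norm_sq
      + (F 0 * V 0 + F 1 * V 1) * hfr.tangent - hfr.quadric
  set F := fermiPoint κ γ v C S w with hFdef
  set N := fermiNormal κ γ v C S w with hNdef
  set V := v (w 0) with hVdef
  set c := C (w 1) - k * S (w 1) with hcdef
  set d := -κ * S (w 1) - k * C (w 1) with hddef
  refine ⟨-2 * τ * c * (-d * (F 1 * N 0 - F 0 * N 1) * (1 + F 2)⁻¹
      - (F 1 * V 0 - F 0 * V 1) * (c * V 2) * ((1 + F 2)⁻¹) ^ 2),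
    -2 * τ * ((c * (V 1 * N 0 - V 0 * N 1) + d * (F 1 * V 0 - F 0 * V 1)) * (1 + F 2)⁻¹
      - (F 1 * N 0 - F 0 * N 1) * (c * V 2) * ((1 + F 2)⁻¹) ^ 2),
    2 * τ * (F 1 * N 0 - F 0 * N 1) * N 2 * ((1 + F 2)⁻¹) ^ 2, ?_, ?_⟩
  · refine hp.congr_fderiv (ContinuousLinearMap.ext fun u => ?_)
    have hgk : (1 + F 2)⁻¹ * (1 + F 2) = 1 := inv_mul_cancel₀ hw
    simp only [smul_eq_mul, add_apply, sub_apply,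
      smul_apply, PiLp.proj_apply, Pi.mul_apply, Pi.sub_apply,
      Function.comp_apply, ← hFdef, ← hVdef, ← hcdef, ← inv_pow]
    linear_combination (u 1 * 2 * τ * c) * (-2 * (1 + F 2)⁻¹ * hd + ((1 + F 2)⁻¹) ^ 2 * he
      - (1 + (1 + F 2)⁻¹ * (1 - F 2)) * hgk)
  · refine hq.congr_fderiv (ContinuousLinearMap.ext fun u => ?_)
    simp only [smul_eq_mul, add_apply, sub_apply,
      smul_apply, PiLp.proj_apply, Pi.mul_apply, Pi.sub_apply,
      Function.comp_apply, ← hFdef, ← hNdef, ← inv_pow]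
    ring

lemma contDiffAt_verticalForm (hγ : IsFrenetCurve κ k γ v) (hT : IsTrigTriple κ C S E)
    {w : Eu 3} (hw : 1 + fermiPoint κ γ v C S w 2 ≠ 0) :
    ContDiffAt ℝ ∞ (verticalForm κ τ k γ v C S E) w := by
  have h0 : ∀ i : Fin 3, ContDiff ℝ ∞ fun w : Eu 3 => w i := fun i =>
    (EuclideanSpace.proj i : Eu 3 →L[ℝ] ℝ).contDiff
  have hF : ∀ i, ContDiff ℝ ∞ fun w => fermiPoint κ γ v C S w i :=
    contDiff_euclidean.mp (contDiff_fermiPoint hγ hT)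
  have hv : ContDiff ℝ ∞ fun w : Eu 3 => v (w 0) := hγ.contDiff_deriv.comp (h0 0)
  have hV : ∀ i, ContDiff ℝ ∞ fun w : Eu 3 => v (w 0) i := contDiff_euclidean.mp hv
  have hN : ∀ i, ContDiff ℝ ∞ fun w => fermiNormal κ γ v C S w i := by
    refine contDiff_euclidean.mp ?_
    have h1 : fermiNormal κ γ v C S = fun w : Eu 3 =>
        (-κ * S (w 1)) • γ (w 0) + C (w 1) • rot κ (γ (w 0)) (v (w 0)) :=
      funext fun w => fermiNormal_eq hγ w
    rw [h1]
    exact ((contDiff_const.mul (hT.contDiff_S.comp (h0 1))).smul (hγ.contDiff.comp (h0 0))).add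
      ((hT.contDiff_C.comp (h0 1)).smul (hγ.contDiff_normal.comp (h0 0)))
  have hg : ContDiffAt ℝ ∞ (fun w => (1 + fermiPoint κ γ v C S w 2)⁻¹) w :=
    (contDiff_const.add (hF 2)).contDiffAt.inv hw
  have hp : ContDiffAt ℝ ∞ (verticalCoeff₀ κ τ k γ v C S E) w :=
    (contDiff_const.mul ((hT.contDiff_S.comp (h0 1)).sub
      (contDiff_const.mul (hT.contDiff_E.comp (h0 1))))).contDiffAt.sub
    (contDiffAt_const.mul (((hT.contDiff_C.comp (h0 1)).sub
      (contDiff_const.mul (hT.contDiff_S.comp (h0 1)))).contDiffAt.mul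
      ((((hF 1).mul (hV 0)).sub ((hF 0).mul (hV 1))).contDiffAt.mul hg)))
  have hq : ContDiffAt ℝ ∞ (verticalCoeff₁ κ τ γ v C S) w :=
    contDiffAt_const.mul ((((hF 1).mul (hN 0)).sub ((hF 0).mul (hN 1))).contDiffAt.mul hg)
  exact ((hp.smul contDiffAt_const).add (hq.smul contDiffAt_const)).add contDiffAt_const

/-- The vertical coordinate. -/
lemma exists_verticalCoord (hγ : IsFrenetCurve κ k γ v) (hT : IsTrigTriple κ C S E) {w₀ : Eu 3}
    (hw : 0 < 1 + fermiPoint κ γ v C S w₀ 2) (z₀ : ℝ) : ∃ Z : Eu 3 → ℝ, Z w₀ = z₀ ∧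
      ∀ᶠ w in 𝓝 w₀, ContDiffAt ℝ ∞ Z w ∧ fderiv ℝ Z w = verticalForm κ τ k γ v C S E w := by
  have hc : Continuous fun w => 1 + fermiPoint κ γ v C S w 2 :=
    continuous_const.add ((EuclideanSpace.proj 2 : Eu 3 →L[ℝ] ℝ).continuous.comp
      (contDiff_fermiPoint hγ hT).continuous)
  obtain ⟨ε, hε, hball⟩ := Metric.isOpen_iff.mp (isOpen_lt continuous_const hc) w₀ hw
  have hne : ∀ w ∈ Metric.ball w₀ ε, 1 + fermiPoint κ γ v C S w 2 ≠ 0 := fun w hw =>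
    (hball hw).ne'
  have hsm : ContDiffOn ℝ ∞ (verticalForm κ τ k γ v C S E) (Metric.ball w₀ ε) := fun w hw =>
    (contDiffAt_verticalForm hγ hT (hne w hw)).contDiffWithinAt
  -- The Poincaré lemma on a ball on which the stereographic denominator stays positive.
  obtain ⟨f, hf⟩ := (convex_ball w₀ ε).exists_forall_hasFDerivAt_of_fderiv_symmetric
    Metric.isOpen_ball (hsm.differentiableOn (by simp)) (fun w hw x y => by
      obtain ⟨p₀, p₁, q₁, hp, hq⟩ := exists_hasFDerivAt_verticalCoeff (τ := τ) hγ hT (hne w hw)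
      have h1 := (((hp.smul (hasFDerivAt_const (EuclideanSpace.proj 0 : Eu 3 →L[ℝ] ℝ) w)).add
        (hq.smul (hasFDerivAt_const (EuclideanSpace.proj 1 : Eu 3 →L[ℝ] ℝ) w))).add
        (hasFDerivAt_const (EuclideanSpace.proj 2 : Eu 3 →L[ℝ] ℝ) w)).fderiv
      change fderiv ℝ (verticalForm κ τ k γ v C S E) w = _ at h1
      rw [h1]
      simp
      ring)
  have hfs : ContDiffOn ℝ ∞ f (Metric.ball w₀ ε) := by
    rw [contDiffOn_infty_iff_fderiv_of_isOpen Metric.isOpen_ball]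
    exact ⟨fun w hw => (hf w hw).differentiableAt.differentiableWithinAt,
      hsm.congr fun w hw => (hf w hw).fderiv⟩
  refine ⟨fun w => f w + (z₀ - f w₀), by ring, ?_⟩
  filter_upwards [Metric.ball_mem_nhds w₀ hε] with w hw
  refine ⟨(hfs.contDiffAt (Metric.isOpen_ball.mem_nhds hw)).add contDiffAt_const, ?_⟩
  rw [fderiv_add_const, (hf w hw).fderiv]

/-- Fermi coordinates in the Cartan model along the vertical cylinder over `γ`. -/
theorem exists_cartanParam (hγ : IsFrenetCurve κ k γ v) (τ : ℝ) {s₀ : ℝ} (hs : 0 < 1 + γ s₀ 2)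
    (z₀ : ℝ) : ∃ c d a : ℝ → ℝ, ∃ Θ : Eu 3 → Eu 3, FermiProfile κ τ k c d a ∧
      Θ !₂[s₀, 0, z₀] = cartanLift (γ s₀) z₀ ∧
      ∀ᶠ w in 𝓝 (!₂[s₀, 0, z₀] : Eu 3), ContDiffAt ℝ ∞ Θ w ∧
        (∀ u u' : Eu 3, ((cartanMetric κ τ).pullback Θ : MetricTensor 3 (Eu 3)) w u u' =
          metricForm (fermiMetric c a) w u u') ∧
        0 < 1 + κ / 4 * (Θ w 0 ^ 2 + Θ w 1 ^ 2) ∧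
        (w 1 = 0 → cartanBase κ (Θ w) = γ (w 0)) := by
  obtain ⟨C, S, E, hT⟩ := exists_isTrigTriple κ
  set w₀ : Eu 3 := !₂[s₀, 0, z₀]
  have hF0 : ∀ w : Eu 3, w 1 = 0 → fermiPoint κ γ v C S w = γ (w 0) := fun w hw => by
    rw [fermiPoint, hw, hT.C_zero, hT.S_zero, one_smul, zero_smul, add_zero]
  have hFw₀ : fermiPoint κ γ v C S w₀ = γ s₀ := hF0 w₀ rfl
  obtain ⟨Z, hZ0, hZ⟩ := exists_verticalCoord (τ := τ) hγ hT (by rwa [hFw₀]) z₀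
  have hFs : ∀ i, ContDiff ℝ ∞ fun w => fermiPoint κ γ v C S w i :=
    contDiff_euclidean.mp (contDiff_fermiPoint hγ hT)
  have hpos : ∀ᶠ w in 𝓝 w₀, 0 < 1 + fermiPoint κ γ v C S w 2 :=
    continuousAt_const.eventually_lt (continuous_const.add (hFs 2).continuous).continuousAt
      (by change 0 < 1 + fermiPoint κ γ v C S w₀ 2; rwa [hFw₀])
  refine ⟨_, _, _, fun w => cartanLift (fermiPoint κ γ v C S w) (Z w), hT.fermiProfile τ k,
    by simp only [hFw₀, hZ0], ?_⟩
  filter_upwards [hpos, hZ] with w hw ⟨hZs, hZd⟩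
  have hne : 1 + fermiPoint κ γ v C S w 2 ≠ 0 := hw.ne'
  have hfr := isUnitTangent_fermiPoint hγ hT w
  have hg : ContDiffAt ℝ ∞ (fun w => (1 + fermiPoint κ γ v C S w 2)) w :=
    (contDiff_const.add (hFs 2)).contDiffAt
  have hΘs : ContDiffAt ℝ ∞ (fun w => cartanLift (fermiPoint κ γ v C S w) (Z w)) w := by
    rw [contDiffAt_euclidean]
    intro i
    fin_cases i
    · exact (contDiff_const.mul (hFs 0)).contDiffAt.div hg hne
    · exact (contDiff_const.mul (hFs 1)).contDiffAt.div hg hne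
    · exact hZs
  refine ⟨hΘs, fun u u' => ?_, ?_, fun hw1 => ?_⟩
  · set F := fermiPoint κ γ v C S w with hF
    set N := fermiNormal κ γ v C S w with hN
    set V := v (w 0) with hV
    set c := C (w 1) - k * S (w 1) with hc
    set D : Eu 3 →L[ℝ] Eu 3 :=
      fderiv ℝ (fun w => cartanLift (fermiPoint κ γ v C S w) (Z w)) w with hD
    -- The differential of the Fermi point on the quadric; horizontal lengths are computed from it
    -- by conformality.
    set dF : Eu 3 → Eu 3 := fun u => (c * u 0) • V + u 1 • N with hdF
    have hdFi : ∀ u i, dF u i = c * u 0 * V i + u 1 * N i := fun u i => by simp [hdF]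
    have hinv := (hasDerivAt_inv hne).comp_hasFDerivAt w
      ((hasFDerivAt_fermiPoint hγ hT w 2).const_add 1)
    have hDi : ∀ i : Fin 3, ∀ u : Eu 3, fderiv ℝ (fun w => 2 * fermiPoint κ γ v C S w i /
        (1 + fermiPoint κ γ v C S w 2)) w u =
          2 / (1 + F 2) * (dF u i - F i * dF u 2 / (1 + F 2)) := fun i u => by
      have h1 := (((hasFDerivAt_fermiPoint hγ hT w i).const_mul 2).mul hinv).fderiv
      have h2 : (fun w => 2 * fermiPoint κ γ v C S w i / (1 + fermiPoint κ γ v C S w 2)) =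
          (fun w => 2 * fermiPoint κ γ v C S w i) *
            ((fun y => y⁻¹) ∘ fun w => 1 + fermiPoint κ γ v C S w 2) := by
        funext w
        exact div_eq_mul_inv _ _
      rw [h2, h1, hdFi, hdFi]
      simp only [smul_eq_mul, add_apply, smul_apply,
        PiLp.proj_apply, Function.comp_apply, ← hF, ← hN, ← hV, ← hc]
      field_simp
      ring
    have hΘd : DifferentiableAt ℝ (fun w => cartanLift (fermiPoint κ γ v C S w) (Z w)) w :=
      hΘs.differentiableAt (by simp)
    have hD0 : ∀ u, D u 0 = 2 / (1 + F 2) * (dF u 0 - F 0 * dF u 2 / (1 + F 2)) := fun u => by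
      rw [← hDi, hD, fderiv_coord hΘd]; rfl
    have hD1 : ∀ u, D u 1 = 2 / (1 + F 2) * (dF u 1 - F 1 * dF u 2 / (1 + F 2)) := fun u => by
      rw [← hDi, hD, fderiv_coord hΘd]; rfl
    have hD2 : ∀ u, D u 2 = verticalForm κ τ k γ v C S E w u := fun u => by
      rw [← hZd, hD, fderiv_coord hΘd]; rfl
    have htan : ∀ u, IsTangentTo κ F (dF u) := fun u => by
      rw [IsTangentTo, hdFi, hdFi, hdFi]
      have h1 : κ * (F 0 * N 0 + F 1 * N 1) + F 2 * N 2 = 0 := hfr.rot_unit.tangent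
      linear_combination (c * u 0) * hfr.tangent + u 1 * h1
    have hsp : spaceFormInner κ (dF u) (dF u') = c ^ 2 * (u 0 * u' 0) + u 1 * u' 1 := by
      have h1 := hfr.unit
      have h2 := hfr.rot_unit.unit
      have h3 := hfr.inner_rot
      change spaceFormInner κ V N = 0 at h3
      change N 0 * N 0 + N 1 * N 1 + κ⁻¹ * (N 2 * N 2) = 1 at h2
      rw [spaceFormInner] at h3 ⊢
      simp only [hdFi]
      linear_combination c ^ 2 * (u 0 * u' 0) * h1 + u 1 * u' 1 * h2
        + c * (u 0 * u' 1 + u 1 * u' 0) * h3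
    have hhor := hfr.spaceFormInner_eq hne (htan u) (htan u')
    rw [hsp] at hhor
    -- The vertical form was chosen for this identity: the connection form of the Cartan metric
    -- pulls back to `dt + a ds`.
    have hver : ∀ u : Eu 3, D u 2 + τ * ((1 + F 2) / 2) * (2 * F 1 / (1 + F 2) * D u 0
        - 2 * F 0 / (1 + F 2) * D u 1) =
          2 * τ * (S (w 1) - k * E (w 1)) * u 0 + u 2 := fun u => by
      rw [hD0, hD1, hD2]
      simp only [verticalForm, verticalCoeff₀, verticalCoeff₁, add_apply,
        smul_apply, PiLp.proj_apply, smul_eq_mul, hdFi, ← hF, ← hN, ← hV, ← hc]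
      field_simp
      ring
    have hcf := conformalFactor_cartanLift (Z w) hfr.quadric hne
    rw [pullback_apply, dmf_eq_fderiv, ← hD]
    change conformalFactor κ (cartanLift F (Z w)) ^ 2 * (D u 0 * D u' 0 + D u 1 * D u' 1) +
      (D u 2 + τ * conformalFactor κ (cartanLift F (Z w)) *
        (2 * F 1 / (1 + F 2) * D u 0 - 2 * F 0 / (1 + F 2) * D u 1)) *
      (D u' 2 + τ * conformalFactor κ (cartanLift F (Z w)) *
        (2 * F 1 / (1 + F 2) * D u' 0 - 2 * F 0 / (1 + F 2) * D u' 1)) = _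
    rw [hcf, hver, hver, hD0, hD1, hD0, hD1, metricForm_apply]
    simp only [Fin.sum_univ_three, fermiMetric, Matrix.of_apply, Matrix.cons_val', Matrix.cons_val,
      Matrix.cons_val_zero, Matrix.cons_val_one, ← hc]
    have hexp : ∀ x y x' y' : ℝ, ((1 + F 2) / 2) ^ 2 * (2 / (1 + F 2) * x * (2 / (1 + F 2) * x')
        + 2 / (1 + F 2) * y * (2 / (1 + F 2) * y')) = x * x' + y * y' := fun x y x' y' => by
      field_simp
    rw [hexp, hhor]
    ring
  · rw [one_add_cartanLift _ hfr.quadric hne]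
    positivity
  · rw [cartanBase_cartanLift _ hfr.quadric hne, hF0 w hw1]

end Connection

end FermiCartan

/-! ### The cylinder in a space locally isometric to the Cartan model -/

/-- The identity (`σ = 1`) or the half turn around the first axis (`σ = -1`). -/
def halfTurn (σ : ℝ) (F : Eu 3) : Eu 3 := !₂[F 0, σ * F 1, σ * F 2]

@[simp] lemma halfTurn_zero (σ : ℝ) (F : Eu 3) : halfTurn σ F 0 = F 0 := rfl
@[simp] lemma halfTurn_one (σ : ℝ) (F : Eu 3) : halfTurn σ F 1 = σ * F 1 := rfl
@[simp] lemma halfTurn_two (σ : ℝ) (F : Eu 3) : halfTurn σ F 2 = σ * F 2 := rfl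

lemma halfTurn_halfTurn {σ : ℝ} (hσ : σ ^ 2 = 1) (F : Eu 3) : halfTurn σ (halfTurn σ F) = F := by
  ext i
  fin_cases i
  · rfl
  · simp; linear_combination F 1 * hσ
  · simp; linear_combination F 2 * hσ

/-- Changing the sign of two coordinates preserves orientation, so a turned curve keeps its signed
curvature. -/
lemma rot_halfTurn {κ σ : ℝ} (hσ : σ ^ 2 = 1) (P v : Eu 3) :
    rot κ (halfTurn σ P) (halfTurn σ v) = halfTurn σ (rot κ P v) := by
  ext i
  fin_cases i
  · simp; linear_combination (P 1 * v 2 - P 2 * v 1) * hσ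
  · simp; ring
  · simp; ring

lemma IsFrenetCurve.halfTurn {κ k σ : ℝ} {γ v : ℝ → Eu 3} (h : IsFrenetCurve κ k γ v)
    (hσ : σ ^ 2 = 1) :
    IsFrenetCurve κ k (fun s => halfTurn σ (γ s)) (fun s => halfTurn σ (v s)) := by
  have hcd : ∀ f : ℝ → Eu 3, ContDiff ℝ ∞ f → ContDiff ℝ ∞ fun s => _root_.halfTurn σ (f s) := by
    intro f hf
    rw [contDiff_euclidean] at *
    intro i
    fin_cases i
    · exact hf 0
    · exact contDiff_const.mul (hf 1)
    · exact contDiff_const.mul (hf 2)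
  have hd : ∀ (f : ℝ → Eu 3) (f' : Eu 3) (s : ℝ), HasDerivAt f f' s →
      HasDerivAt (fun s => _root_.halfTurn σ (f s)) (_root_.halfTurn σ f') s := by
    intro f f' s hf
    have e : ∀ i, HasDerivAt (fun s => f s i) (f' i) s := fun i =>
      ((EuclideanSpace.proj i : Eu 3 →L[ℝ] ℝ).hasFDerivAt).comp_hasDerivAt s hf
    refine hasDerivAt_of_apply fun i => ?_
    fin_cases i
    · exact e 0
    · exact (e 1).const_mul σ
    · exact (e 2).const_mul σ
  refine ⟨hcd _ h.contDiff, hcd _ h.contDiff_deriv, fun s => hd _ _ s (h.hasDerivAt s),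
    fun s => (hd _ _ s (h.hasDerivAt_deriv s)).congr_deriv ?_, fun s => ⟨?_, ?_, ?_⟩⟩
  · rw [rot_halfTurn hσ]
    ext i
    fin_cases i <;> simp <;> ring
  · have := (h.frame s).quadric
    simp only [halfTurn_zero, halfTurn_one, halfTurn_two]
    linear_combination this + (κ * γ s 1 ^ 2 + γ s 2 ^ 2) * hσ
  · have := (h.frame s).tangent
    simp only [halfTurn_zero, halfTurn_one, halfTurn_two]
    linear_combination this + (κ * γ s 1 * v s 1 + γ s 2 * v s 2) * hσ
  · have := (h.frame s).unit
    simp only [halfTurn_zero, halfTurn_one, halfTurn_two]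
    linear_combination this + (v s 1 ^ 2 + κ⁻¹ * v s 2 ^ 2) * hσ

section Lift

variable {N : Type*} [TopologicalSpace N] [ChartedSpace (Eu 3) N] [IsManifold (𝓡 3) ∞ N]

/-- `J` is a local isometry of the Cartan model to `(N, g)`; it commutes with the projections up to
a half turn. -/
def IsCartanImmersion (κ τ : ℝ) (g : MetricTensor 3 N) (π : N → Eu 3) (σ : ℝ) (J : Eu 3 → N) :
    Prop :=
  ∀ P : Eu 3, 0 < 1 + κ / 4 * (P 0 ^ 2 + P 1 ^ 2) → ContMDiffAt (𝓡 3) (𝓡 3) ∞ J P ∧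
    (∀ u u' : Eu 3, (g.pullback J : MetricTensor 3 (Eu 3)) P u u' = cartanMetric κ τ P u u') ∧
    π (J P) = halfTurn σ (cartanBase κ P)

/-- The turned curve has Fermi coordinates `Θ` in the Cartan model, and the local isometry `J`
carries them to `N`. Projecting back applies the half turn a second time, which undoes it. -/
theorem hasFermiCoordinates_of_cartan {κ τ k k' : ℝ} {g : MetricTensor 3 N} {π : N → Eu 3}
    {γ v : ℝ → Eu 3} (hγ : IsFrenetCurve κ k' γ v) (hk : k' ^ 2 = k ^ 2)
    (hJ : ∀ q, ∀ s, π q = γ s → ∃ (σ : ℝ) (J : Eu 3 → N) (z : ℝ), σ ^ 2 = 1 ∧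
      IsCartanImmersion κ τ g π σ J ∧ 0 < 1 + halfTurn σ (γ s) 2 ∧
      J (cartanLift (halfTurn σ (γ s)) z) = q) :
    HasFermiCoordinates κ k g (π ⁻¹' Set.range γ) := by
  rintro q ⟨s, hs⟩
  obtain ⟨σ, J, z, hσ, hJ, hpos, hq⟩ := hJ q s hs.symm
  obtain ⟨c, d, a, Θ, hprof, hΘ0, hΘ⟩ := exists_cartanParam (hγ.halfTurn hσ) τ hpos z
  refine ⟨τ, k', c, d, a, J ∘ Θ, !₂[s, 0, z], hk, hprof, ⟨rfl, ?_, ?_, ?_⟩, ?_⟩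
  · filter_upwards [hΘ] with w ⟨h1, _, h3, _⟩
    exact (hJ _ h3).1.comp w h1.contMDiffAt
  · filter_upwards [hΘ] with w ⟨h1, h2, h3, _⟩ u u'
    rw [← pullback_pullback g ((hJ _ h3).1.mdifferentiableAt (by simp))
      (h1.contMDiffAt.mdifferentiableAt (by simp)), ← h2]
    exact (hJ _ h3).2.1 _ _
  · filter_upwards [hΘ] with w ⟨h1, h2, h3, h4⟩ hw
    refine ⟨w 0, ?_⟩
    rw [Function.comp_apply, (hJ _ h3).2.2, h4 hw, halfTurn_halfTurn hσ]
  · rw [Function.comp_apply, hΘ0, hq]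

end Lift

/-- Where the stereographic denominator is not positive, `F 2 ≤ -1`, and the half turn replaces it
by `1 - F 2 ≥ 2`. -/
lemma exists_halfTurn_pos {F : Eu 3} : ∃ σ : ℝ, σ ^ 2 = 1 ∧ 0 < 1 + halfTurn σ F 2 := by
  by_cases h : 0 < 1 + F 2
  · exact ⟨1, by norm_num, by simpa using h⟩
  · exact ⟨-1, by norm_num, by simp; linarith⟩

/-! ### The Cartan model -/

section Cartan

variable {κ τ : ℝ}

variable (κ τ) in
/-- The metric of `cartanSpace`. -/
abbrev cartanSpaceMetric : MetricTensor 3 (cartanDomain κ) :=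
  (cartanMetric κ τ).pullback Subtype.val

variable (κ) in
/-- The projection of `cartanSpace`. -/
abbrev cartanSpaceProj (P : cartanDomain κ) : Eu 3 := cartanBase κ P.1

lemma mdifferentiable_val {n : ℕ} {U : TopologicalSpace.Opens (Eu n)} (p : U) :
    MDifferentiableAt (𝓡 n) (𝓡 n) (Subtype.val : U → Eu n) p :=
  (contMDiff_subtype_val (n := ∞) p).mdifferentiableAt (by simp)

lemma zero_mem_cartanDomain : (0 : Eu 3) ∈ cartanDomain κ := by
  change 0 < 1 + κ / 4 * ((0 : ℝ) ^ 2 + (0 : ℝ) ^ 2)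
  norm_num

open Classical in
variable (κ) in
/-- The points of the domain, as points of the manifold. -/
def toCartanDomain (P : Eu 3) : cartanDomain κ :=
  if h : P ∈ cartanDomain κ then ⟨P, h⟩ else ⟨0, zero_mem_cartanDomain⟩

lemma toCartanDomain_coe {P : Eu 3} (h : P ∈ cartanDomain κ) : (toCartanDomain κ P).1 = P := by
  rw [toCartanDomain, dif_pos h]

lemma isCartanImmersion_toCartanDomain : IsCartanImmersion κ τ (cartanSpaceMetric κ τ)
    (cartanSpaceProj κ) 1 (toCartanDomain κ) := by
  intro P hP
  have hP' : P ∈ cartanDomain κ := hP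
  have he : Subtype.val ∘ toCartanDomain κ =ᶠ[𝓝 P] fun Q => Q := by
    filter_upwards [(cartanDomain κ).isOpen.mem_nhds hP'] with Q hQ
    exact toCartanDomain_coe hQ
  have hs : ContMDiffAt (𝓡 3) (𝓡 3) ∞ (toCartanDomain κ) P := by
    rw [← ContMDiffAt.subtypeVal_comp_iff]
    exact contMDiffAt_id.congr_of_eventuallyEq he
  refine ⟨hs, fun u u' => ?_, ?_⟩
  · rw [pullback_pullback _ (mdifferentiable_val _) (hs.mdifferentiableAt (by simp)),
      pullback_congr (f := Subtype.val ∘ toCartanDomain κ) (f' := fun Q => Q) _ he, pullback_apply,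
      dmf_id]
    rfl
  · rw [cartanSpaceProj, toCartanDomain_coe hP']
    ext i
    fin_cases i <;> simp

lemma conformalFactor_pos {P : Eu 3} (hP : P ∈ cartanDomain κ) : 0 < conformalFactor κ P :=
  inv_pos.mpr hP

lemma one_add_cartanBase_two {P : Eu 3} (hP : P ∈ cartanDomain κ) :
    1 + cartanBase κ P 2 = 2 * conformalFactor κ P := by
  have h : 1 + κ / 4 * (P 0 ^ 2 + P 1 ^ 2) ≠ 0 := ne_of_gt hP
  change 1 + conformalFactor κ P * (1 - κ / 4 * (P 0 ^ 2 + P 1 ^ 2)) = _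
  have h1 : conformalFactor κ P * (1 + κ / 4 * (P 0 ^ 2 + P 1 ^ 2)) = 1 := inv_mul_cancel₀ h
  linear_combination -h1

lemma cartanLift_cartanBase {P : Eu 3} (hP : P ∈ cartanDomain κ) :
    cartanLift (cartanBase κ P) (P 2) = P := by
  have h := (conformalFactor_pos hP).ne'
  rw [cartanLift, one_add_cartanBase_two hP]
  ext i
  fin_cases i <;> simp [cartanBase] <;> field_simp

lemma cartanLift_mem {F : Eu 3} (hF : κ * (F 0 ^ 2 + F 1 ^ 2) + F 2 ^ 2 = 1) (hF2 : 0 < 1 + F 2)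
    (z : ℝ) : cartanLift F z ∈ cartanDomain κ := by
  change 0 < 1 + κ / 4 * (cartanLift F z 0 ^ 2 + cartanLift F z 1 ^ 2)
  rw [one_add_cartanLift z hF hF2.ne']
  positivity

lemma hasFermiCoordinates_cartan {k k' : ℝ} {γ v : ℝ → Eu 3} (hγ : IsFrenetCurve κ k' γ v)
    (hk : k' ^ 2 = k ^ 2) : HasFermiCoordinates κ k (cartanSpaceMetric κ τ)
      (cartanSpaceProj κ ⁻¹' Set.range γ) := by
  refine hasFermiCoordinates_of_cartan (τ := τ) hγ hk fun q s hq => ?_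
  have h1 : halfTurn 1 (γ s) = cartanBase κ q.1 := by
    rw [← hq]
    ext i
    fin_cases i <;> simp
  -- The model is its own chart, so no half turn is needed, and the height of the point is its third
  -- coordinate.
  refine ⟨1, toCartanDomain κ, q.1 2, by norm_num, isCartanImmersion_toCartanDomain, ?_, ?_⟩
  · rw [h1, one_add_cartanBase_two q.2]
    linarith [conformalFactor_pos q.2]
  · rw [h1, cartanLift_cartanBase q.2]
    exact Subtype.ext (toCartanDomain_coe q.2)

variable (κ) in
/-- The vertical translations of the Cartan model. -/
def cartanTranslation (b : ℝ) (q : cartanDomain κ) : cartanDomain κ :=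
  ⟨q.1 + b • (coordVec 2 : Eu 3), by
    have h : 0 < 1 + κ / 4 * (q.1 0 ^ 2 + q.1 1 ^ 2) := q.2
    change 0 < 1 + κ / 4 * ((q.1 + b • (coordVec 2 : Eu 3)) 0 ^ 2 + (q.1 + b • (coordVec 2 : Eu 3)) 1 ^ 2)
    simpa [coordVec] using h⟩

lemma contMDiff_cartanTranslation (b : ℝ) :
    ContMDiff (𝓡 3) (𝓡 3) ∞ (cartanTranslation κ b) := by
  rw [← ContMDiff.subtypeVal_comp_iff]
  exact (contDiff_id.add contDiff_const).contMDiff.comp contMDiff_subtype_val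

lemma cartanMetric_translation (b : ℝ) (P u u' : Eu 3) :
    cartanMetric κ τ (P + b • (coordVec 2 : Eu 3)) u u' = cartanMetric κ τ P u u' := by
  have h : ∀ i : Fin 3, i ≠ 2 → (P + b • (coordVec 2 : Eu 3)) i = P i := fun i hi => by
    simp [coordVec, hi]
  have hc : conformalFactor κ (P + b • (coordVec 2 : Eu 3)) = conformalFactor κ P := by
    rw [conformalFactor, conformalFactor, h 0 (by decide), h 1 (by decide)]
  rw [cartanMetric, cartanMetric, hc, h 0 (by decide), h 1 (by decide)]

lemma cartanBase_translation (b : ℝ) (P : Eu 3) :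
    cartanBase κ (P + b • (coordVec 2 : Eu 3)) = cartanBase κ P := by
  have h : ∀ i : Fin 3, i ≠ 2 → (P + b • (coordVec 2 : Eu 3)) i = P i := fun i hi => by
    simp [coordVec, hi]
  have hc : conformalFactor κ (P + b • (coordVec 2 : Eu 3)) = conformalFactor κ P := by
    rw [conformalFactor, conformalFactor, h 0 (by decide), h 1 (by decide)]
  rw [cartanBase, cartanBase, hc, h 0 (by decide), h 1 (by decide)]

lemma isVerticalTranslation_cartan {K : Set (Eu 3)} (hK : IsCompact K) (hne : K.Nonempty)
    (hKq : ∀ F ∈ K, κ * (F 0 ^ 2 + F 1 ^ 2) + F 2 ^ 2 = 1 ∧ 0 < 1 + F 2) :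
    IsVerticalTranslation (cartanSpaceMetric κ τ) (cartanSpaceProj κ ⁻¹' K) (fun q => q.1 2)
      (cartanTranslation κ 1) (cartanTranslation κ (-1)) where
  smooth_height := (EuclideanSpace.proj 2 : Eu 3 →L[ℝ] ℝ).contDiff.contMDiff.comp
    contMDiff_subtype_val
  smooth := contMDiff_cartanTranslation 1
  smooth' := contMDiff_cartanTranslation (-1)
  right_inv q := Subtype.ext (by simp [cartanTranslation])
  left_inv q := Subtype.ext (by simp [cartanTranslation])
  isometry q u u' := by
    have hs := contMDiff_cartanTranslation (κ := κ) (-1) q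
    rw [pullback_pullback _ (mdifferentiable_val _) (hs.mdifferentiableAt (by simp))]
    have he : Subtype.val ∘ cartanTranslation κ (-1) =
        (fun P : Eu 3 => P + (-1 : ℝ) • coordVec 2) ∘ Subtype.val := rfl
    have hd : DifferentiableAt ℝ (fun P : Eu 3 => P + (-1 : ℝ) • coordVec 2) q.1 := by fun_prop
    rw [he, ← pullback_pullback _ hd.mdifferentiableAt (mdifferentiable_val _), pullback_apply,
      pullback_apply, dmf_eq_fderiv, fderiv_add_const, fderiv_fun_id]
    exact (cartanMetric_translation (-1) q.1 _ _).symm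
  map_mem q hq := by
    change cartanBase κ (q.1 + (1 : ℝ) • coordVec 2) ∈ K
    rw [cartanBase_translation]
    exact hq
  map_mem' q hq := by
    change cartanBase κ (q.1 + (-1 : ℝ) • coordVec 2) ∈ K
    rw [cartanBase_translation]
    exact hq
  height_map q := by simp [cartanTranslation, coordVec]
  isCompact R := by
    rw [Subtype.isCompact_iff]
    -- The section trivializes the bundle over `K`, so a slab is a continuous image of `K × [0, R]`.
    have h1 : Subtype.val '' (cartanSpaceProj κ ⁻¹' K ∩ (fun q => q.1 2) ⁻¹' Set.Icc 0 R) =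
        (fun p : Eu 3 × ℝ => cartanLift p.1 p.2) '' (K ×ˢ Set.Icc 0 R) := by
      ext P
      constructor
      · rintro ⟨q, ⟨hq1, hq2⟩, rfl⟩
        exact ⟨(cartanBase κ q.1, q.1 2), ⟨hq1, hq2⟩, cartanLift_cartanBase q.2⟩
      · rintro ⟨⟨F, z⟩, ⟨hF, hz⟩, rfl⟩
        obtain ⟨h1, h2⟩ := hKq F hF
        refine ⟨⟨cartanLift F z, cartanLift_mem h1 h2 z⟩, ⟨?_, hz⟩, rfl⟩
        change cartanBase κ (cartanLift F z) ∈ K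
        rw [cartanBase_cartanLift z h1 h2.ne']
        exact hF
    rw [h1]
    refine (hK.prod isCompact_Icc).image_of_continuousOn ?_
    have hc : ∀ i : Fin 3, Continuous fun p : Eu 3 × ℝ => p.1 i := fun i =>
      (EuclideanSpace.proj i : Eu 3 →L[ℝ] ℝ).continuous.comp continuous_fst
    refine (PiLp.continuous_toLp 2 _).comp_continuousOn (continuousOn_pi.mpr fun i => ?_)
    fin_cases i
    · exact (continuous_const.mul (hc 0)).continuousOn.div (continuous_const.add (hc 2)).continuousOn
        fun p hp => (hKq p.1 hp.1).2.ne'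
    · exact (continuous_const.mul (hc 1)).continuousOn.div (continuous_const.add (hc 2)).continuousOn
        fun p hp => (hKq p.1 hp.1).2.ne'
    · exact continuous_snd.continuousOn
  nonempty := by
    obtain ⟨F, hF⟩ := hne
    obtain ⟨h1, h2⟩ := hKq F hF
    refine ⟨⟨cartanLift F (1 / 2), cartanLift_mem h1 h2 _⟩, ?_, ?_⟩
    · change cartanBase κ (cartanLift F (1 / 2)) ∈ K
      rw [cartanBase_cartanLift _ h1 h2.ne']
      exact hF
    · change (1 / 2 : ℝ) ∈ Set.Ioo 0 1
      norm_num

end Cartan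

/-! ### The product `𝕊²(κ) × ℝ` -/

section ConformalFactor

variable {κ : ℝ}

lemma one_add_pos (hκ : 0 < κ) (P : Eu 3) : 0 < 1 + κ / 4 * (P 0 ^ 2 + P 1 ^ 2) := by positivity

lemma hasFDerivAt_radius (κ : ℝ) (P : Eu 3) :
    HasFDerivAt (fun P : Eu 3 => 1 + κ / 4 * (P 0 ^ 2 + P 1 ^ 2))
      ((κ / 2 * P 0) • (EuclideanSpace.proj 0 : Eu 3 →L[ℝ] ℝ)
        + (κ / 2 * P 1) • (EuclideanSpace.proj 1 : Eu 3 →L[ℝ] ℝ)) P := by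
  have h := ((((hasFDerivAt_coord 0 P).pow 2).add ((hasFDerivAt_coord 1 P).pow 2)).const_mul
    (κ / 4)).const_add 1
  refine h.congr_fderiv (ContinuousLinearMap.ext fun u => ?_)
  simp
  ring

lemma hasFDerivAt_conformalFactor (hκ : 0 < κ) (P : Eu 3) :
    HasFDerivAt (conformalFactor κ) ((-(κ / 2) * conformalFactor κ P ^ 2) •
      (P 0 • (EuclideanSpace.proj 0 : Eu 3 →L[ℝ] ℝ)
        + P 1 • (EuclideanSpace.proj 1 : Eu 3 →L[ℝ] ℝ))) P := by
  have h := (hasDerivAt_inv (one_add_pos hκ P).ne').comp_hasFDerivAt P (hasFDerivAt_radius κ P)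
  refine h.congr_fderiv (ContinuousLinearMap.ext fun u => ?_)
  simp only [smul_eq_mul, add_apply, smul_apply, PiLp.proj_apply, conformalFactor, ← inv_pow]
  ring

lemma contDiff_conformalFactor (hκ : 0 < κ) : ContDiff ℝ ∞ (conformalFactor κ) := by
  have h0 : ∀ i : Fin 3, ContDiff ℝ ∞ fun w : Eu 3 => w i := fun i =>
    (EuclideanSpace.proj i : Eu 3 →L[ℝ] ℝ).contDiff
  exact (contDiff_const.add (contDiff_const.mul (((h0 0).pow 2).add ((h0 1).pow 2)))).inv
    fun P => (one_add_pos hκ P).ne'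

lemma conformalFactor_mul (hκ : 0 < κ) (P : Eu 3) :
    conformalFactor κ P * (1 + κ / 4 * (P 0 ^ 2 + P 1 ^ 2)) = 1 :=
  inv_mul_cancel₀ (one_add_pos hκ P).ne'

lemma cartanBase_quadric (hκ : 0 < κ) (P : Eu 3) :
    κ * (cartanBase κ P 0 ^ 2 + cartanBase κ P 1 ^ 2) + cartanBase κ P 2 ^ 2 = 1 := by
  have h := conformalFactor_mul hκ P
  change κ * ((conformalFactor κ P * P 0) ^ 2 + (conformalFactor κ P * P 1) ^ 2)
    + (conformalFactor κ P * (1 - κ / 4 * (P 0 ^ 2 + P 1 ^ 2))) ^ 2 = 1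
  linear_combination (conformalFactor κ P * (1 + κ / 4 * (P 0 ^ 2 + P 1 ^ 2)) + 1) * h

end ConformalFactor

section Product

variable {κ b σ : ℝ}

variable (κ) in
/-- The metric of `productSpace`. -/
abbrev productSpaceMetric : MetricTensor 3 puncturedSpace :=
  (conicalMetric κ).pullback Subtype.val

variable (κ) in
/-- The projection of `productSpace`. -/
abbrev productSpaceProj (P : puncturedSpace) : Eu 3 :=
  !₂[P.1 0 / (Real.sqrt κ * ‖P.1‖), P.1 1 / (Real.sqrt κ * ‖P.1‖), P.1 2 / ‖P.1‖]

/-- The point over `F` at height `z`. -/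
def conePoint (b : ℝ) (F : Eu 3) (z : ℝ) : Eu 3 :=
  !₂[Real.exp (b * z) * (b * F 0), Real.exp (b * z) * (b * F 1), Real.exp (b * z) * F 2]

lemma norm_conePoint {F : Eu 3} (hF : b ^ 2 * (F 0 ^ 2 + F 1 ^ 2) + F 2 ^ 2 = 1) (z : ℝ) :
    ‖conePoint b F z‖ = Real.exp (b * z) := by
  rw [EuclideanSpace.norm_eq, Real.sqrt_eq_iff_mul_self_eq (by positivity) (by positivity),
    Fin.sum_univ_three]
  simp only [Real.norm_eq_abs, sq_abs]
  change (Real.exp (b * z) * (b * F 0)) ^ 2 + (Real.exp (b * z) * (b * F 1)) ^ 2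
    + (Real.exp (b * z) * F 2) ^ 2 = _
  linear_combination Real.exp (b * z) ^ 2 * hF

lemma conePoint_ne_zero {F : Eu 3} (hF : b ^ 2 * (F 0 ^ 2 + F 1 ^ 2) + F 2 ^ 2 = 1) (z : ℝ) :
    conePoint b F z ∈ puncturedSpace := by
  change conePoint b F z ≠ 0
  rw [← norm_ne_zero_iff, norm_conePoint hF]
  positivity

lemma productSpaceProj_conePoint (hb : 0 < b) {F : Eu 3}
    (hF : b ^ 2 * (F 0 ^ 2 + F 1 ^ 2) + F 2 ^ 2 = 1) (z : ℝ) (q : puncturedSpace)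
    (hq : q.1 = conePoint b F z) : productSpaceProj (b ^ 2) q = F := by
  have he := (Real.exp_pos (b * z)).ne'
  rw [productSpaceProj, hq, norm_conePoint hF, Real.sqrt_sq hb.le]
  ext i
  fin_cases i <;> simp [conePoint] <;> field_simp

lemma conePoint_productSpaceProj (hb : 0 < b) (q : puncturedSpace) :
    conePoint b (productSpaceProj (b ^ 2) q) (Real.log ‖q.1‖ / b) = q.1 := by
  have hq : 0 < ‖q.1‖ := norm_pos_iff.mpr q.2
  rw [conePoint, mul_div_cancel₀ _ hb.ne', Real.exp_log hq, productSpaceProj, Real.sqrt_sq hb.le]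
  ext i
  fin_cases i <;> simp <;> field_simp

variable (κ b σ) in
/-- The immersion of the Cartan model, before the restriction of the codomain. -/
def coneMap (P : Eu 3) : Eu 3 := conePoint b (halfTurn σ (cartanBase κ P)) (P 2)

lemma halfTurn_quadric (hσ : σ ^ 2 = 1) {F : Eu 3} (hF : κ * (F 0 ^ 2 + F 1 ^ 2) + F 2 ^ 2 = 1) :
    κ * (halfTurn σ F 0 ^ 2 + halfTurn σ F 1 ^ 2) + halfTurn σ F 2 ^ 2 = 1 := by
  simp only [halfTurn_zero, halfTurn_one, halfTurn_two]
  linear_combination hF + (κ * F 1 ^ 2 + F 2 ^ 2) * hσ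

lemma halfTurn_cartanBase_quadric (hb : 0 < b) (hσ : σ ^ 2 = 1) (P : Eu 3) :
    b ^ 2 * (halfTurn σ (cartanBase (b ^ 2) P) 0 ^ 2 + halfTurn σ (cartanBase (b ^ 2) P) 1 ^ 2)
      + halfTurn σ (cartanBase (b ^ 2) P) 2 ^ 2 = 1 :=
  halfTurn_quadric hσ (cartanBase_quadric (by positivity) P)

lemma contDiff_coneMap (hb : 0 < b) : ContDiff ℝ ∞ (coneMap (b ^ 2) b σ) := by
  have hl := contDiff_conformalFactor (κ := b ^ 2) (by positivity)
  have h0 : ∀ i : Fin 3, ContDiff ℝ ∞ fun w : Eu 3 => w i := fun i =>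
    (EuclideanSpace.proj i : Eu 3 →L[ℝ] ℝ).contDiff
  have he : ContDiff ℝ ∞ fun w : Eu 3 => Real.exp (b * w 2) :=
    Real.contDiff_exp.comp (contDiff_const.mul (h0 2))
  rw [contDiff_euclidean]
  intro i
  fin_cases i
  · exact he.mul (contDiff_const.mul (hl.mul (h0 0)))
  · exact he.mul (contDiff_const.mul (contDiff_const.mul (hl.mul (h0 1))))
  · exact he.mul (contDiff_const.mul (hl.mul (contDiff_const.sub (contDiff_const.mul
      (((h0 0).pow 2).add ((h0 1).pow 2))))))

/-- In polar coordinates the radius is `exp (b z)` and the angular part is inverse stereographic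
projection, which is conformal with factor `λ`. -/
lemma conicalMetric_pullback_coneMap (hb : 0 < b) (hσ : σ ^ 2 = 1) (P u u' : Eu 3) :
    ((conicalMetric (b ^ 2)).pullback (coneMap (b ^ 2) b σ) : MetricTensor 3 (Eu 3)) P u u' =
      cartanMetric (b ^ 2) 0 P u u' := by
  have hκ : 0 < b ^ 2 := by positivity
  have hd : DifferentiableAt ℝ (coneMap (b ^ 2) b σ) P :=
    (contDiff_coneMap hb).differentiable (by simp) P
  have hn : ‖coneMap (b ^ 2) b σ P‖ = Real.exp (b * P 2) :=
    norm_conePoint (halfTurn_cartanBase_quadric hb hσ P) _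
  set L := conformalFactor (b ^ 2) P with hL
  set e := Real.exp (b * P 2) with he
  have hl := hasFDerivAt_conformalFactor hκ P
  have hexp := (Real.hasDerivAt_exp (b * P 2)).comp_hasFDerivAt P
    ((hasFDerivAt_coord 2 P).const_mul b)
  set dL : Eu 3 → ℝ := fun u => -(b ^ 2 / 2) * L ^ 2 * (P 0 * u 0 + P 1 * u 1) with hdL
  have hmul := conformalFactor_mul hκ P
  rw [← hL] at hmul
  -- The relation `λ (1 + κ ρ² / 4) = 1`, with `ρ² = P 0 ^ 2 + P 1 ^ 2`, turns the last component
  -- into `2 λ - 1`, which is easier to differentiate.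
  have h2 : coneMap (b ^ 2) b σ = fun P => !₂[Real.exp (b * P 2) * (b * (conformalFactor (b ^ 2) P
      * P 0)), Real.exp (b * P 2) * (b * (σ * (conformalFactor (b ^ 2) P * P 1))),
      Real.exp (b * P 2) * (σ * (2 * conformalFactor (b ^ 2) P - 1))] := by
    funext Q
    have := conformalFactor_mul hκ Q
    ext i
    fin_cases i
    · rfl
    · rfl
    · change Real.exp (b * Q 2) * (σ * (conformalFactor (b ^ 2) Q *
        (1 - b ^ 2 / 4 * (Q 0 ^ 2 + Q 1 ^ 2)))) =
        Real.exp (b * Q 2) * (σ * (2 * conformalFactor (b ^ 2) Q - 1))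
      linear_combination -(Real.exp (b * Q 2) * σ) * this
  have hD0 : ∀ u : Eu 3, fderiv ℝ (coneMap (b ^ 2) b σ) P u 0 =
      e * (b * (b * u 2 * (L * P 0) + (dL u * P 0 + L * u 0))) := fun u => by
    rw [fderiv_coord hd, h2]
    have := (hexp.mul ((hl.mul (hasFDerivAt_coord 0 P)).const_mul b)).fderiv
    change fderiv ℝ (fun P : Eu 3 => Real.exp (b * P 2) * (b * (conformalFactor (b ^ 2) P * P 0)))
      P = _ at this
    change fderiv ℝ (fun P : Eu 3 => Real.exp (b * P 2) * (b * (conformalFactor (b ^ 2) P * P 0)))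
      P u = _
    rw [this]
    simp only [smul_eq_mul, add_apply, smul_apply, PiLp.proj_apply, Pi.mul_apply,
      Function.comp_apply, ← hL, ← he, hdL]
    ring
  have hD1 : ∀ u : Eu 3, fderiv ℝ (coneMap (b ^ 2) b σ) P u 1 =
      e * (b * (σ * (b * u 2 * (L * P 1) + (dL u * P 1 + L * u 1)))) := fun u => by
    rw [fderiv_coord hd, h2]
    have := (hexp.mul (((hl.mul (hasFDerivAt_coord 1 P)).const_mul σ).const_mul b)).fderiv
    change fderiv ℝ (fun P : Eu 3 => Real.exp (b * P 2) *
      (b * (σ * (conformalFactor (b ^ 2) P * P 1)))) P = _ at this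
    change fderiv ℝ (fun P : Eu 3 => Real.exp (b * P 2) *
      (b * (σ * (conformalFactor (b ^ 2) P * P 1)))) P u = _
    rw [this]
    simp only [smul_eq_mul, add_apply, smul_apply, PiLp.proj_apply, Pi.mul_apply,
      Function.comp_apply, ← hL, ← he, hdL]
    ring
  have hD2 : ∀ u : Eu 3, fderiv ℝ (coneMap (b ^ 2) b σ) P u 2 =
      e * (σ * (b * u 2 * (2 * L - 1) + 2 * dL u)) := fun u => by
    rw [fderiv_coord hd, h2]
    have := (hexp.mul (((hl.const_mul 2).sub_const 1).const_mul σ)).fderiv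
    change fderiv ℝ (fun P : Eu 3 => Real.exp (b * P 2) *
      (σ * (2 * conformalFactor (b ^ 2) P - 1))) P = _ at this
    change fderiv ℝ (fun P : Eu 3 => Real.exp (b * P 2) *
      (σ * (2 * conformalFactor (b ^ 2) P - 1))) P u = _
    rw [this]
    simp only [smul_eq_mul, add_apply, smul_apply, PiLp.proj_apply,
      Function.comp_apply, ← hL, ← he, hdL]
    ring
  rw [pullback_apply, dmf_eq_fderiv]
  change (b ^ 2 * ‖coneMap (b ^ 2) b σ P‖ ^ 2)⁻¹ * inner ℝ (fderiv ℝ (coneMap (b ^ 2) b σ) P u)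
      (fderiv ℝ (coneMap (b ^ 2) b σ) P u') =
    L ^ 2 * (u 0 * u' 0 + u 1 * u' 1) + (u 2 + 0 * L * (P 1 * u 0 - P 0 * u 1)) *
      (u' 2 + 0 * L * (P 1 * u' 0 - P 0 * u' 1))
  rw [hn, PiLp.inner_apply, Fin.sum_univ_three]
  simp only [RCLike.inner_apply, conj_trivial, hD0, hD1, hD2]
  have hepos : e ≠ 0 := (Real.exp_pos _).ne'
  rw [inv_mul_eq_iff_eq_mul₀ (by positivity)]
  have hD : ∀ u : Eu 3, dL u = -(b ^ 2 / 2) * L ^ 2 * (P 0 * u 0 + P 1 * u 1) := fun u => rfl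
  rw [hD, hD]
  generalize P 0 = x at *
  generalize P 1 = y at *
  linear_combination e ^ 2 * (b ^ 2 * u 2 * u' 2 * (4 * L)
    - 2 * b ^ 3 * L ^ 2 * (u 2 * (x * u' 0 + y * u' 1) + u' 2 * (x * u 0 + y * u 1))
    + b ^ 4 * L ^ 3 * (x * u 0 + y * u 1) * (x * u' 0 + y * u' 1)) * hmul
    + e ^ 2 * (b ^ 2 * (b * u 2 * (L * y) + (-(b ^ 2 / 2) * L ^ 2 * (x * u 0 + y * u 1) * y
        + L * u 1)) * (b * u' 2 * (L * y) + (-(b ^ 2 / 2) * L ^ 2 * (x * u' 0 + y * u' 1) * y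
        + L * u' 1)) + (b * u 2 * (2 * L - 1) - b ^ 2 * L ^ 2 * (x * u 0 + y * u 1)) *
        (b * u' 2 * (2 * L - 1) - b ^ 2 * L ^ 2 * (x * u' 0 + y * u' 1))) * hσ

variable (b σ) in
/-- The immersion of the Cartan model. -/
def toPunctured (hb : 0 < b) (hσ : σ ^ 2 = 1) (P : Eu 3) : puncturedSpace :=
  ⟨coneMap (b ^ 2) b σ P, conePoint_ne_zero (halfTurn_cartanBase_quadric hb hσ P) _⟩

lemma isCartanImmersion_toPunctured (hb : 0 < b) (hσ : σ ^ 2 = 1) :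
    IsCartanImmersion (b ^ 2) 0 (productSpaceMetric (b ^ 2)) (productSpaceProj (b ^ 2)) σ
      (toPunctured b σ hb hσ) := by
  intro P _
  have hs : ContMDiffAt (𝓡 3) (𝓡 3) ∞ (toPunctured b σ hb hσ) P := by
    rw [← ContMDiffAt.subtypeVal_comp_iff]
    exact (contDiff_coneMap hb).contMDiff P
  refine ⟨hs, fun u u' => ?_, ?_⟩
  · rw [pullback_pullback _ (mdifferentiable_val _) (hs.mdifferentiableAt (by simp))]
    exact conicalMetric_pullback_coneMap hb hσ P u u'
  · exact productSpaceProj_conePoint hb (halfTurn_cartanBase_quadric hb hσ P) _ _ rfl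

lemma hasFermiCoordinates_product (hb : 0 < b) {k k' : ℝ} {γ v : ℝ → Eu 3}
    (hγ : IsFrenetCurve (b ^ 2) k' γ v) (hk : k' ^ 2 = k ^ 2) :
    HasFermiCoordinates (b ^ 2) k (productSpaceMetric (b ^ 2))
      (productSpaceProj (b ^ 2) ⁻¹' Set.range γ) := by
  refine hasFermiCoordinates_of_cartan (τ := 0) hγ hk fun q s hq => ?_
  obtain ⟨σ, hσ, hpos⟩ := exists_halfTurn_pos (F := γ s)
  refine ⟨σ, toPunctured b σ hb hσ, Real.log ‖q.1‖ / b, hσ, isCartanImmersion_toPunctured hb hσ,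
    hpos, Subtype.ext ?_⟩
  change conePoint b (halfTurn σ (cartanBase (b ^ 2) (cartanLift (halfTurn σ (γ s)) _))) _ = q.1
  rw [cartanBase_cartanLift _ (halfTurn_quadric hσ (hγ.frame s).quadric) hpos.ne',
    halfTurn_halfTurn hσ, ← hq]
  exact conePoint_productSpaceProj hb q

/-- The vertical translations of the product. -/
def dilation (t : ℝ) (q : puncturedSpace) : puncturedSpace :=
  ⟨Real.exp t • q.1, smul_ne_zero (Real.exp_pos t).ne' q.2⟩

lemma contMDiff_dilation (t : ℝ) : ContMDiff (𝓡 3) (𝓡 3) ∞ (dilation t) := by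
  rw [← ContMDiff.subtypeVal_comp_iff]
  exact (contDiff_const_smul (F := Eu 3) (𝕜 := ℝ) (Real.exp t)).contMDiff.comp contMDiff_subtype_val

lemma norm_dilation (t : ℝ) (q : puncturedSpace) : ‖(dilation t q).1‖ = Real.exp t * ‖q.1‖ := by
  rw [dilation, norm_smul, Real.norm_eq_abs, abs_of_pos (Real.exp_pos t)]

lemma productSpaceProj_dilation (t : ℝ) (q : puncturedSpace) :
    productSpaceProj κ (dilation t q) = productSpaceProj κ q := by
  have ht := (Real.exp_pos t).ne'
  have h : ∀ i, (dilation t q).1 i = Real.exp t * q.1 i := fun i => rfl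
  rw [productSpaceProj, productSpaceProj, norm_dilation, h, h, h, mul_left_comm,
    mul_div_mul_left _ _ ht, mul_div_mul_left _ _ ht, mul_div_mul_left _ _ ht]

/-- The height is `log ‖P‖ / b`, so dilation by `exp b` raises it by one. Dilations are isometries
because numerator and denominator of the conical metric scale alike. -/
lemma isVerticalTranslation_product (hb : 0 < b) {K : Set (Eu 3)} (hK : IsCompact K)
    (hne : K.Nonempty) (hKq : ∀ F ∈ K, b ^ 2 * (F 0 ^ 2 + F 1 ^ 2) + F 2 ^ 2 = 1) :
    IsVerticalTranslation (productSpaceMetric (b ^ 2)) (productSpaceProj (b ^ 2) ⁻¹' K)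
      (fun q => Real.log ‖q.1‖ / b) (dilation b) (dilation (-b)) where
  smooth_height q := by
    have h : ContDiffAt ℝ ∞ (fun P : Eu 3 => Real.log ‖P‖ / b) q.1 :=
      ((contDiffAt_norm ℝ q.2).log (norm_ne_zero_iff.mpr q.2)).div_const b
    exact h.contMDiffAt.comp q (contMDiff_subtype_val q)
  smooth := contMDiff_dilation b
  smooth' := contMDiff_dilation (-b)
  right_inv q := Subtype.ext (by
    change Real.exp b • Real.exp (-b) • q.1 = q.1
    rw [smul_smul, ← Real.exp_add, add_neg_cancel, Real.exp_zero, one_smul])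
  left_inv q := Subtype.ext (by
    change Real.exp (-b) • Real.exp b • q.1 = q.1
    rw [smul_smul, ← Real.exp_add, neg_add_cancel, Real.exp_zero, one_smul])
  isometry q u u' := by
    have hs := contMDiff_dilation (-b) q
    rw [pullback_pullback _ (mdifferentiable_val _) (hs.mdifferentiableAt (by simp))]
    have he : Subtype.val ∘ dilation (-b) =
        (fun P : Eu 3 => Real.exp (-b) • P) ∘ Subtype.val := rfl
    have hd : DifferentiableAt ℝ (fun P : Eu 3 => Real.exp (-b) • P) q.1 := by fun_prop
    have hf : fderiv ℝ (fun P : Eu 3 => Real.exp (-b) • P) q.1 =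
        Real.exp (-b) • ContinuousLinearMap.id ℝ (Eu 3) :=
      ((hasFDerivAt_id q.1).const_smul (Real.exp (-b))).fderiv
    rw [he, ← pullback_pullback _ hd.mdifferentiableAt (mdifferentiable_val _), pullback_apply,
      pullback_apply, dmf_eq_fderiv, hf]
    change (b ^ 2 * ‖q.1‖ ^ 2)⁻¹ * inner ℝ (dmf 3 3 Subtype.val q u) (dmf 3 3 Subtype.val q u') =
      (b ^ 2 * ‖Real.exp (-b) • q.1‖ ^ 2)⁻¹ * inner ℝ (Real.exp (-b) • dmf 3 3 Subtype.val q u)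
        (Real.exp (-b) • dmf 3 3 Subtype.val q u')
    have hq : ‖q.1‖ ≠ 0 := norm_ne_zero_iff.mpr q.2
    have hexp := (Real.exp_pos (-b)).ne'
    rw [norm_smul, Real.norm_eq_abs, abs_of_pos (Real.exp_pos (-b)), real_inner_smul_left,
      real_inner_smul_right]
    field_simp
  map_mem q hq := by
    change productSpaceProj _ (dilation b q) ∈ K
    rw [productSpaceProj_dilation]
    exact hq
  map_mem' q hq := by
    change productSpaceProj _ (dilation (-b) q) ∈ K
    rw [productSpaceProj_dilation]
    exact hq
  height_map q := by
    rw [norm_dilation, Real.log_mul (Real.exp_pos b).ne' (norm_ne_zero_iff.mpr q.2), Real.log_exp]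
    field_simp
    ring
  isCompact R := by
    rw [Subtype.isCompact_iff]
    have h1 : Subtype.val '' (productSpaceProj (b ^ 2) ⁻¹' K ∩
        (fun q => Real.log ‖q.1‖ / b) ⁻¹' Set.Icc 0 R) =
        (fun p : Eu 3 × ℝ => conePoint b p.1 p.2) '' (K ×ˢ Set.Icc 0 R) := by
      ext P
      constructor
      · rintro ⟨q, ⟨hq1, hq2⟩, rfl⟩
        exact ⟨(_, _), ⟨hq1, hq2⟩, conePoint_productSpaceProj hb q⟩
      · rintro ⟨⟨F, z⟩, ⟨hF, hz⟩, rfl⟩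
        refine ⟨⟨conePoint b F z, conePoint_ne_zero (hKq F hF) z⟩, ⟨?_, ?_⟩, rfl⟩
        · change productSpaceProj _ _ ∈ K
          rw [productSpaceProj_conePoint hb (hKq F hF) z _ rfl]
          exact hF
        · change Real.log ‖conePoint b F z‖ / b ∈ Set.Icc 0 R
          rw [norm_conePoint (hKq F hF), Real.log_exp, mul_div_cancel_left₀ _ hb.ne']
          exact hz
    rw [h1]
    refine (hK.prod isCompact_Icc).image ?_
    have hc : ∀ i : Fin 3, Continuous fun p : Eu 3 × ℝ => p.1 i := fun i =>
      (EuclideanSpace.proj i : Eu 3 →L[ℝ] ℝ).continuous.comp continuous_fst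
    have he : Continuous fun p : Eu 3 × ℝ => Real.exp (b * p.2) :=
      Real.continuous_exp.comp (continuous_const.mul continuous_snd)
    refine (PiLp.continuous_toLp 2 _).comp (continuous_pi fun i => ?_)
    fin_cases i
    · exact he.mul (continuous_const.mul (hc 0))
    · exact he.mul (continuous_const.mul (hc 1))
    · exact he.mul (hc 2)
  nonempty := by
    obtain ⟨F, hF⟩ := hne
    refine ⟨⟨conePoint b F (1 / 2), conePoint_ne_zero (hKq F hF) _⟩, ?_, ?_⟩
    · change productSpaceProj _ _ ∈ K
      rw [productSpaceProj_conePoint hb (hKq F hF) _ _ rfl]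
      exact hF
    · change Real.log ‖conePoint b F (1 / 2)‖ / b ∈ Set.Ioo (0 : ℝ) 1
      rw [norm_conePoint (hKq F hF), Real.log_exp, mul_div_cancel_left₀ _ hb.ne']
      norm_num

end Product

/-! ### The Berger spheres -/

section Berger

variable {b f τ : ℝ}

/-- The isometry `(z, w) ↦ (w, z)` of `ℂ²`. -/
def swapIso : Eu 4 ≃ₗᵢ[ℝ] Eu 4 := LinearIsometryEquiv.piLpCongrLeft 2 ℝ ℝ (Equiv.addRight 2)

lemma swapIso_apply (P : Eu 4) : swapIso P = !₂[P 2, P 3, P 0, P 1] := by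
  ext i
  fin_cases i <;> rfl

lemma hopfField_swapIso (P : Eu 4) : hopfField (swapIso P) = swapIso (hopfField P) := by
  rw [swapIso_apply, swapIso_apply]
  ext i
  fin_cases i <;> rfl

lemma bergerForm_swapIso (κ τ : ℝ) (P v w : Eu 4) :
    bergerForm κ τ (swapIso P) (swapIso v) (swapIso w) = bergerForm κ τ P v w := by
  simp only [bergerForm, hopfField_swapIso, LinearIsometryEquiv.inner_map_map]

/-- The Hopf map. -/
def hopfMap (b : ℝ) (P : Eu 4) : Eu 3 :=
  !₂[2 * (P 0 * P 2 + P 1 * P 3) / b, 2 * (P 1 * P 2 - P 0 * P 3) / b,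
    P 0 ^ 2 + P 1 ^ 2 - P 2 ^ 2 - P 3 ^ 2]

/-- Exchanging `z` and `w` conjugates `z w̄` and reverses the last component; this is the half turn
that moves the missing fibre into the chart. -/
lemma hopfMap_swapIso (b : ℝ) (P : Eu 4) : hopfMap b (swapIso P) = halfTurn (-1) (hopfMap b P) := by
  rw [swapIso_apply]
  ext i
  fin_cases i <;> simp [hopfMap] <;> ring

/-- The factor `√λ`. -/
def sqrtFactor (b : ℝ) (P : Eu 3) : ℝ := Real.sqrt (conformalFactor (b ^ 2) P)

lemma sqrtFactor_sq (hb : 0 < b) (P : Eu 3) : sqrtFactor b P ^ 2 = conformalFactor (b ^ 2) P :=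
  Real.sq_sqrt (inv_pos.mpr (one_add_pos (by positivity) P)).le

lemma sqrtFactor_mul (hb : 0 < b) (P : Eu 3) :
    sqrtFactor b P ^ 2 * (1 + b ^ 2 / 4 * (P 0 ^ 2 + P 1 ^ 2)) = 1 := by
  rw [sqrtFactor_sq hb, conformalFactor_mul (by positivity)]

lemma sqrtFactor_pos (hb : 0 < b) (P : Eu 3) : 0 < sqrtFactor b P :=
  Real.sqrt_pos.mpr (inv_pos.mpr (one_add_pos (by positivity) P))

lemma contDiff_sqrtFactor (hb : 0 < b) : ContDiff ℝ ∞ (sqrtFactor b) :=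
  (contDiff_conformalFactor (by positivity)).sqrt
    fun P => (inv_pos.mpr (one_add_pos (by positivity) P)).ne'

lemma hasFDerivAt_sqrtFactor (hb : 0 < b) (P : Eu 3) :
    HasFDerivAt (sqrtFactor b) ((-(b ^ 2 / 4) * sqrtFactor b P ^ 3) •
      (P 0 • (EuclideanSpace.proj 0 : Eu 3 →L[ℝ] ℝ)
        + P 1 • (EuclideanSpace.proj 1 : Eu 3 →L[ℝ] ℝ))) P := by
  have h := (hasFDerivAt_conformalFactor (κ := b ^ 2) (by positivity) P).sqrt
    (inv_pos.mpr (one_add_pos (by positivity) P)).ne'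
  refine h.congr_fderiv ?_
  have hm := (sqrtFactor_pos hb P).ne'
  rw [smul_smul, ← sqrtFactor_sq hb]
  congr 1
  change 1 / (2 * √(sqrtFactor b P ^ 2)) * _ = _
  rw [Real.sqrt_sq (sqrtFactor_pos hb P).le]
  field_simp
  ring

variable (b f) in
/-- The immersion of the Cartan model, as a map to `ℂ²`. -/
def bergerMap (P : Eu 3) : Eu 4 :=
  !₂[sqrtFactor b P * Real.cos (f * P 2), sqrtFactor b P * Real.sin (f * P 2),
    b / 2 * (sqrtFactor b P * (P 0 * Real.cos (f * P 2) + P 1 * Real.sin (f * P 2))),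
    b / 2 * (sqrtFactor b P * (P 0 * Real.sin (f * P 2) - P 1 * Real.cos (f * P 2)))]

lemma contDiff_bergerMap (hb : 0 < b) : ContDiff ℝ ∞ (bergerMap b f) := by
  have hm := contDiff_sqrtFactor hb
  have h0 : ∀ i : Fin 3, ContDiff ℝ ∞ fun w : Eu 3 => w i := fun i =>
    (EuclideanSpace.proj i : Eu 3 →L[ℝ] ℝ).contDiff
  have hc : ContDiff ℝ ∞ fun w : Eu 3 => Real.cos (f * w 2) :=
    Real.contDiff_cos.comp (contDiff_const.mul (h0 2))
  have hs : ContDiff ℝ ∞ fun w : Eu 3 => Real.sin (f * w 2) :=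
    Real.contDiff_sin.comp (contDiff_const.mul (h0 2))
  rw [contDiff_euclidean]
  intro i
  fin_cases i
  · exact hm.mul hc
  · exact hm.mul hs
  · exact contDiff_const.mul (hm.mul (((h0 0).mul hc).add ((h0 1).mul hs)))
  · exact contDiff_const.mul (hm.mul (((h0 0).mul hs).sub ((h0 1).mul hc)))

lemma norm_bergerMap (hb : 0 < b) (P : Eu 3) : ‖bergerMap b f P‖ = 1 := by
  rw [EuclideanSpace.norm_eq, Real.sqrt_eq_one, Fin.sum_univ_four]
  simp only [Real.norm_eq_abs, sq_abs]
  have hcs := Real.cos_sq_add_sin_sq (f * P 2)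
  have hm := sqrtFactor_mul hb P
  set c := Real.cos (f * P 2)
  set s := Real.sin (f * P 2)
  set m := sqrtFactor b P
  change (m * c) ^ 2 + (m * s) ^ 2 + (b / 2 * (m * (P 0 * c + P 1 * s))) ^ 2
    + (b / 2 * (m * (P 0 * s - P 1 * c))) ^ 2 = 1
  linear_combination m ^ 2 * (1 + b ^ 2 / 4 * (P 0 ^ 2 + P 1 ^ 2)) * hcs + hm

/-- In complex notation the map is `√λ exp(i f t) (1, (b/2)(x - i y))`. The phase cancels in `2 z w̄
/ b`, leaving `λ (x + i y)`. -/
lemma hopfMap_bergerMap (hb : 0 < b) (P : Eu 3) :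
    hopfMap b (bergerMap b f P) = cartanBase (b ^ 2) P := by
  have hcs := Real.cos_sq_add_sin_sq (f * P 2)
  rw [cartanBase, ← sqrtFactor_sq hb]
  set c := Real.cos (f * P 2) with hc
  set s := Real.sin (f * P 2) with hs
  set m := sqrtFactor b P with hm
  ext i
  fin_cases i
  · change 2 * (m * c * (b / 2 * (m * (P 0 * c + P 1 * s))) +
      m * s * (b / 2 * (m * (P 0 * s - P 1 * c)))) / b = m ^ 2 * P 0
    field_simp
    linear_combination m ^ 2 * P 0 * hcs
  · change 2 * (m * s * (b / 2 * (m * (P 0 * c + P 1 * s))) -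
      m * c * (b / 2 * (m * (P 0 * s - P 1 * c)))) / b = m ^ 2 * P 1
    field_simp
    linear_combination m ^ 2 * P 1 * hcs
  · change (m * c) ^ 2 + (m * s) ^ 2 - (b / 2 * (m * (P 0 * c + P 1 * s))) ^ 2
      - (b / 2 * (m * (P 0 * s - P 1 * c))) ^ 2 = m ^ 2 * (1 - b ^ 2 / 4 * (P 0 ^ 2 + P 1 ^ 2))
    linear_combination m ^ 2 * (1 - b ^ 2 / 4 * (P 0 ^ 2 + P 1 ^ 2)) * hcs

lemma fderiv_bergerMap (hb : 0 < b) (P u : Eu 3) :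
    fderiv ℝ (bergerMap b f) P u =
      (let c := Real.cos (f * P 2)
       let s := Real.sin (f * P 2)
       let m := sqrtFactor b P
       let D := -(b ^ 2 / 4) * m ^ 3 * (P 0 * u 0 + P 1 * u 1)
       !₂[D * c - m * s * (f * u 2), D * s + m * c * (f * u 2),
        b / 2 * (D * (P 0 * c + P 1 * s) + m * (u 0 * c + u 1 * s)
          + m * (f * u 2) * (P 1 * c - P 0 * s)),
        b / 2 * (D * (P 0 * s - P 1 * c) + m * (u 0 * s - u 1 * c)
          + m * (f * u 2) * (P 0 * c + P 1 * s))]) := by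
  have hd : DifferentiableAt ℝ (bergerMap b f) P :=
    (contDiff_bergerMap hb).differentiable (by simp) P
  have hm := hasFDerivAt_sqrtFactor hb P
  have hc := (Real.hasDerivAt_cos (f * P 2)).comp_hasFDerivAt P
    ((hasFDerivAt_coord 2 P).const_mul f)
  have hs := (Real.hasDerivAt_sin (f * P 2)).comp_hasFDerivAt P
    ((hasFDerivAt_coord 2 P).const_mul f)
  have h0 := (hm.mul hc).fderiv
  have h1 := (hm.mul hs).fderiv
  have h2 := ((hm.mul (((hasFDerivAt_coord 0 P).mul hc).add
    ((hasFDerivAt_coord 1 P).mul hs))).const_mul (b / 2)).fderiv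
  have h3 := ((hm.mul (((hasFDerivAt_coord 0 P).mul hs).sub
    ((hasFDerivAt_coord 1 P).mul hc))).const_mul (b / 2)).fderiv
  ext i
  rw [fderiv_coord hd]
  fin_cases i
  · refine (congrArg (fun L => L u) h0).trans ?_
    simp
    ring
  · refine (congrArg (fun L => L u) h1).trans ?_
    simp
    ring
  · refine (congrArg (fun L => L u) h2).trans ?_
    simp
    ring
  · refine (congrArg (fun L => L u) h3).trans ?_
    simp
    ring

/-- By `hB`, the Euclidean metric pulls back to `(κ/4) λ² (dx² + dy²)` plus the square of the
component along `V`. With `f = κ / (4 τ)` this component is `f (dz + τ λ (y dx - x dy))`, and the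
total Berger weight `16 τ² / κ²` is exactly `f⁻²`. -/
lemma bergerForm_pullback_bergerMap (hb : 0 < b) (hτ : τ ≠ 0) (P u u' : Eu 3) :
    bergerForm (b ^ 2) τ (bergerMap b (b ^ 2 / (4 * τ)) P)
      (fderiv ℝ (bergerMap b (b ^ 2 / (4 * τ))) P u)
      (fderiv ℝ (bergerMap b (b ^ 2 / (4 * τ))) P u') = cartanMetric (b ^ 2) τ P u u' := by
  obtain ⟨f, hf⟩ : ∃ f, f = b ^ 2 / (4 * τ) := ⟨_, rfl⟩
  rw [← hf]
  have hcs := Real.cos_sq_add_sin_sq (f * P 2)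
  have hm := sqrtFactor_mul hb P
  have hA : ∀ u : Eu 3, inner ℝ (fderiv ℝ (bergerMap b f) P u) (hopfField (bergerMap b f P)) =
      f * u 2 + b ^ 2 / 4 * sqrtFactor b P ^ 2 * (P 1 * u 0 - P 0 * u 1) := by
    intro u
    rw [fderiv_bergerMap hb, PiLp.inner_apply, Fin.sum_univ_four]
    simp only [RCLike.inner_apply, conj_trivial, hopfField, bergerMap, PiLp.toLp_apply,
      Matrix.cons_val_zero, Matrix.cons_val_one, Matrix.cons_val]
    generalize sqrtFactor b P = m at *
    generalize Real.cos (f * P 2) = c at *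
    generalize Real.sin (f * P 2) = s at *
    generalize P 0 = x at *
    generalize P 1 = y at *
    linear_combination (m ^ 2 * (f * u 2) * (1 + b ^ 2 / 4 * (x ^ 2 + y ^ 2))
      + b ^ 2 / 4 * m ^ 2 * (y * u 0 - x * u 1)) * hcs + f * u 2 * hm
  have hB : inner ℝ (fderiv ℝ (bergerMap b f) P u) (fderiv ℝ (bergerMap b f) P u') =
      b ^ 2 / 4 * sqrtFactor b P ^ 4 * (u 0 * u' 0 + u 1 * u' 1) +
        (f * u 2 + b ^ 2 / 4 * sqrtFactor b P ^ 2 * (P 1 * u 0 - P 0 * u 1)) *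
        (f * u' 2 + b ^ 2 / 4 * sqrtFactor b P ^ 2 * (P 1 * u' 0 - P 0 * u' 1)) := by
    rw [fderiv_bergerMap hb, fderiv_bergerMap hb, PiLp.inner_apply, Fin.sum_univ_four]
    simp only [RCLike.inner_apply, conj_trivial,
      Matrix.cons_val_zero, Matrix.cons_val_one, Matrix.cons_val]
    generalize sqrtFactor b P = m at *
    generalize Real.cos (f * P 2) = c at *
    generalize Real.sin (f * P 2) = s at *
    generalize P 0 = x at *
    generalize P 1 = y at *
    generalize f * u 2 = p at *
    generalize f * u' 2 = p' at *
    generalize u 0 = a at *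
    generalize u 1 = d at *
    generalize u' 0 = a' at *
    generalize u' 1 = d' at *
    have hD : ∀ D D' : ℝ, (D' * c - m * s * p') * (D * c - m * s * p)
        + (D' * s + m * c * p') * (D * s + m * c * p)
        + b / 2 * (D' * (x * c + y * s) + m * (a' * c + d' * s) + m * p' * (y * c - x * s)) *
          (b / 2 * (D * (x * c + y * s) + m * (a * c + d * s) + m * p * (y * c - x * s)))
        + b / 2 * (D' * (x * s - y * c) + m * (a' * s - d' * c) + m * p' * (x * c + y * s)) *
          (b / 2 * (D * (x * s - y * c) + m * (a * s - d * c) + m * p * (x * c + y * s))) =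
        D * D' + m ^ 2 * p * p' + b ^ 2 / 4 * ((D * x + m * a + m * p * y) *
          (D' * x + m * a' + m * p' * y) + (-D * y - m * d + m * p * x) *
          (-D' * y - m * d' + m * p' * x)) := fun D D' => by
      linear_combination (D * D' + m ^ 2 * p * p' + b ^ 2 / 4 * ((D * x + m * a + m * p * y) *
          (D' * x + m * a' + m * p' * y) + (-D * y - m * d + m * p * x) *
          (-D' * y - m * d' + m * p' * x))) * hcs
    rw [hD]
    linear_combination ((b ^ 2 / 4) ^ 2 * m ^ 4 * (x * a + y * d) * (x * a' + y * d') + p * p'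
      - b ^ 2 / 4 * m ^ 2 * (a * a' + d * d')) * hm
  have hf' : f ≠ 0 := by rw [hf]; positivity
  rw [bergerForm, hA, hA, hB, cartanMetric, ← sqrtFactor_sq hb]
  have hb2 : b ^ 2 = 4 * τ * f := by rw [hf]; field_simp
  rw [hb2]
  field_simp
  ring

/-- The condition says that the first complex coordinate is nonzero. Its modulus is `√λ`, and its
argument divided by `f` is the height. -/
lemma exists_bergerMap_eq (hb : 0 < b) (hf : f ≠ 0) {P : Eu 4} (hP : ‖P‖ = 1)
    (hpos : 0 < 1 + hopfMap b P 2) :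
    ∃ z, bergerMap b f (cartanLift (hopfMap b P) z) = P := by
  have hn : P 0 ^ 2 + P 1 ^ 2 + P 2 ^ 2 + P 3 ^ 2 = 1 := by
    rw [EuclideanSpace.norm_eq, Real.sqrt_eq_one, Fin.sum_univ_four] at hP
    simpa only [Real.norm_eq_abs, sq_abs] using hP
  have hF2 : hopfMap b P 2 = P 0 ^ 2 + P 1 ^ 2 - P 2 ^ 2 - P 3 ^ 2 := rfl
  have hF0 : hopfMap b P 0 = 2 * (P 0 * P 2 + P 1 * P 3) / b := rfl
  have hF1 : hopfMap b P 1 = 2 * (P 1 * P 2 - P 0 * P 3) / b := rfl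
  have hsum : 1 + hopfMap b P 2 = 2 * (P 0 ^ 2 + P 1 ^ 2) := by rw [hF2]; linarith
  have hρ : 0 < P 0 ^ 2 + P 1 ^ 2 := by linarith
  have hquad : b ^ 2 * (hopfMap b P 0 ^ 2 + hopfMap b P 1 ^ 2) + hopfMap b P 2 ^ 2 = 1 := by
    rw [hF0, hF1, hF2]
    field_simp
    linear_combination (P 0 ^ 2 + P 1 ^ 2 + P 2 ^ 2 + P 3 ^ 2 + 1) * hn
  set w : ℂ := ⟨P 0, P 1⟩ with hw
  set ρ := ‖w‖ with hρdef
  have hρ2 : ρ ^ 2 = P 0 ^ 2 + P 1 ^ 2 := by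
    rw [hρdef, Complex.sq_norm, Complex.normSq_apply]; ring
  have hρ0 : 0 < ρ := by
    refine lt_of_le_of_ne (norm_nonneg _) fun h => ?_
    rw [← h] at hρ2
    linarith
  have hc : ρ * Real.cos (w.arg) = P 0 := Complex.norm_mul_cos_arg w
  have hs : ρ * Real.sin (w.arg) = P 1 := Complex.norm_mul_sin_arg w
  refine ⟨w.arg / f, ?_⟩
  have hm : sqrtFactor b (cartanLift (hopfMap b P) (w.arg / f)) = ρ := by
    rw [sqrtFactor, conformalFactor_cartanLift _ hquad hpos.ne', hsum, mul_div_cancel_left₀ _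
      two_ne_zero, ← hρ2, Real.sqrt_sq hρ0.le]
  have hz : f * cartanLift (hopfMap b P) (w.arg / f) 2 = w.arg := mul_div_cancel₀ _ hf
  have hx : cartanLift (hopfMap b P) (w.arg / f) 0 = 2 * (P 0 * P 2 + P 1 * P 3) / b / ρ ^ 2 := by
    change 2 * hopfMap b P 0 / (1 + hopfMap b P 2) = _
    rw [hsum, hF0, ← hρ2]
    field_simp
  have hy : cartanLift (hopfMap b P) (w.arg / f) 1 = 2 * (P 1 * P 2 - P 0 * P 3) / b / ρ ^ 2 := by
    change 2 * hopfMap b P 1 / (1 + hopfMap b P 2) = _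
    rw [hsum, hF1, ← hρ2]
    field_simp
  rw [bergerMap, hm, hz, hx, hy]
  have hc' : Real.cos w.arg = P 0 / ρ := by rw [← hc]; field_simp
  have hs' : Real.sin w.arg = P 1 / ρ := by rw [← hs]; field_simp
  rw [hc', hs']
  ext i
  fin_cases i
  · change ρ * (P 0 / ρ) = P 0
    field_simp
  · change ρ * (P 1 / ρ) = P 1
    field_simp
  · change b / 2 * (ρ * (2 * (P 0 * P 2 + P 1 * P 3) / b / ρ ^ 2 * (P 0 / ρ) +
      2 * (P 1 * P 2 - P 0 * P 3) / b / ρ ^ 2 * (P 1 / ρ))) = P 2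
    field_simp
    linear_combination -P 2 * hρ2
  · change b / 2 * (ρ * (2 * (P 0 * P 2 + P 1 * P 3) / b / ρ ^ 2 * (P 1 / ρ) -
      2 * (P 1 * P 2 - P 0 * P 3) / b / ρ ^ 2 * (P 0 / ρ))) = P 3
    field_simp
    linear_combination -P 3 * hρ2

variable (b τ) in
/-- The metric of `bergerSphere`. -/
abbrev bergerSphereMetric : MetricTensor 3 (Metric.sphere (0 : Eu 4) 1) :=
  (bergerForm (b ^ 2) τ).pullback Subtype.val

lemma mdifferentiable_sphere_val (p : Metric.sphere (0 : Eu 4) 1) :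
    MDifferentiableAt (𝓡 3) (𝓡 4) (Subtype.val : Metric.sphere (0 : Eu 4) 1 → Eu 4) p :=
  have : Fact (Module.finrank ℝ (Eu 4) = 3 + 1) := ⟨finrank_euclideanSpace_fin⟩
  (contMDiff_coe_sphere (n := 3) (m := ∞) p).mdifferentiableAt (by simp)

/-- Immersions of the Cartan model into the sphere. -/
lemma isCartanImmersion_sphere {σ : ℝ} {G : Eu 3 → Eu 4} (hG : ContDiff ℝ ∞ G)
    (hG1 : ∀ P, G P ∈ Metric.sphere (0 : Eu 4) 1)
    (hGm : ∀ P u u', bergerForm (b ^ 2) τ (G P) (fderiv ℝ G P u) (fderiv ℝ G P u') =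
      cartanMetric (b ^ 2) τ P u u')
    (hGp : ∀ P, hopfMap b (G P) = halfTurn σ (cartanBase (b ^ 2) P)) :
    IsCartanImmersion (b ^ 2) τ (bergerSphereMetric b τ) (fun q => hopfMap b q.1) σ
      (fun P => ⟨G P, hG1 P⟩) := by
  intro P _
  have : Fact (Module.finrank ℝ (Eu 4) = 3 + 1) := ⟨finrank_euclideanSpace_fin⟩
  have hs : ContMDiff (𝓡 3) (𝓡 3) ∞ fun P => (⟨G P, hG1 P⟩ : Metric.sphere (0 : Eu 4) 1) :=
    hG.contMDiff.codRestrict_sphere hG1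
  refine ⟨hs P, fun u u' => ?_, hGp P⟩
  rw [pullback_pullback _ (mdifferentiable_sphere_val _) ((hs P).mdifferentiableAt (by simp)),
    pullback_apply]
  have h : Subtype.val ∘ (fun P => (⟨G P, hG1 P⟩ : Metric.sphere (0 : Eu 4) 1)) = G := rfl
  rw [h, dmf_eq_fderiv]
  exact hGm P u u'

/-- The immersion `bergerMap` reaches every fibre except that of points with vanishing first complex
coordinate; composing with the coordinate swap, an isometry of the Berger metric, reaches that one.
-/
lemma hasFermiCoordinates_berger (hb : 0 < b) (hτ : τ ≠ 0) {k k' : ℝ} {γ v : ℝ → Eu 3}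
    (hγ : IsFrenetCurve (b ^ 2) k' γ v) (hk : k' ^ 2 = k ^ 2) :
    HasFermiCoordinates (b ^ 2) k (bergerSphereMetric b τ)
      ((fun q => hopfMap b q.1) ⁻¹' Set.range γ) := by
  have hf : b ^ 2 / (4 * τ) ≠ 0 := by positivity
  refine hasFermiCoordinates_of_cartan (τ := τ) hγ hk fun q s hq => ?_
  have hq1 : ‖q.1‖ = 1 := mem_sphere_zero_iff_norm.mp q.2
  by_cases hpos : 0 < 1 + γ s 2
  · obtain ⟨z, hz⟩ := exists_bergerMap_eq hb hf hq1 (by rw [hq]; exact hpos)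
    refine ⟨1, _, z, by norm_num, isCartanImmersion_sphere (contDiff_bergerMap hb)
      (fun P => mem_sphere_zero_iff_norm.mpr (norm_bergerMap hb P))
      (bergerForm_pullback_bergerMap hb hτ) (fun P => ?_), by simpa using hpos, Subtype.ext ?_⟩
    · rw [hopfMap_bergerMap hb]
      ext i
      fin_cases i <;> simp
    · have h1 : halfTurn 1 (γ s) = γ s := by
        ext i
        fin_cases i <;> simp
      change bergerMap b _ (cartanLift (halfTurn 1 (γ s)) z) = q.1
      rw [h1, ← hq, hz]
  · obtain ⟨z, hz⟩ := exists_bergerMap_eq hb hf (P := swapIso q.1)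
      (by rw [LinearIsometryEquiv.norm_map, hq1])
      (by rw [hopfMap_swapIso, hq]; simp; linarith)
    refine ⟨-1, _, z, by norm_num, isCartanImmersion_sphere
      (G := swapIso ∘ bergerMap b (b ^ 2 / (4 * τ)))
      (swapIso.contDiff.comp (contDiff_bergerMap hb))
      (fun P => mem_sphere_zero_iff_norm.mpr (by
        rw [Function.comp_apply, LinearIsometryEquiv.norm_map, norm_bergerMap hb]))
      (fun P u u' => ?_) (fun P => ?_), by simp; linarith, Subtype.ext ?_⟩
    · have hd : DifferentiableAt ℝ (bergerMap b (b ^ 2 / (4 * τ))) P :=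
        (contDiff_bergerMap hb).differentiable (by simp) P
      have h1 : ∀ u, fderiv ℝ (swapIso ∘ bergerMap b (b ^ 2 / (4 * τ))) P u =
          swapIso (fderiv ℝ (bergerMap b (b ^ 2 / (4 * τ))) P u) := fun u => by
        rw [LinearIsometryEquiv.comp_fderiv]
        rfl
      rw [h1, h1, Function.comp_apply, bergerForm_swapIso, bergerForm_pullback_bergerMap hb hτ]
    · rw [Function.comp_apply, hopfMap_swapIso, hopfMap_bergerMap hb]
    · change swapIso (bergerMap b _ (cartanLift (halfTurn (-1) (γ s)) z)) = q.1
      rw [← hq, ← hopfMap_swapIso, hz, swapIso_apply, swapIso_apply]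
      ext i
      fin_cases i <;> rfl

lemma isCompact_berger {K : Set (Eu 3)} (hK : IsCompact K) :
    IsCompact ((fun q : Metric.sphere (0 : Eu 4) 1 => hopfMap b q.1) ⁻¹' K) := by
  refine (hK.isClosed.preimage ?_).isCompact
  have hc : ∀ i : Fin 4, Continuous fun q : Metric.sphere (0 : Eu 4) 1 => q.1 i := fun i =>
    (EuclideanSpace.proj i : Eu 4 →L[ℝ] ℝ).continuous.comp continuous_subtype_val
  refine (PiLp.continuous_toLp 2 _).comp (continuous_pi fun i => ?_)
  fin_cases i
  · exact (continuous_const.mul (((hc 0).mul (hc 2)).add ((hc 1).mul (hc 3)))).div_const _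
  · exact (continuous_const.mul (((hc 1).mul (hc 2)).sub ((hc 0).mul (hc 3)))).div_const _
  · exact ((((hc 0).pow 2).add ((hc 1).pow 2)).sub ((hc 2).pow 2)).sub ((hc 3).pow 2)

lemma nonempty_berger (hb : 0 < b) {F : Eu 3} (hF : b ^ 2 * (F 0 ^ 2 + F 1 ^ 2) + F 2 ^ 2 = 1) :
    ∃ q : Metric.sphere (0 : Eu 4) 1, hopfMap b q.1 = F := by
  obtain ⟨σ, hσ, hpos⟩ := exists_halfTurn_pos (F := F)
  -- The values `f = 1` and height `0` are arbitrary, because the Hopf map ignores the phase.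
  have h1 : hopfMap b (bergerMap b 1 (cartanLift (halfTurn σ F) 0)) = halfTurn σ F := by
    rw [hopfMap_bergerMap hb, cartanBase_cartanLift _ (halfTurn_quadric hσ hF) hpos.ne']
  set P := bergerMap b 1 (cartanLift (halfTurn σ F) 0) with hP
  have hP1 : ‖P‖ = 1 := norm_bergerMap hb _
  rcases sq_eq_one_iff.mp hσ with h | h
  · refine ⟨⟨P, mem_sphere_zero_iff_norm.mpr hP1⟩, h1.trans ?_⟩
    rw [h]
    ext i
    fin_cases i <;> simp
  · refine ⟨⟨swapIso P, mem_sphere_zero_iff_norm.mpr (by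
      rw [LinearIsometryEquiv.norm_map, hP1])⟩, ?_⟩
    change hopfMap b (swapIso P) = F
    rw [hopfMap_swapIso, h1, h, halfTurn_halfTurn (by norm_num)]

end Berger

/-! ### The cylinders of the homogeneous spaces -/

/-- The cylinders over the curve `γ` in `E` satisfy the hypotheses of `cylinder_stability`. -/
structure HasModelCylinder (κ k : ℝ) (γ : ℝ → Eu 3) (E : FiberedThreeSpace) : Prop where
  t2 : T2Space E.carrier
  secondCountable : SecondCountableTopology E.carrier
  fermi : HasFermiCoordinates κ k E.metric (E.proj ⁻¹' Set.range γ)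
  unstable : 0 < k ^ 2 + κ →
    (IsCompact (E.proj ⁻¹' Set.range γ) ∧ (E.proj ⁻¹' Set.range γ).Nonempty) ∨
      ∃ ζ T T', IsVerticalTranslation E.metric (E.proj ⁻¹' Set.range γ) ζ T T'

variable {κ τ k : ℝ} {γ : ℝ → Eu 3}

lemma hasModelCylinder_cartanSpace (hκ : κ ≤ 0) (hγ : IsCompleteCurve κ γ)
    (hk : HasGeodesicCurvature κ γ k) : HasModelCylinder κ k γ (cartanSpace κ τ) where
  t2 := inferInstanceAs (T2Space (cartanDomain κ))
  secondCountable := inferInstanceAs (SecondCountableTopology (cartanDomain κ))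
  fermi := by
    obtain ⟨k', hk', h⟩ := exists_isFrenetCurve hγ hk
    exact hasFermiCoordinates_cartan h hk'
  unstable hpos := by
    obtain ⟨k', hk', h⟩ := exists_isFrenetCurve hγ hk
    refine Or.inr ⟨_, _, _, isVerticalTranslation_cartan
      (h.isCompact_range (by rwa [hk'])) (Set.range_nonempty γ) ?_⟩
    rintro _ ⟨s, rfl⟩
    have hs := (hγ.2 s).1
    -- For `κ ≤ 0` the quadric was restricted to its upper sheet, so the stereographic denominator
    -- is positive everywhere.
    exact ⟨hs.1, by linarith [hs.2 hκ]⟩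

lemma hasModelCylinder_productSpace (hκ : 0 < κ) (hγ : IsCompleteCurve κ γ)
    (hk : HasGeodesicCurvature κ γ k) : HasModelCylinder κ k γ (productSpace κ) := by
  obtain ⟨b, hb, rfl⟩ : ∃ b : ℝ, 0 < b ∧ κ = b ^ 2 :=
    ⟨Real.sqrt κ, Real.sqrt_pos.mpr hκ, (Real.sq_sqrt hκ.le).symm⟩
  obtain ⟨k', hk', h⟩ := exists_isFrenetCurve hγ hk
  refine ⟨inferInstanceAs (T2Space puncturedSpace),
    inferInstanceAs (SecondCountableTopology puncturedSpace),
    hasFermiCoordinates_product hb h hk', fun hpos => Or.inr ⟨_, _, _,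
      isVerticalTranslation_product hb (h.isCompact_range (by rwa [hk'])) (Set.range_nonempty γ) ?_⟩⟩
  rintro _ ⟨s, rfl⟩
  exact (hγ.2 s).1.1

/-- The ambient sphere is compact, so the preimage of the closed curve is compact and no vertical
translation is required. -/
lemma hasModelCylinder_bergerSphere (hκ : 0 < κ) (hτ : τ ≠ 0) (hγ : IsCompleteCurve κ γ)
    (hk : HasGeodesicCurvature κ γ k) : HasModelCylinder κ k γ (bergerSphere κ τ) := by
  obtain ⟨b, hb, rfl⟩ : ∃ b : ℝ, 0 < b ∧ κ = b ^ 2 :=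
    ⟨Real.sqrt κ, Real.sqrt_pos.mpr hκ, (Real.sq_sqrt hκ.le).symm⟩
  obtain ⟨k', hk', h⟩ := exists_isFrenetCurve hγ hk
  have hproj : (bergerSphere (b ^ 2) τ).proj =
      fun q : Metric.sphere (0 : Eu 4) 1 => hopfMap b q.1 := by
    simp only [bergerSphere, Real.sqrt_sq hb.le]
    rfl
  refine ⟨inferInstanceAs (T2Space (Metric.sphere (0 : Eu 4) 1)),
    inferInstanceAs (SecondCountableTopology (Metric.sphere (0 : Eu 4) 1)), ?_, fun hpos =>
      Or.inl ?_⟩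
  · rw [hproj]
    exact hasFermiCoordinates_berger hb hτ h hk'
  · rw [hproj]
    refine ⟨isCompact_berger (h.isCompact_range (by rwa [hk'])), ?_⟩
    obtain ⟨q, hq⟩ := nonempty_berger hb (hγ.2 0).1.1
    exact ⟨q, 0, hq.symm⟩

lemma hasModelCylinder_homogeneousSpace (κ τ : ℝ) (hγ : IsCompleteCurve κ γ)
    (hk : HasGeodesicCurvature κ γ k) : HasModelCylinder κ k γ (homogeneousSpace κ τ) := by
  unfold homogeneousSpace
  split_ifs with h1 h2
  · exact hasModelCylinder_cartanSpace h1 hγ hk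
  · exact hasModelCylinder_productSpace (not_le.mp h1) hγ hk
  · exact hasModelCylinder_bergerSphere (not_le.mp h1) h2 hγ hk

end

theorem mainTheorem8 (κ τ k : ℝ) (γ : ℝ → Eu 3)
    (hγ : IsCompleteCurve κ γ) (hk : HasGeodesicCurvature κ γ k)
    {S : Type*} [TopologicalSpace S] [ChartedSpace (Eu 2) S] [IsManifold (𝓡 2) ∞ S]
    [MeasurableSpace S] [BorelSpace S]
    (x : S → (homogeneousSpace κ τ).carrier)
    (hx : IsSmoothEmbedding (𝓡 2) (𝓡 3) ∞ x)
    (hC : Set.range x = (homogeneousSpace κ τ).proj ⁻¹' Set.range γ)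
    (η : (p : S) → TangentSpace (𝓡 3) (x p))
    (hη : IsUnitNormal (homogeneousSpace κ τ).metric x η) :
    (IsStableSurface (homogeneousSpace κ τ).metric x η ↔ κ ≤ -k ^ 2) ∧
    (∀ f : S → ℝ, ContMDiff (𝓡 2) 𝓘(ℝ, ℝ) ∞ f → ∀ p : S,
      stabilityOperator (homogeneousSpace κ τ).metric x η f p =
        laplacian ((homogeneousSpace κ τ).metric.pullback x : MetricTensor 2 S) f p
          + (k ^ 2 + κ) * f p) ∧
    IsFlatMetric ((homogeneousSpace κ τ).metric.pullback x : MetricTensor 2 S) := by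
  have h := hasModelCylinder_homogeneousSpace κ τ hγ hk
  have := h.t2
  have := h.secondCountable
  exact cylinder_stability h.fermi h.unstable hx hC η hη
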